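/- **Setting.** Fix an integer $r\ge 5$. Let $F:\mathbb T^2\to\mathbb T^2$ ($\mathbb T^2=\mathbb R^2/\mathbb Z^2$) be a surjective $C^r$ map with $C^r$ lift $\mathbf F(x,\theta)=(f(x,\theta),\theta+\omega(x,\theta))$ to $\mathbb R^2$, and let $\chi_u\in(0,1)$, $\chi_c\in(0,1]$, $0<\mu_-<1<\mu_+<\lambda_-\le\lambda_+$, $\iota_\star\in(0,1)$, $C_\star\ge1$. Put $\mathbf C_u=\{|\eta|\le\chi_u|\xi|\}$, $\mathbf C_c=\{|\xi|\le\chi_c|\eta|\}$, $\mu=\max\{\mu_+,\mu_-^{-1}\}$. Let $\Upsilon$ be the set of closed $C^r$ curves $\gamma:\mathbb T\to\mathbb T^2$ of homotopy class $(0,1)$ with $\gamma'\ne0$ and $\gamma'\in\mathbf C_c$. $F$ is a *strongly dominated vertical partially hyperbolic system* (SVPH), with these constants, if: * (H0) $\det D_zF>0$ for all $z$; * (H1) $D_zF\,\mathbf C_u\subset\{|\eta|\le\iota_\star\chi_u|\xi|\}$, $(D_zF)^{-1}\mathbf C_c\subset\{|\xi|\le\iota_\star\chi_c|\eta|\}$,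 and for all $z$ and $n\in\mathbb N$: $C_\star^{-1}\mu_-^n\le\|(D_zF^n)^{-1}v\|/\|v\|\le C_\star\mu_+^n$ for $0\neq v\in\mathbf C_c$, and $C_\star^{-1}\lambda_-^n\le\|D_zF^nv\|/\|v\|\le C_\star\lambda_+^n$ for $v\notin\mathbf C_c$; * (H2) for each $\gamma\in\Upsilon$ the set $F^{-1}(\gamma)$ is a finite union of curves $\gamma_i\in\Upsilon$, where $F\circ\gamma_i$ is $\gamma$ up to an orientation preserving $C^r$ reparametrization of the circle; * (H3) $\mu^{6(r+1)!}<\lambda_-$; * (H4) $\partial_xf(p)>\max\{2(1+\|\partial_x\omega\|_\infty),|\partial_\theta f(p)|\}$ for all $p$, and (H1) also holds for some choice of constants with $\chi_c=1$. A constant is *uniform* if, for each $M$, it can be chosen the same (for fixed $r$) for all SVPH $F$ for which the derivatives of $\mathbf F$ of orders $1,\dots,r$, and $(\lambda_--\mu_+)^{-1}$, $\chi_c^{-1}$, $(1-\chi_u)^{-1}$, $(1-\iota_\star)^{-1}$, $C_\star$ are all bounded by $M$. For $c>0$ and $1\le j\le r$ let $\Gamma_j(c)$ be the set of $\gamma\in\Upsilon$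 of the form $\gamma(t)=(\gamma_1(t),t)$ with $\|\gamma^{(\ell)}(t)\|\le c^{(\ell-1)!}$ for $2\le\ell\le j$ and all $t$. Use the norms $\|g\|_{C^0}=\sup|g|$, $\|g\|_{C^{k+1}}=2^{k+1}\|g\|_{C^0}+\max_i\|\partial_ig\|_{C^k}$ (for $\omega$, the sup is over $[0,1]^2$) and, given $\mathbb c>0$, $$\|u\|_\rho=\max_{|\alpha|\le\rho}\ \sup_{\gamma\in\Gamma_r(\mathbb c)}\ \sup_{\phi\in C^{|\alpha|}(\mathbb T),\ \|\phi\|_{C^{|\alpha|}}=1}\ \int_{\mathbb T}\phi(t)\,(\partial^\alpha u)(\gamma(t))\,dt .$$ Let $\mathcal L u(z)=\sum_{y\in F^{-1}(z)}u(y)/|\det D_yF|$, $C_F=\chi_u+\|\omega\|_{C^r}$, $C_{\mu,n}=C_\sharp\frac{1-\mu^{-n}}{\mu-1}$, $a_\rho=(\rho-1)!\sum_{k=0}^{\rho-1}\frac1{k!}$, $\bar a_\rho=1+2a_\rho\rho^2+\rho$, $\bar b_\rho=(\rho!+1)(\rho^2+2)$, $\bar c_\rho=1+\max\{\rho+1,\rho(\rho+1)/2\}$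 and $\mathbb c_{\rho,F}=\mathbb c^{\rho!(2\rho+1)}(1+C_F\mathbb c^{\rho!})^{\bar c_\rho}$. **Theorem.** There are uniform constants $\bar n\in\mathbb N$, $C_\flat>1$, $C_\sharp>0$, and constants $C_{n,\rho}$ (uniform once $n,\rho,\mathbb c$ are fixed) such that for every SVPH $F$, every $\mathbb c>\frac94C_\flat^3\mu^{3\bar n}$ and every $n>\bar n$ the following holds. 1. For $1\le\ell\le r$ and $\gamma\in\Gamma_\ell(\mathbb c)$, the set $F^{-n}(\gamma)$ is a finite union of curves $\nu_i\in\Gamma_\ell(\mathbb c)$, where $F^n\circ\nu_i$ is $\gamma$ up to an orientation preserving $C^r$ reparametrization. 2. For every $u\in C^{r-1}(\mathbb T^2,\mathbb R)$ one has $\mathcal L^nu\in C^{r-1}(\mathbb T^2,\mathbb R)$, $$\|\mathcal L^nu\|_0\le(1+C_F\mathbb c)\,C_{\mu,n}\,\mu^n\,\|u\|_0,$$ and, for every integer $1\le\rho\le r-1$, $$\|\mathcal L^nu\|_\rho\le\mathbb c_{\rho,F}\,\frac{C_{\mu,n}^{\bar a_\rho}\,\mu^{\bar b_\rho n}}{\lambda_-^{\rho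 n}}\,\|u\|_\rho+C_{n,\rho}\,\|u\|_{\rho-1}.$$ -/

import Mathlib

open scoped Nat

noncomputable section

namespace SVPH

/-! ### The torus, smooth functions, norms -/

/-- The torus `𝕋² = ℝ²/ℤ²`. -/
abbrev Torus : Type := UnitAddCircle × UnitAddCircle

/-- The covering projection `ℝ² → 𝕋²`. -/
def proj (z : ℝ × ℝ) : Torus := ((z.1 : UnitAddCircle), (z.2 : UnitAddCircle))

/-- The representative in `[0,1)²` of a point of the torus. -/
def rep (p : Torus) : ℝ × ℝ :=
  ((AddCircle.equivIco (1 : ℝ) 0 p.1 : ℝ), (AddCircle.equivIco (1 : ℝ) 0 p.2 : ℝ))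

/-- The Euclidean norm on `ℝ²` (the default norm of `ℝ × ℝ` is the sup norm). -/
def eNorm (v : ℝ × ℝ) : ℝ := Real.sqrt (v.1 ^ 2 + v.2 ^ 2)

/-- The coordinate vectors `e₁`, `e₂`. -/
def unitVec (i : Fin 2) : ℝ × ℝ := if i = 0 then (1, 0) else (0, 1)

/-- The partial derivative `∂_{x_i}` of a function on the plane. -/
def partialD (i : Fin 2) (g : ℝ × ℝ → ℝ) (z : ℝ × ℝ) : ℝ := fderiv ℝ g z (unitVec i)

/-- `∂^α = ∂_{x_{α₁}} ⋯ ∂_{x_{α_k}}` for a word `α = (α₁, …, α_k)` in the indices, `|α| = k`. -/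
def partials : List (Fin 2) → (ℝ × ℝ → ℝ) → ℝ × ℝ → ℝ
  | [], g => g
  | i :: α, g => partialD i (partials α g)

/-- A function on the torus is of class `C^k`. -/
def IsCk (k : ℕ) (u : Torus → ℝ) : Prop := ContDiff ℝ k (fun z => u (proj z))

/-- The sup of `|g|` over the closed fundamental square `[0,1]²`. -/
def supSquare (g : ℝ × ℝ → ℝ) : ℝ :=
  sSup ((fun z => |g z|) '' (Set.Icc (0 : ℝ) 1 ×ˢ Set.Icc (0 : ℝ) 1))

/-- The weighted `C^k` norm
`‖g‖_{C^{k+1}} = 2^{k+1} ‖g‖_{C^0} + max_i ‖∂_{x_i} g‖_{C^k}`, with sups over `[0,1]²`. -/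
def ckNorm : ℕ → (ℝ × ℝ → ℝ) → ℝ
  | 0, g => supSquare g
  | k + 1, g =>
      2 ^ (k + 1) * supSquare g + max (ckNorm k (partialD 0 g)) (ckNorm k (partialD 1 g))

/-- The same weighted norm for a function on the circle, viewed as a `1`-periodic function:
`‖ψ‖_{C^{k+1}} = 2^{k+1} ‖ψ‖_{C^0} + ‖ψ'‖_{C^k}`. -/
def circleNorm : ℕ → (ℝ → ℝ) → ℝ
  | 0, ψ => sSup (Set.range fun t => |ψ t|)
  | k + 1, ψ => 2 ^ (k + 1) * sSup (Set.range fun t => |ψ t|) + circleNorm k (deriv ψ)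

/-! ### The maps -/

/-- `G : ℝ² → ℝ²` is a `C^r` lift of the torus map `F`. -/
def IsLift (r : ℕ) (F : Torus → Torus) (G : ℝ × ℝ → ℝ × ℝ) : Prop :=
  ContDiff ℝ r G ∧ ∀ z, F (proj z) = proj (G z)

/-- `D_z F^n`, computed with the lift `G`. -/
def dIter (G : ℝ × ℝ → ℝ × ℝ) (n : ℕ) (z : ℝ × ℝ) : ℝ × ℝ →L[ℝ] ℝ × ℝ := fderiv ℝ (G^[n]) z

/-- `ω` in the representation `F(x,θ) = (f(x,θ), θ + ω(x,θ))`. -/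
def omega (G : ℝ × ℝ → ℝ × ℝ) (z : ℝ × ℝ) : ℝ := (G z).2 - z.2

/-- The cone `{(ξ,η) : |η| ≤ χ |ξ|}` (unstable cone for `χ = χ_u`). -/
def coneU (χ : ℝ) : Set (ℝ × ℝ) := {v | |v.2| ≤ χ * |v.1|}

/-- The cone `{(ξ,η) : |ξ| ≤ χ |η|}` (central cone for `χ = χ_c`). -/
def coneC (χ : ℝ) : Set (ℝ × ℝ) := {v | |v.1| ≤ χ * |v.2|}

/-- The constants of the hyperbolicity hypothesis:
`χ_u, χ_c, μ_-, μ_+, λ_-, λ_+, ι_⋆, C_⋆`. -/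
structure HypConst where
  χu : ℝ
  χc : ℝ
  μm : ℝ
  μp : ℝ
  lm : ℝ
  lp : ℝ
  ι : ℝ
  Cs : ℝ

/-- `μ = max {μ_+, μ_-⁻¹}`. -/
def HypConst.μ (d : HypConst) : ℝ := max d.μp d.μm⁻¹

/-- The hyperbolicity hypothesis: constant invariant cones, and the bounds
`C_⋆⁻¹ μ_-^n ≤ ‖(D_zF^n)⁻¹ v‖/‖v‖ ≤ C_⋆ μ_+^n` for `0 ≠ v ∈ C_c` and
`C_⋆⁻¹ λ_-^n ≤ ‖D_zF^n v‖/‖v‖ ≤ C_⋆ λ_+^n` for `v ∉ C_c`.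
Vectors of the form `(D_zF^n)⁻¹ v` are written as vectors `w` with `D_zF^n w = v`. -/
structure Hyperbolic (G : ℝ × ℝ → ℝ × ℝ) (d : HypConst) : Prop where
  χu_pos : 0 < d.χu
  χu_lt : d.χu < 1
  χc_pos : 0 < d.χc
  χc_le : d.χc ≤ 1
  μm_pos : 0 < d.μm
  μm_lt : d.μm < 1
  one_lt_μp : 1 < d.μp
  μp_lt : d.μp < d.lm
  lm_le : d.lm ≤ d.lp
  ι_pos : 0 < d.ι
  ι_lt : d.ι < 1
  one_le_Cs : 1 ≤ d.Cs
  invU : ∀ z, ∀ v ∈ coneU d.χu, dIter G 1 z v ∈ coneU (d.ι * d.χu)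
  invC : ∀ z w, dIter G 1 z w ∈ coneC d.χc → w ∈ coneC (d.ι * d.χc)
  central : ∀ (n : ℕ) (z w : ℝ × ℝ), w ≠ 0 → dIter G n z w ∈ coneC d.χc →
    d.Cs⁻¹ * d.μm ^ n ≤ eNorm w / eNorm (dIter G n z w) ∧
      eNorm w / eNorm (dIter G n z w) ≤ d.Cs * d.μp ^ n
  expanding : ∀ (n : ℕ) (z v : ℝ × ℝ), v ∉ coneC d.χc →
    d.Cs⁻¹ * d.lm ^ n ≤ eNorm (dIter G n z v) / eNorm v ∧
      eNorm (dIter G n z v) / eNorm v ≤ d.Cs * d.lp ^ n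

/-! ### Closed curves in the central direction, described by their lifts to the plane -/

/-- The family `Υ`: (lifts of) closed `C^r` curves `γ : 𝕋 → 𝕋²` of homotopy class `(0,1)`, with
`γ' ≠ 0` and `γ'` in the central cone. -/
def Upsilon (r : ℕ) (χc : ℝ) : Set (ℝ → ℝ × ℝ) :=
  {γ | ContDiff ℝ r γ ∧ (∀ t, γ (t + 1) = γ t + (0, 1)) ∧
    ∀ t, deriv γ t ≠ 0 ∧ deriv γ t ∈ coneC χc}

/-- The set `Γ_j(c)`: curves of `Υ` parametrized by vertical length with
`‖γ^{(ℓ)}‖ ≤ c^{(ℓ-1)!}` for `2 ≤ ℓ ≤ j`. -/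
def Gam (r : ℕ) (χc : ℝ) (j : ℕ) (c : ℝ) : Set (ℝ → ℝ × ℝ) :=
  {γ | γ ∈ Upsilon r χc ∧ (∀ t, (γ t).2 = t) ∧
    ∀ l, 2 ≤ l → l ≤ j → ∀ t, eNorm (iteratedDeriv l γ t) ≤ c ^ (l - 1)!}

/-- (Lift of) an orientation preserving `C^r` diffeomorphism of the circle. -/
def IsCircleDiffeo (r : ℕ) (h : ℝ → ℝ) : Prop :=
  ContDiff ℝ r h ∧ (∀ t, h (t + 1) = h t + 1) ∧ ∀ t, 0 < deriv h t

/-- The preimage of the closed curve `γ` under `T` consists of finitely many closed curves `ν_i`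
belonging to `S`; each `T ∘ ν_i` is the curve `γ` up to a reparametrization. -/
def PreimageSplits (r : ℕ) (T : Torus → Torus) (γ : ℝ → ℝ × ℝ) (S : Set (ℝ → ℝ × ℝ)) : Prop :=
  ∃ (N : ℕ) (ν : Fin N → ℝ → ℝ × ℝ),
    (∀ i, ν i ∈ S ∧ ∃ h, IsCircleDiffeo r h ∧ ∀ t, T (proj (ν i t)) = proj (γ (h t))) ∧
    T ⁻¹' (Set.range fun t => proj (γ t)) = ⋃ i, Set.range fun t => proj (ν i t)

/-- `F`, with `C^r` lift `G` and hyperbolicity constants `d`, is a strongly dominated vertical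
partially hyperbolic system. -/
structure IsSVPH (r : ℕ) (F : Torus → Torus) (G : ℝ × ℝ → ℝ × ℝ) (d : HypConst) : Prop where
  lift : IsLift r F G
  surj : Function.Surjective F
  /-- orientation preserving local diffeomorphism -/
  det_pos : ∀ z, 0 < (dIter G 1 z).det
  /-- cone hyperbolicity -/
  hyp : Hyperbolic G d
  /-- preimages of closed central curves are closed central curves -/
  preimage : ∀ γ ∈ Upsilon r d.χc, PreimageSplits r F γ (Upsilon r d.χc)
  /-- pinching `μ^{6 (r+1)!} < λ_-` -/
  pinching : d.μ ^ (6 * (r + 1)!) < d.lm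
  /-- `∂_x f > 2 (1 + ‖∂_x ω‖_∞)`. -/
  expansion : ∀ z w, 2 * (1 + |partialD 0 (omega G) w|) < partialD 0 (fun y => (G y).1) z
  /-- `∂_x f > |∂_θ f|`. -/
  expansion' : ∀ z, |partialD 1 (fun y => (G y).1) z| < partialD 0 (fun y => (G y).1) z
  /-- The choice `χ_c = 1` is possible. -/
  wide : ∃ d' : HypConst, d'.χc = 1 ∧ Hyperbolic G d'

/-- All the quantities on which a *uniform* constant may depend (the `C^r` norm of `F`,
`(λ_- - μ_+)⁻¹`, `χ_c⁻¹`, `(1 - χ_u)⁻¹`, `(1 - ι_⋆)⁻¹` and `C_⋆`) are bounded by `M`. -/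
def UniformBound (r : ℕ) (M : ℝ) (G : ℝ × ℝ → ℝ × ℝ) (d : HypConst) : Prop :=
  (∀ k, 1 ≤ k → k ≤ r → ∀ z, ‖iteratedFDeriv ℝ k G z‖ ≤ M) ∧
    (d.lm - d.μp)⁻¹ ≤ M ∧ d.χc⁻¹ ≤ M ∧ (1 - d.χu)⁻¹ ≤ M ∧ (1 - d.ι)⁻¹ ≤ M ∧ d.Cs ≤ M

/-! ### Transfer operator and geometric norms -/

/-- The transfer operator `(L u)(z) = ∑_{y ∈ F⁻¹(z)} u(y) / |det D_y F|`. -/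
def transfer (F : Torus → Torus) (G : ℝ × ℝ → ℝ × ℝ) (u : Torus → ℝ) (z : Torus) : ℝ :=
  ∑ᶠ y ∈ F ⁻¹' {z}, u y / |(dIter G 1 (rep y)).det|

/-- The geometric norm `‖u‖_ρ`: the sup, over `|α| ≤ ρ`, over the admissible central curves
`γ ∈ Γ_r(c)` and over the test functions `ψ ∈ C^{|α|}(𝕋)` with `‖ψ‖_{C^{|α|}} = 1`, of
`∫_𝕋 ψ(t) (∂^α u)(γ(t)) dt`. -/
def geomNorm (r : ℕ) (χc c : ℝ) (ρ : ℕ) (u : Torus → ℝ) : ℝ :=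
  sSup {I | ∃ α : List (Fin 2), α.length ≤ ρ ∧ ∃ γ ∈ Gam r χc r c, ∃ ψ : ℝ → ℝ,
    ContDiff ℝ α.length ψ ∧ Function.Periodic ψ 1 ∧ circleNorm α.length ψ = 1 ∧
    I = ∫ t in (0 : ℝ)..1, ψ t * partials α (fun z => u (proj z)) (γ t)}

/-! ### The constants -/

/-- `C_{μ,n} = C_♯ (1 - μ^{-n}) / (μ - 1)`. -/
def Cmu (Csharp μ : ℝ) (n : ℕ) : ℝ := Csharp * ((1 - (μ ^ n)⁻¹) / (μ - 1))

/-- `C_F = χ_u + ‖ω‖_{C^r}`. -/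
def CF (r : ℕ) (G : ℝ × ℝ → ℝ × ℝ) (d : HypConst) : ℝ := d.χu + ckNorm r (omega G)

/-- `a_ρ = (ρ-1)! ∑_{k=0}^{ρ-1} 1/k!` (for `ρ ≥ 1`; every division is exact). -/
def aExp (ρ : ℕ) : ℕ := ∑ k ∈ Finset.range ρ, (ρ - 1)! / k !

/-- `ā_ρ = 1 + 2 a_ρ ρ² + ρ`. -/
def aBar (ρ : ℕ) : ℕ := 1 + 2 * aExp ρ * ρ ^ 2 + ρ

/-- `b̄_ρ = (ρ! + 1)(ρ² + 2)`. -/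
def bBar (ρ : ℕ) : ℕ := (ρ ! + 1) * (ρ ^ 2 + 2)

/-- `c̄_ρ = 1 + max {ρ + 1, ρ(ρ+1)/2}` (the division is exact). -/
def cBar (ρ : ℕ) : ℕ := 1 + max (ρ + 1) (ρ * (ρ + 1) / 2)

/-- `𝕔_{ρ,F} = 𝕔^{ρ!(2ρ+1)} (1 + C_F 𝕔^{ρ!})^{c̄_ρ}`. -/
def cRhoF (CFv c : ℝ) (ρ : ℕ) : ℝ := c ^ (ρ ! * (2 * ρ + 1)) * (1 + CFv * c ^ ρ !) ^ cBar ρ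

end SVPH

end

open SVPH

open scoped Nat

noncomputable section

namespace SVPH

/-! ### Functions on the line with derivatives at scale `R` -/

/-! Everything is lifted to the plane. The lift satisfies G(z + e₂) = G(z) + e₂ and G(z + e₁) = G(z)
+ (D, e) with D ≥ 1. Hence the preimage under F^n of a closed central graph x = g(t) consists of D^n
closed central graphs, obtained by pulling the translates g + j, 0 ≤ j < D^n, back n times under G
(`Sys.exists_pullback`, `Sys.preimage_range`). Such a sequence of pullbacks is a `Chain`. Write T
for the reparametrization from its last curve g_n to its first one (`climb`) and J = T'/det DG^n
(`jac`). Tangents are central, so T' lies between multiples of μ^{-n} and μ^n; and J is the inverse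
of the horizontal expansion measured across the curve (`Chain.jac_mul`), so it is at most a multiple
of λ₋^{-n}.

Backward invariance. Differentiating the invariance relation l times shows that the l-th derivative
of the pulled back curve is J T'^l times that of the curve, plus terms in derivatives of lower order
(`Chain.step_contraction`). Pinching makes products of these factors decay at a uniform rate
(`exists_pinching_rate`), and the bounds c^{(l-1)!} grow so fast with l that the lower order terms
are either smaller by a factor c or decay with the number of steps (`Chain.exists_bounds`). For n
and c large the bounds therefore reproduce themselves (`exists_backward_bounds`).

Norm inequality. On the plane, the n-th iterate of the transfer operator is a sum of D^n translates
of one function. After the substitution t = T(s), the pairing of ∂^α with ψ along γ becomes a sum of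
pairings along the D^n preimages of γ, which are admissible again, and each ∂_i becomes an operator
m₀∂₀ + m₁∂₁ whose coefficients are cofactors of DG^n divided by the determinant
(`Sys.pairing_transfer`). Modulo fewer derivatives of u the coefficients can be pulled out, and ∂₁
can be replaced by -g_n'∂₀, because the difference is the derivative along the curve, which
integration by parts moves to the test function (`Tested.exists_leading`). What is left of ∂₀ and ∂₁
is J∂₀ and -g'(T)J∂₀ (`Chain.pushCoef_leading`), so the leading term for |α| = ρ pairs ∂₀^ρ u with
ψ(T)(-g'(T))^m J·J^ρ, m being the number of letters 1 in α.

The factor J^ρ yields λ₋^{-ρn}. The remaining J is summed over the branches: at a fixed height the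
sum is bounded, since J is at most a multiple of the gap to the next branch and the gaps fill one
period (`Sys.sum_jac_le`); and each supremum is controlled by its mean at the price (1 + C_F c)S,
with S = 1 + μ + ⋯ + μ^{n-1}, by distortion (`Sys.exists_jac_sup`). The derivatives of the test
function live at scale c^{ρ!}S². Altogether the leading coefficient is a constant times (1 + C_F c)
c^{ρ!ρ} S^{2ρ+1} λ₋^{-ρn}. Since C_♯ S = C_{μ,n} μ^n, this lies within the asserted bound
(`Sys.leading_le`); all other terms go into ‖u‖_{ρ-1}. For ρ = 0 there is no remainder. -/

/-- `|f⁽ⁱ⁾| ≤ K Rⁱ` for `i ≤ N`. -/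
def Sc : ℕ → ℝ → ℝ → (ℝ → ℝ) → Prop
  | 0, K, _, f => Continuous f ∧ ∀ s, |f s| ≤ K
  | N + 1, K, R, f => Differentiable ℝ f ∧ (∀ s, |f s| ≤ K) ∧ Sc N (K * R) R (deriv f)

theorem Sc.bound {N : ℕ} {K R : ℝ} {f : ℝ → ℝ} (h : Sc N K R f) (s : ℝ) : |f s| ≤ K := by
  cases N with
  | zero => exact h.2 s
  | succ N => exact h.2.1 s

theorem Sc.nonneg {N : ℕ} {K R : ℝ} {f : ℝ → ℝ} (h : Sc N K R f) : 0 ≤ K :=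
  (abs_nonneg _).trans (h.bound 0)

theorem Sc.continuous {N : ℕ} {K R : ℝ} {f : ℝ → ℝ} (h : Sc N K R f) : Continuous f := by
  cases N with
  | zero => exact h.1
  | succ N => exact h.1.continuous

theorem Sc.of_succ {N : ℕ} : ∀ {K R : ℝ} {f : ℝ → ℝ}, Sc (N + 1) K R f → Sc N K R f := by
  induction N with
  | zero => exact fun h => ⟨h.1.continuous, h.2.1⟩
  | succ N ih => exact fun h => ⟨h.1, h.2.1, ih h.2.2⟩

theorem Sc.of_le {N N' : ℕ} {K R : ℝ} {f : ℝ → ℝ} (h : Sc N K R f) (hN : N' ≤ N) :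
    Sc N' K R f := by
  induction hN with
  | refl => exact h
  | step _ ih => exact ih h.of_succ

theorem Sc.mono {N : ℕ} : ∀ {K K' R : ℝ} {f : ℝ → ℝ}, Sc N K R f → K ≤ K' → 0 ≤ R →
    Sc N K' R f := by
  induction N with
  | zero => exact fun h hK _ => ⟨h.1, fun s => (h.2 s).trans hK⟩
  | succ N ih =>
    exact fun h hK hR => ⟨h.1, fun s => (h.2.1 s).trans hK,
      ih h.2.2 (mul_le_mul_of_nonneg_right hK hR) hR⟩

theorem Sc.mono_scale {N : ℕ} : ∀ {K R R' : ℝ} {f : ℝ → ℝ}, Sc N K R f → R ≤ R' → 0 ≤ R →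
    Sc N K R' f := by
  induction N with
  | zero => exact fun h _ _ => h
  | succ N ih =>
    intro K R R' f h hR hR0
    exact ⟨h.1, h.2.1, (ih h.2.2 hR hR0).mono (mul_le_mul_of_nonneg_left hR h.nonneg)
      (hR0.trans hR)⟩

theorem Sc.zero (N : ℕ) : ∀ {K : ℝ} (R : ℝ), 0 ≤ K → 0 ≤ R → Sc N K R (fun _ => 0) := by
  induction N with
  | zero => exact fun R hK _ => ⟨continuous_const, fun s => by simpa using hK⟩
  | succ N ih =>
    intro K R hK hR
    refine ⟨differentiable_const _, fun s => by simpa using hK, ?_⟩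
    have : deriv (fun _ : ℝ => (0 : ℝ)) = fun _ => 0 := by ext; simp
    rw [this]
    exact ih R (mul_nonneg hK hR) hR

theorem Sc.const (N : ℕ) (a : ℝ) {R : ℝ} (hR : 0 ≤ R) : Sc N |a| R (fun _ => a) := by
  cases N with
  | zero => exact ⟨continuous_const, fun s => le_rfl⟩
  | succ N =>
    refine ⟨differentiable_const _, fun s => le_rfl, ?_⟩
    have : deriv (fun _ : ℝ => a) = fun _ => 0 := by ext; simp
    rw [this]
    exact Sc.zero N R (by positivity) hR

theorem Sc.add {N : ℕ} : ∀ {K K' R : ℝ} {f g : ℝ → ℝ}, Sc N K R f → Sc N K' R g →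
    Sc N (K + K') R (fun s => f s + g s) := by
  induction N with
  | zero =>
    exact fun hf hg => ⟨hf.1.add hg.1, fun s => (abs_add_le _ _).trans (add_le_add (hf.2 s) (hg.2 s))⟩
  | succ N ih =>
    intro K K' R f g hf hg
    refine ⟨hf.1.add hg.1, fun s => (abs_add_le _ _).trans (add_le_add (hf.2.1 s) (hg.2.1 s)), ?_⟩
    have : deriv (fun s => f s + g s) = fun s => deriv f s + deriv g s := by
      ext s; exact deriv_fun_add (hf.1 s) (hg.1 s)
    rw [this, add_mul]
    exact ih hf.2.2 hg.2.2

theorem Sc.neg {N : ℕ} : ∀ {K R : ℝ} {f : ℝ → ℝ}, Sc N K R f → Sc N K R (fun s => -f s) := by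
  induction N with
  | zero => exact fun hf => ⟨hf.1.neg, fun s => by simpa using hf.2 s⟩
  | succ N ih =>
    intro K R f hf
    refine ⟨hf.1.neg, fun s => by simpa using hf.2.1 s, ?_⟩
    have : deriv (fun s => -f s) = fun s => -deriv f s := by ext s; exact deriv.fun_neg
    rw [this]
    exact ih hf.2.2

theorem Sc.sub {N : ℕ} {K K' R : ℝ} {f g : ℝ → ℝ} (hf : Sc N K R f) (hg : Sc N K' R g) :
    Sc N (K + K') R (fun s => f s - g s) := by
  simpa [sub_eq_add_neg] using hf.add hg.neg

/-- Leibniz' rule doubles the number of terms with each derivative, whence the power of 2. The scale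
is untouched, so a single R serves for all the factors of a product. -/
theorem Sc.mul {N : ℕ} : ∀ {K K' R : ℝ} {f g : ℝ → ℝ}, Sc N K R f → Sc N K' R g →
    Sc N (2 ^ N * (K * K')) R (fun s => f s * g s) := by
  induction N with
  | zero =>
    intro K K' R f g hf hg
    refine ⟨hf.1.mul hg.1, fun s => ?_⟩
    rw [abs_mul, pow_zero, one_mul]
    exact mul_le_mul (hf.2 s) (hg.2 s) (abs_nonneg _) hf.nonneg
  | succ N ih =>
    intro K K' R f g hf hg
    refine ⟨hf.1.mul hg.1, fun s => ?_, ?_⟩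
    · rw [abs_mul]
      refine (mul_le_mul (hf.bound s) (hg.bound s) (abs_nonneg _) hf.nonneg).trans ?_
      exact le_mul_of_one_le_left (mul_nonneg hf.nonneg hg.nonneg) (one_le_pow₀ (by norm_num))
    have : deriv (fun s => f s * g s) = fun s => deriv f s * g s + f s * deriv g s := by
      ext s; exact deriv_fun_mul (hf.1 s) (hg.1 s)
    rw [this]
    have := (ih hf.2.2 hg.of_succ).add (ih hf.of_succ hg.2.2)
    convert this using 1
    ring

/-- If `f` lives at scale `B` and `H'` has size `T` at scale `R`, then `f ∘ H` lives at
scale `R ≳ B T`. -/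
theorem Sc.comp (N : ℕ) : ∀ {Q : ℝ}, 1 ≤ Q → ∃ C : ℝ, 1 ≤ C ∧
    ∀ {K B T R : ℝ} {f H : ℝ → ℝ}, Sc N K B f → Differentiable ℝ H →
      (∀ m < N, Sc m T R (deriv H)) → 0 ≤ B → 0 ≤ R → B * T ≤ Q * R →
      Sc N (C * K) R (fun s => f (H s)) := by
  induction N with
  | zero =>
    refine fun {Q} _ => ⟨1, le_rfl, fun {K B T R f H} hf hH _ _ _ _ => ?_⟩
    exact ⟨hf.1.comp hH.continuous, fun s => by simpa using hf.2 _⟩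
  | succ N ih =>
    intro Q hQ
    obtain ⟨C, hC, h⟩ := ih hQ
    have hD : (1 : ℝ) ≤ 2 ^ N := one_le_pow₀ (by norm_num)
    have hE : 1 ≤ 2 ^ N * C * Q := one_le_mul_of_one_le_of_one_le
      (one_le_mul_of_one_le_of_one_le hD hC) hQ
    refine ⟨2 ^ N * C * Q, hE, fun {K B T R f H} hf hH hH' hB hR hBT => ?_⟩
    have hK := hf.nonneg
    refine ⟨hf.1.comp hH, fun s => ?_, ?_⟩
    · exact (hf.bound _).trans (le_mul_of_one_le_left hK hE)
    have : deriv (fun s => f (H s)) = fun s => deriv f (H s) * deriv H s := by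
      ext s; exact deriv_comp s (hf.1 _) (hH s)
    rw [this]
    have h1 := h hf.2.2 hH (fun m hm => hH' m (by omega)) hB hR hBT
    refine (h1.mul (hH' N (by omega))).mono ?_ hR
    have : 2 ^ N * (C * (K * B) * T) = 2 ^ N * C * K * (B * T) := by ring
    rw [this]
    have : 2 ^ N * C * Q * K * R = 2 ^ N * C * K * (Q * R) := by ring
    rw [this]
    exact mul_le_mul_of_nonneg_left hBT (by positivity)

/-- Solutions of `f' = L f`. -/
theorem Sc.of_deriv_eq_mul (N : ℕ) {K₁ : ℝ} (hK₁ : 0 ≤ K₁) : ∃ C : ℝ, 1 ≤ C ∧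
    ∀ {K R : ℝ} {f L : ℝ → ℝ}, Differentiable ℝ f → (∀ s, |f s| ≤ K) →
      (∀ s, deriv f s = L s * f s) → (∀ m < N, Sc m (K₁ * R) R L) → 0 ≤ R →
      Sc N (C * K) R f := by
  induction N with
  | zero =>
    exact ⟨1, le_rfl, fun {K R f L} hf hK _ _ _ => ⟨hf.continuous, by simpa using hK⟩⟩
  | succ N ih =>
    obtain ⟨C, hC, h⟩ := ih
    refine ⟨C + 2 ^ N * (K₁ * C), by
      have : 0 ≤ 2 ^ N * (K₁ * C) := by positivity
      linarith, fun {K R f L} hf hK hd hL hR => ?_⟩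
    have h1 := h hf hK hd (fun m hm => hL m (by omega)) hR
    have hK0 : 0 ≤ K := (abs_nonneg _).trans (hK 0)
    have hle : C * K ≤ (C + 2 ^ N * (K₁ * C)) * K := by
      apply mul_le_mul_of_nonneg_right _ hK0
      have : 0 ≤ 2 ^ N * (K₁ * C) := by positivity
      linarith
    refine ⟨hf, fun s => (h1.bound s).trans hle, ?_⟩
    have : deriv f = fun s => L s * f s := funext hd
    rw [this]
    refine ((hL N (by omega)).mul h1).mono ?_ hR
    have : 2 ^ N * (K₁ * R * (C * K)) = (2 ^ N * (K₁ * C)) * K * R := by ring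
    rw [this]
    apply mul_le_mul_of_nonneg_right _ hR
    apply mul_le_mul_of_nonneg_right _ hK0
    linarith

/-- Differentiation replaces 1/f by -f'/f². The constant depends on the order, the size and the
lower bound only, hence is uniform in the scale. -/
theorem Sc.inv (N : ℕ) {K δ : ℝ} (hK : 0 ≤ K) (hδ : 0 < δ) : ∃ C : ℝ, 0 ≤ C ∧
    ∀ {R : ℝ} {f : ℝ → ℝ}, Sc N K R f → (∀ s, δ ≤ f s) → 0 ≤ R →
      Sc N C R (fun s => (f s)⁻¹) := by
  induction N with
  | zero =>
    refine ⟨δ⁻¹, by positivity, fun {R f} hf hd _ => ?_⟩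
    refine ⟨hf.1.inv₀ fun s => (hδ.trans_le (hd s)).ne', fun s => ?_⟩
    rw [abs_of_pos (inv_pos.2 (hδ.trans_le (hd s)))]
    exact inv_anti₀ hδ (hd s)
  | succ N ih =>
    obtain ⟨C, hC, h⟩ := ih
    have hP : 0 ≤ 2 ^ N * (K * (2 ^ N * (C * C))) := by positivity
    refine ⟨C + 2 ^ N * (K * (2 ^ N * (C * C))), by positivity, fun {R f} hf hd hR => ?_⟩
    have hne : ∀ s, f s ≠ 0 := fun s => (hδ.trans_le (hd s)).ne'
    have h1 := h hf.of_succ hd hR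
    refine ⟨hf.1.inv hne, fun s => (h1.bound s).trans (by linarith), ?_⟩
    have : deriv (fun s => (f s)⁻¹) = fun s => -(deriv f s * ((f s)⁻¹ * (f s)⁻¹)) := by
      ext s
      rw [deriv_fun_inv'' (hf.1 s) (hne s)]
      field_simp
    rw [this]
    refine (hf.2.2.mul (h1.mul h1)).neg.mono ?_ hR
    nlinarith [mul_nonneg hC hR]

theorem Sc.pow {N : ℕ} {K R : ℝ} {f : ℝ → ℝ} (hf : Sc N K R f) (hR : 0 ≤ R) (m : ℕ) :
    Sc N ((2 ^ N * K) ^ m) R (fun s => f s ^ m) := by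
  induction m with
  | zero => simpa using Sc.const N 1 hR
  | succ m ih =>
    simp only [pow_succ]
    refine (ih.mul hf).mono (le_of_eq ?_) hR
    ring

theorem Sc.contDiff {N : ℕ} : ∀ {K R : ℝ} {f : ℝ → ℝ}, Sc N K R f → ContDiff ℝ N f := by
  induction N with
  | zero => exact fun h => contDiff_zero.2 h.1
  | succ N ih =>
    intro K R f h
    rw [Nat.cast_succ, contDiff_succ_iff_deriv]
    exact ⟨h.1, by simp, ih h.2.2⟩

theorem Sc.of_contDiff {N : ℕ} : ∀ {K R : ℝ} {f : ℝ → ℝ}, ContDiff ℝ N f →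
    (∀ i ≤ N, ∀ s, |iteratedDeriv i f s| ≤ K * R ^ i) → Sc N K R f := by
  induction N with
  | zero => exact fun h hb => ⟨h.continuous, fun s => by simpa using hb 0 le_rfl s⟩
  | succ N ih =>
    intro K R f h hb
    rw [Nat.cast_succ, contDiff_succ_iff_deriv] at h
    refine ⟨h.1, fun s => by simpa using hb 0 (by omega) s, ih h.2.2 fun i hi s => ?_⟩
    have := hb (i + 1) (by omega) s
    rw [iteratedDeriv_succ'] at this
    rw [mul_assoc, ← pow_succ']
    exact this

theorem Sc.iteratedDeriv {N : ℕ} : ∀ {K R : ℝ} {f : ℝ → ℝ}, Sc N K R f → ∀ i ≤ N, ∀ s,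
    |iteratedDeriv i f s| ≤ K * R ^ i := by
  induction N with
  | zero =>
    intro K R f h i hi s
    obtain rfl : i = 0 := by omega
    simpa using h.2 s
  | succ N ih =>
    intro K R f h i hi s
    cases i with
    | zero => simpa using h.2.1 s
    | succ i =>
      rw [iteratedDeriv_succ', pow_succ', ← mul_assoc]
      exact ih h.2.2 i (by omega) s

/-! ### Functions on the plane with bounded partial derivatives -/

theorem partialD_add {f g : ℝ × ℝ → ℝ} (hf : Differentiable ℝ f) (hg : Differentiable ℝ g)
    (i : Fin 2) : partialD i (fun z => f z + g z) = fun z => partialD i f z + partialD i g z := by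
  ext z
  simp [partialD, fderiv_fun_add (hf z) (hg z)]

theorem partialD_mul {f g : ℝ × ℝ → ℝ} (hf : Differentiable ℝ f) (hg : Differentiable ℝ g)
    (i : Fin 2) : partialD i (fun z => f z * g z) =
      fun z => partialD i f z * g z + f z * partialD i g z := by
  ext z
  simp [partialD, fderiv_fun_mul (hf z) (hg z)]
  ring

theorem partialD_neg (f : ℝ × ℝ → ℝ) (i : Fin 2) :
    partialD i (fun z => -f z) = fun z => -partialD i f z := by
  ext z
  simp [partialD]

theorem partialD_const (a : ℝ) (i : Fin 2) : partialD i (fun _ => a) = fun _ => 0 := by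
  ext z
  simp [partialD]

theorem fderiv_apply_eq (f : ℝ × ℝ → ℝ) (z v : ℝ × ℝ) :
    fderiv ℝ f z v = v.1 * partialD 0 f z + v.2 * partialD 1 f z := by
  have : v = v.1 • ((1 : ℝ), (0 : ℝ)) + v.2 • ((0 : ℝ), (1 : ℝ)) := by ext <;> simp
  conv_lhs => rw [this]
  rw [map_add, map_smul, map_smul]
  simp [partialD, unitVec]

theorem partialD_comp {f : ℝ × ℝ → ℝ} {P : ℝ × ℝ → ℝ × ℝ} (hf : Differentiable ℝ f)
    (hP : Differentiable ℝ P) (i : Fin 2) :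
    partialD i (fun z => f (P z)) = fun z =>
      partialD 0 f (P z) * partialD i (fun z => (P z).1) z +
      partialD 1 f (P z) * partialD i (fun z => (P z).2) z := by
  ext z
  have h := fderiv_comp z (hf (P z)) (hP z)
  have h1 : fderiv ℝ (fun z => (P z).1) z = (ContinuousLinearMap.fst ℝ ℝ ℝ).comp (fderiv ℝ P z) :=
    fderiv.fst (hP z)
  have h2 : fderiv ℝ (fun z => (P z).2) z = (ContinuousLinearMap.snd ℝ ℝ ℝ).comp (fderiv ℝ P z) :=
    fderiv.snd (hP z)
  have : partialD i (fun z => f (P z)) z = fderiv ℝ f (P z) (fderiv ℝ P z (unitVec i)) := by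
    simp only [partialD]
    change fderiv ℝ (f ∘ P) z _ = _
    rw [h]; rfl
  rw [this, fderiv_apply_eq]
  simp only [partialD, h1, h2]
  simp
  ring

/-- All partial derivatives of `f` of order at most `N` are bounded by `K`. -/
def Pl : ℕ → ℝ → (ℝ × ℝ → ℝ) → Prop
  | 0, K, f => Continuous f ∧ ∀ z, |f z| ≤ K
  | N + 1, K, f => Differentiable ℝ f ∧ (∀ z, |f z| ≤ K) ∧ ∀ i, Pl N K (partialD i f)

theorem Pl.bound {N : ℕ} {K : ℝ} {f : ℝ × ℝ → ℝ} (h : Pl N K f) (z : ℝ × ℝ) : |f z| ≤ K := by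
  cases N with
  | zero => exact h.2 z
  | succ N => exact h.2.1 z

theorem Pl.nonneg {N : ℕ} {K : ℝ} {f : ℝ × ℝ → ℝ} (h : Pl N K f) : 0 ≤ K :=
  (abs_nonneg _).trans (h.bound 0)

theorem Pl.continuous {N : ℕ} {K : ℝ} {f : ℝ × ℝ → ℝ} (h : Pl N K f) : Continuous f := by
  cases N with
  | zero => exact h.1
  | succ N => exact h.1.continuous

theorem Pl.of_succ {N : ℕ} : ∀ {K : ℝ} {f : ℝ × ℝ → ℝ}, Pl (N + 1) K f → Pl N K f := by
  induction N with
  | zero => exact fun h => ⟨h.1.continuous, h.2.1⟩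
  | succ N ih => exact fun h => ⟨h.1, h.2.1, fun i => ih (h.2.2 i)⟩

theorem Pl.of_le {N N' : ℕ} {K : ℝ} {f : ℝ × ℝ → ℝ} (h : Pl N K f) (hN : N' ≤ N) :
    Pl N' K f := by
  induction hN with
  | refl => exact h
  | step _ ih => exact ih h.of_succ

theorem Pl.mono {N : ℕ} : ∀ {K K' : ℝ} {f : ℝ × ℝ → ℝ}, Pl N K f → K ≤ K' → Pl N K' f := by
  induction N with
  | zero => exact fun h hK => ⟨h.1, fun s => (h.2 s).trans hK⟩
  | succ N ih =>
    exact fun h hK => ⟨h.1, fun s => (h.2.1 s).trans hK, fun i => ih (h.2.2 i) hK⟩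

theorem Pl.zero (N : ℕ) : ∀ {K : ℝ}, 0 ≤ K → Pl N K (fun _ => 0) := by
  induction N with
  | zero => exact fun hK => ⟨continuous_const, fun s => by simpa using hK⟩
  | succ N ih =>
    intro K hK
    refine ⟨differentiable_const _, fun s => by simpa using hK, fun i => ?_⟩
    rw [partialD_const]
    exact ih hK

theorem Pl.add {N : ℕ} : ∀ {K K' : ℝ} {f g : ℝ × ℝ → ℝ}, Pl N K f → Pl N K' g →
    Pl N (K + K') (fun s => f s + g s) := by
  induction N with
  | zero =>
    exact fun hf hg => ⟨hf.1.add hg.1, fun s => (abs_add_le _ _).trans (add_le_add (hf.2 s) (hg.2 s))⟩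
  | succ N ih =>
    intro K K' f g hf hg
    refine ⟨hf.1.add hg.1, fun s => (abs_add_le _ _).trans (add_le_add (hf.2.1 s) (hg.2.1 s)),
      fun i => ?_⟩
    rw [partialD_add hf.1 hg.1]
    exact ih (hf.2.2 i) (hg.2.2 i)

theorem Pl.neg {N : ℕ} : ∀ {K : ℝ} {f : ℝ × ℝ → ℝ}, Pl N K f → Pl N K (fun s => -f s) := by
  induction N with
  | zero => exact fun hf => ⟨hf.1.neg, fun s => by simpa using hf.2 s⟩
  | succ N ih =>
    intro K f hf
    refine ⟨hf.1.neg, fun s => by simpa using hf.2.1 s, fun i => ?_⟩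
    rw [partialD_neg]
    exact ih (hf.2.2 i)

theorem Pl.sub {N : ℕ} {K K' : ℝ} {f g : ℝ × ℝ → ℝ} (hf : Pl N K f) (hg : Pl N K' g) :
    Pl N (K + K') (fun s => f s - g s) := by
  simpa [sub_eq_add_neg] using hf.add hg.neg

theorem Pl.mul {N : ℕ} : ∀ {K K' : ℝ} {f g : ℝ × ℝ → ℝ}, Pl N K f → Pl N K' g →
    Pl N (2 ^ N * (K * K')) (fun s => f s * g s) := by
  induction N with
  | zero =>
    intro K K' f g hf hg
    refine ⟨hf.1.mul hg.1, fun s => ?_⟩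
    rw [abs_mul, pow_zero, one_mul]
    exact mul_le_mul (hf.2 s) (hg.2 s) (abs_nonneg _) hf.nonneg
  | succ N ih =>
    intro K K' f g hf hg
    refine ⟨hf.1.mul hg.1, fun s => ?_, fun i => ?_⟩
    · rw [abs_mul]
      refine (mul_le_mul (hf.bound s) (hg.bound s) (abs_nonneg _) hf.nonneg).trans ?_
      exact le_mul_of_one_le_left (mul_nonneg hf.nonneg hg.nonneg) (one_le_pow₀ (by norm_num))
    rw [partialD_mul hf.1 hg.1]
    have := (ih (hf.2.2 i) hg.of_succ).add (ih hf.of_succ (hg.2.2 i))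
    convert this using 1
    ring

theorem Pl.inv (N : ℕ) {K δ : ℝ} (hK : 0 ≤ K) (hδ : 0 < δ) : ∃ C : ℝ, 0 ≤ C ∧
    ∀ {f : ℝ × ℝ → ℝ}, Pl N K f → (∀ s, δ ≤ f s) → Pl N C (fun s => (f s)⁻¹) := by
  induction N with
  | zero =>
    refine ⟨δ⁻¹, by positivity, fun {f} hf hd => ?_⟩
    refine ⟨hf.1.inv₀ fun s => (hδ.trans_le (hd s)).ne', fun s => ?_⟩
    rw [abs_of_pos (inv_pos.2 (hδ.trans_le (hd s)))]
    exact inv_anti₀ hδ (hd s)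
  | succ N ih =>
    obtain ⟨C, hC, h⟩ := ih
    have hP : 0 ≤ 2 ^ N * (K * (2 ^ N * (C * C))) := by positivity
    refine ⟨C + 2 ^ N * (K * (2 ^ N * (C * C))), by positivity, fun {f} hf hd => ?_⟩
    have hne : ∀ s, f s ≠ 0 := fun s => (hδ.trans_le (hd s)).ne'
    have h1 := h hf.of_succ hd
    refine ⟨hf.1.inv hne, fun s => (h1.bound s).trans (by linarith), fun i => ?_⟩
    have : partialD i (fun s => (f s)⁻¹) = fun s => -(partialD i f s * ((f s)⁻¹ * (f s)⁻¹)) := by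
      ext s
      have := ((hasDerivAt_inv (hne s)).comp_hasFDerivAt s (hf.1 s).hasFDerivAt).fderiv
      change fderiv ℝ (Inv.inv ∘ f) s _ = _
      rw [this]
      simp only [partialD, _root_.smul_apply, smul_eq_mul]
      field_simp
    rw [this]
    exact ((hf.2.2 i).mul (h1.mul h1)).neg.mono (by linarith)

theorem Pl.comp (N : ℕ) {K' : ℝ} (hK' : 0 ≤ K') : ∃ C : ℝ, 1 ≤ C ∧
    ∀ {K : ℝ} {f : ℝ × ℝ → ℝ} {P : ℝ × ℝ → ℝ × ℝ}, Pl N K f → Differentiable ℝ P →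
      (∀ m < N, ∀ i, Pl m K' (partialD i fun z => (P z).1) ∧
        Pl m K' (partialD i fun z => (P z).2)) →
      Pl N (C * K) (fun z => f (P z)) := by
  induction N with
  | zero =>
    refine ⟨1, le_rfl, fun {K f P} hf hP _ => ?_⟩
    exact ⟨hf.1.comp hP.continuous, fun s => by simpa using hf.2 _⟩
  | succ N ih =>
    obtain ⟨C, hC, h⟩ := ih
    have hE : 0 ≤ 2 ^ N * (C * K') := by positivity
    refine ⟨C + 2 * (2 ^ N * (C * K')), by linarith, fun {K f P} hf hP hP' => ?_⟩
    have hK := hf.nonneg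
    refine ⟨hf.1.comp hP, fun s => ?_, fun i => ?_⟩
    · exact (hf.bound _).trans (le_mul_of_one_le_left hK (by linarith))
    rw [partialD_comp hf.1 hP]
    have h1 := fun j => h (hf.2.2 j) hP (fun m hm => hP' m (by omega))
    refine (((h1 0).mul (hP' N (by omega) i).1).add ((h1 1).mul (hP' N (by omega) i).2)).mono ?_
    nlinarith

theorem deriv_comp_graph {f : ℝ × ℝ → ℝ} {q : ℝ → ℝ} (hf : Differentiable ℝ f)
    (hq : Differentiable ℝ q) : deriv (fun s => f (q s, s)) =
      fun s => partialD 0 f (q s, s) * deriv q s + partialD 1 f (q s, s) := by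
  ext s
  have h1 : HasDerivAt (fun s => (q s, s)) (deriv q s, (1 : ℝ)) s :=
    (hq s).hasDerivAt.prodMk (hasDerivAt_id s)
  have := (HasFDerivAt.comp_hasDerivAt (f := fun s => (q s, s)) s
    (hf (q s, s)).hasFDerivAt h1).deriv
  change deriv (f ∘ fun s => (q s, s)) s = _
  rw [this, fderiv_apply_eq]
  ring

/-- The function on the plane lives at scale 1, so the composition inherits the scale R ≥ 1 of the
slope of the graph. -/
theorem Pl.comp_graph (N : ℕ) {T : ℝ} (hT : 0 ≤ T) : ∃ C : ℝ, 1 ≤ C ∧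
    ∀ {K R : ℝ} {f : ℝ × ℝ → ℝ} {q : ℝ → ℝ}, Pl N K f → Differentiable ℝ q →
      (∀ m < N, Sc m T R (deriv q)) → 1 ≤ R → Sc N (C * K) R (fun s => f (q s, s)) := by
  induction N with
  | zero =>
    refine ⟨1, le_rfl, fun {K R f q} hf hq _ _ => ?_⟩
    exact ⟨hf.1.comp (hq.continuous.prodMk continuous_id), fun s => by simpa using hf.2 _⟩
  | succ N ih =>
    obtain ⟨C, hC, h⟩ := ih
    have hE : 0 ≤ 2 ^ N * (C * T) := by positivity
    refine ⟨C + 2 ^ N * (C * T), by linarith, fun {K R f q} hf hq hq' hR => ?_⟩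
    have hK := hf.nonneg
    refine ⟨hf.1.comp (hq.prodMk differentiable_id), fun s => ?_, ?_⟩
    · exact (hf.bound _).trans (le_mul_of_one_le_left hK (by linarith))
    rw [deriv_comp_graph hf.1 hq]
    have h1 := fun j => h (hf.2.2 j) hq (fun m hm => hq' m (by omega)) hR
    refine (((h1 0).mul (hq' N (by omega))).add (h1 1)).mono ?_ (by linarith)
    have : 0 ≤ (2 ^ N * (C * T) + C) * K := by positivity
    nlinarith

theorem norm_unitVec_le (i : Fin 2) : ‖unitVec i‖ ≤ 1 := by
  fin_cases i <;> simp [unitVec, Prod.norm_def]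

theorem norm_iteratedFDeriv_partialD_le {n : ℕ} {f : ℝ × ℝ → ℝ} (hf : ContDiff ℝ (n + 1 : ℕ) f)
    (i : Fin 2) (z : ℝ × ℝ) :
    ‖iteratedFDeriv ℝ n (partialD i f) z‖ ≤ ‖iteratedFDeriv ℝ (n + 1) f z‖ := by
  let L : ((ℝ × ℝ) →L[ℝ] ℝ) →L[ℝ] ℝ := ContinuousLinearMap.apply ℝ ℝ (unitVec i)
  have hL : ‖L‖ ≤ 1 := by
    refine ContinuousLinearMap.opNorm_le_bound _ zero_le_one fun T => ?_
    have := T.le_opNorm (unitVec i)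
    simp only [L, ContinuousLinearMap.apply_apply, one_mul]
    exact this.trans (mul_le_of_le_one_right (norm_nonneg _) (norm_unitVec_le i))
  have hc : ContDiff ℝ n (fderiv ℝ f) := by
    have : ContDiff ℝ ((n : WithTop ℕ∞) + 1) f := by exact_mod_cast hf
    exact (contDiff_succ_iff_fderiv.1 this).2.2
  have := L.norm_iteratedFDeriv_comp_left (x := z) (hc.contDiffAt) le_rfl
  rw [norm_iteratedFDeriv_fderiv] at this
  refine le_trans ?_ (this.trans (mul_le_of_le_one_left (norm_nonneg _) hL))
  exact le_of_eq rfl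

theorem Pl.of_iteratedFDeriv {N : ℕ} : ∀ {K : ℝ} {f : ℝ × ℝ → ℝ}, ContDiff ℝ N f →
    (∀ i ≤ N, ∀ z, ‖iteratedFDeriv ℝ i f z‖ ≤ K) → Pl N K f := by
  induction N with
  | zero =>
    exact fun h hb => ⟨h.continuous, fun s => by simpa using hb 0 le_rfl s⟩
  | succ N ih =>
    intro K f h hb
    have hd : Differentiable ℝ f := h.differentiable (by simp)
    refine ⟨hd, fun s => by simpa using hb 0 (by omega) s, fun i => ih ?_ fun j hj z => ?_⟩
    · have : ContDiff ℝ ((N : WithTop ℕ∞) + 1) f := by exact_mod_cast h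
      exact ((contDiff_succ_iff_fderiv.1 this).2.2).clm_apply contDiff_const
    · refine (norm_iteratedFDeriv_partialD_le (h.of_le ?_) i z).trans (hb (j + 1) (by omega) z)
      exact_mod_cast (by omega : j + 1 ≤ N + 1)

theorem contDiff_partialD {N : ℕ} {f : ℝ × ℝ → ℝ} (h : ContDiff ℝ (N + 1 : ℕ) f) (i : Fin 2) :
    ContDiff ℝ N (partialD i f) := by
  have : ContDiff ℝ ((N : WithTop ℕ∞) + 1) f := by exact_mod_cast h
  exact ((contDiff_succ_iff_fderiv.1 this).2.2).clm_apply contDiff_const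

theorem partialD_comm {f : ℝ × ℝ → ℝ} (h : ContDiff ℝ 2 f) (i j : Fin 2) :
    partialD i (partialD j f) = partialD j (partialD i f) := by
  ext z
  have hs : IsSymmSndFDerivAt ℝ f z := (h.contDiffAt).isSymmSndFDerivAt (by simp)
  have hd : Differentiable ℝ (fderiv ℝ f) :=
    (h.fderiv_right (m := 1) (by norm_num)).differentiable (by simp)
  have key : ∀ k l, partialD k (partialD l f) z = fderiv ℝ (fderiv ℝ f) z (unitVec k) (unitVec l) := by
    intro k l
    simp only [partialD]
    have := (hd z).hasFDerivAt.clm_apply (hasFDerivAt_const (unitVec l) z)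
    change fderiv ℝ (fun y => (fderiv ℝ f y) (unitVec l)) z _ = _
    rw [this.fderiv]
    simp
  rw [key, key]
  exact hs _ _

end SVPH

namespace SVPH

/-! ### Linear algebra in the plane -/

/-- The determinant of a pair of plane vectors. -/
def cross (u v : ℝ × ℝ) : ℝ := u.1 * v.2 - u.2 * v.1

theorem clm_apply_eq (A : ℝ × ℝ →L[ℝ] ℝ × ℝ) (v : ℝ × ℝ) :
    A v = v.1 • A (1, 0) + v.2 • A (0, 1) := by
  have : v = v.1 • ((1 : ℝ), (0 : ℝ)) + v.2 • ((0 : ℝ), (1 : ℝ)) := by ext <;> simp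
  conv_lhs => rw [this]
  rw [map_add, map_smul, map_smul]

theorem clm_det_eq (A : ℝ × ℝ →L[ℝ] ℝ × ℝ) : A.det = cross (A (1, 0)) (A (0, 1)) := by
  have h := LinearMap.det_toMatrix (Module.Basis.finTwoProd ℝ) (A : ℝ × ℝ →ₗ[ℝ] ℝ × ℝ)
  change LinearMap.det (A : ℝ × ℝ →ₗ[ℝ] ℝ × ℝ) = _
  rw [← h, Matrix.det_fin_two]
  simp [LinearMap.toMatrix_apply, cross]
  ring

/-- The determinant identities of the dynamics are obtained by evaluating this on two well chosen
vectors. -/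
theorem cross_map (A : ℝ × ℝ →L[ℝ] ℝ × ℝ) (u v : ℝ × ℝ) :
    cross (A u) (A v) = A.det * cross u v := by
  rw [clm_det_eq, clm_apply_eq A u, clm_apply_eq A v]
  simp [cross]
  ring

theorem det_comp (A B : ℝ × ℝ →L[ℝ] ℝ × ℝ) : (A.comp B).det = A.det * B.det := by
  rw [clm_det_eq, clm_det_eq B, ← cross_map]
  rfl

theorem exists_clm_apply_eq {A : ℝ × ℝ →L[ℝ] ℝ × ℝ} (hA : A.det ≠ 0) (w : ℝ × ℝ) :
    ∃ v, A v = w := by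
  have hd := clm_det_eq A
  refine ⟨(cross w (A (0, 1)) / A.det, cross (A (1, 0)) w / A.det), ?_⟩
  rw [clm_apply_eq]
  rw [hd] at hA ⊢
  ext
  · simp only [Prod.fst_add, Prod.smul_fst, smul_eq_mul]
    field_simp
    simp [cross]; ring
  · simp only [Prod.snd_add, Prod.smul_snd, smul_eq_mul]
    field_simp
    simp [cross]; ring

theorem abs_fst_le_eNorm (v : ℝ × ℝ) : |v.1| ≤ eNorm v :=
  Real.abs_le_sqrt (by nlinarith [sq_nonneg v.2])

theorem abs_snd_le_eNorm (v : ℝ × ℝ) : |v.2| ≤ eNorm v :=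
  Real.abs_le_sqrt (by nlinarith [sq_nonneg v.1])

theorem eNorm_le (v : ℝ × ℝ) : eNorm v ≤ |v.1| + |v.2| := by
  refine Real.sqrt_le_iff.2 ⟨by positivity, ?_⟩
  nlinarith [sq_abs v.1, sq_abs v.2, abs_nonneg v.1, abs_nonneg v.2,
    mul_nonneg (abs_nonneg v.1) (abs_nonneg v.2)]

theorem eNorm_pos {v : ℝ × ℝ} (hv : v ≠ 0) : 0 < eNorm v := by
  by_contra h
  have h0 : eNorm v ≤ 0 := not_lt.1 h
  apply hv
  ext
  · exact abs_nonpos_iff.1 ((abs_fst_le_eNorm v).trans h0)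
  · exact abs_nonpos_iff.1 ((abs_snd_le_eNorm v).trans h0)

/-! ### The lifted dynamics -/

/-- The part of the hypotheses that concerns the lift: `(0, 1)` and `(D, e)` are the images of the
periods `(0, 1)` and `(1, 0)`. -/
structure Sys (r : ℕ) (M : ℝ) (G : ℝ × ℝ → ℝ × ℝ) (d : HypConst) (D : ℕ) (e : ℤ) : Prop where
  two_le : 2 ≤ r
  smooth : ContDiff ℝ r G
  det_pos : ∀ z, 0 < (dIter G 1 z).det
  hyp : Hyperbolic G d
  pinching : d.μ ^ (6 * (r + 1)!) < d.lm
  expansion : ∀ z w, 2 * (1 + |partialD 0 (omega G) w|) < partialD 0 (fun y => (G y).1) z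
  expansion' : ∀ z, |partialD 1 (fun y => (G y).1) z| < partialD 0 (fun y => (G y).1) z
  add_e₂ : ∀ z, G (z + (0, 1)) = G z + (0, 1)
  add_e₁ : ∀ z, G (z + (1, 0)) = G z + ((D : ℝ), (e : ℝ))
  D_pos : 0 < D
  bound : UniformBound r M G d

namespace Sys

variable {r : ℕ} {M : ℝ} {G : ℝ × ℝ → ℝ × ℝ} {d : HypConst} {D : ℕ} {e : ℤ}

theorem one_le_M (h : Sys r M G d D e) : 1 ≤ M := h.hyp.one_le_Cs.trans h.bound.2.2.2.2.2

theorem Cs_le (h : Sys r M G d D e) : d.Cs ≤ M := h.bound.2.2.2.2.2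

theorem one_lt_μ (h : Sys r M G d D e) : 1 < d.μ := h.hyp.one_lt_μp.trans_le (le_max_left _ _)

theorem μ_pos (h : Sys r M G d D e) : 0 < d.μ := zero_lt_one.trans h.one_lt_μ

theorem one_lt_lm (h : Sys r M G d D e) : 1 < d.lm := h.hyp.one_lt_μp.trans h.hyp.μp_lt

theorem lm_pos (h : Sys r M G d D e) : 0 < d.lm := zero_lt_one.trans h.one_lt_lm

theorem inv_M_le_lm_sub (h : Sys r M G d D e) : M⁻¹ ≤ d.lm - d.μp := by
  have h0 : 0 < d.lm - d.μp := sub_pos.2 h.hyp.μp_lt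
  rw [inv_le_comm₀ (zero_lt_one.trans_le h.one_le_M) h0]
  exact h.bound.2.1

theorem inv_M_le_one_sub (h : Sys r M G d D e) : M⁻¹ ≤ 1 - d.χu := by
  have h0 : 0 < 1 - d.χu := sub_pos.2 h.hyp.χu_lt
  rw [inv_le_comm₀ (zero_lt_one.trans_le h.one_le_M) h0]
  exact h.bound.2.2.2.1

theorem M_inv_pos (h : Sys r M G d D e) : 0 < M⁻¹ := inv_pos.2 (zero_lt_one.trans_le h.one_le_M)

theorem one_add_le_lm (h : Sys r M G d D e) : 1 + M⁻¹ ≤ d.lm := by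
  have := h.inv_M_le_lm_sub
  have := h.hyp.one_lt_μp
  linarith

theorem μ_le_lm (h : Sys r M G d D e) : d.μ ≤ d.lm :=
  (le_self_pow₀ h.one_lt_μ.le (by positivity)).trans h.pinching.le

theorem μ_pow_le (h : Sys r M G d D e) {k : ℕ} (hk : k ≤ 6 * (r + 1)!) : d.μ ^ k ≤ d.lm :=
  (pow_le_pow_right₀ h.one_lt_μ.le hk).trans h.pinching.le

theorem smooth_iter (h : Sys r M G d D e) (n : ℕ) : ContDiff ℝ r (G^[n]) := by
  induction n with
  | zero => exact contDiff_id
  | succ n ih =>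
    rw [Function.iterate_succ']
    exact h.smooth.comp ih

theorem r_ne (h : Sys r M G d D e) : r ≠ 0 := by have := h.two_le; omega

theorem differentiable_iter (h : Sys r M G d D e) (n : ℕ) : Differentiable ℝ (G^[n]) :=
  (h.smooth_iter n).differentiable (by exact_mod_cast h.r_ne)

theorem differentiable (h : Sys r M G d D e) : Differentiable ℝ G := h.differentiable_iter 1

theorem dIter_add (h : Sys r M G d D e) (m n : ℕ) (z : ℝ × ℝ) :
    dIter G (m + n) z = (dIter G m (G^[n] z)).comp (dIter G n z) := by
  simp only [dIter]
  rw [Function.iterate_add]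
  exact fderiv_comp z (h.differentiable_iter m _) (h.differentiable_iter n z)

theorem dIter_succ (h : Sys r M G d D e) (n : ℕ) (z : ℝ × ℝ) :
    dIter G (n + 1) z = (dIter G 1 (G^[n] z)).comp (dIter G n z) := by
  rw [add_comm, h.dIter_add]

theorem dIter_zero (z : ℝ × ℝ) : dIter G 0 z = ContinuousLinearMap.id ℝ (ℝ × ℝ) := by
  simp only [dIter, Function.iterate_zero]
  exact fderiv_id

theorem det_iter_pos (h : Sys r M G d D e) (n : ℕ) (z : ℝ × ℝ) : 0 < (dIter G n z).det := by
  induction n with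
  | zero => rw [dIter_zero, clm_det_eq]; simp [cross]
  | succ n ih =>
    rw [h.dIter_succ, det_comp]
    exact mul_pos (h.det_pos _) ih

theorem dIter_apply_ne (h : Sys r M G d D e) (n : ℕ) (z : ℝ × ℝ) {v : ℝ × ℝ} (hv : v ≠ 0) :
    dIter G n z v ≠ 0 := by
  intro h0
  have h1 := cross_map (dIter G n z) v
  apply hv
  have hd := (h.det_iter_pos n z).ne'
  ext
  · have := h1 (0, 1)
    rw [h0] at this
    simp [cross, hd] at this
    exact this
  · have := h1 (1, 0)
    rw [h0] at this
    simp [cross, hd] at this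
    exact this

theorem fderiv_fst (h : Sys r M G d D e) (n : ℕ) (z v : ℝ × ℝ) :
    fderiv ℝ (fun y => (G^[n] y).1) z v = (dIter G n z v).1 := by
  have := (h.differentiable_iter n z).hasFDerivAt.fst.fderiv
  rw [this]; rfl

theorem fderiv_snd (h : Sys r M G d D e) (n : ℕ) (z v : ℝ × ℝ) :
    fderiv ℝ (fun y => (G^[n] y).2) z v = (dIter G n z v).2 := by
  have := (h.differentiable_iter n z).hasFDerivAt.snd.fderiv
  rw [this]; rfl

theorem partialD_fst (h : Sys r M G d D e) (n : ℕ) (i : Fin 2) (z : ℝ × ℝ) :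
    partialD i (fun y => (G^[n] y).1) z = (dIter G n z (unitVec i)).1 := h.fderiv_fst n z _

theorem partialD_snd (h : Sys r M G d D e) (n : ℕ) (i : Fin 2) (z : ℝ × ℝ) :
    partialD i (fun y => (G^[n] y).2) z = (dIter G n z (unitVec i)).2 := h.fderiv_snd n z _

theorem dIter_apply (h : Sys r M G d D e) (n : ℕ) (z v : ℝ × ℝ) :
    dIter G n z v =
      (v.1 * partialD 0 (fun y => (G^[n] y).1) z + v.2 * partialD 1 (fun y => (G^[n] y).1) z,
       v.1 * partialD 0 (fun y => (G^[n] y).2) z + v.2 * partialD 1 (fun y => (G^[n] y).2) z) := by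
  rw [← fderiv_apply_eq, ← fderiv_apply_eq, h.fderiv_fst, h.fderiv_snd]

theorem det_eq (h : Sys r M G d D e) (n : ℕ) (z : ℝ × ℝ) :
    (dIter G n z).det =
      partialD 0 (fun y => (G^[n] y).1) z * partialD 1 (fun y => (G^[n] y).2) z -
      partialD 0 (fun y => (G^[n] y).2) z * partialD 1 (fun y => (G^[n] y).1) z := by
  rw [clm_det_eq, h.dIter_apply, h.dIter_apply]
  simp [cross]

theorem partialD_omega (h : Sys r M G d D e) (z : ℝ × ℝ) :
    partialD 0 (omega G) z = partialD 0 (fun y => (G y).2) z := by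
  have h1 : DifferentiableAt ℝ (fun y => (G y).2) z := (h.differentiable z).snd
  have h2 : HasFDerivAt (fun z : ℝ × ℝ => z.2) (ContinuousLinearMap.snd ℝ ℝ ℝ) z := hasFDerivAt_snd
  have := (h1.hasFDerivAt.fun_sub h2).fderiv
  simp only [partialD]
  change fderiv ℝ (fun z => (G z).2 - z.2) z _ = _
  rw [this]
  simp [unitVec]

theorem expand_fst (h : Sys r M G d D e) (z w : ℝ × ℝ) :
    2 * (1 + |partialD 0 (fun y => (G y).2) w|) < partialD 0 (fun y => (G y).1) z := by
  rw [← h.partialD_omega]; exact h.expansion z w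

/-! ### Cones -/

theorem coneU_iter (h : Sys r M G d D e) (n : ℕ) (z : ℝ × ℝ) {v : ℝ × ℝ} (hv : v ∈ coneU d.χu) :
    dIter G n z v ∈ coneU d.χu := by
  induction n with
  | zero => rw [dIter_zero]; exact hv
  | succ n ih =>
    rw [h.dIter_succ]
    have := h.hyp.invU (G^[n] z) _ ih
    simp only [coneU, Set.mem_ofPred_eq, ContinuousLinearMap.comp_apply] at this ⊢
    refine this.trans (mul_le_mul_of_nonneg_right ?_ (abs_nonneg _))
    nlinarith [h.hyp.ι_lt, h.hyp.χu_pos]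

theorem fst_iter_pos (h : Sys r M G d D e) (n : ℕ) (z : ℝ × ℝ) {v : ℝ × ℝ} (hv : v ∈ coneU d.χu)
    (hp : 0 < v.1) : 0 < (dIter G n z v).1 := by
  induction n with
  | zero => rw [dIter_zero]; exact hp
  | succ n ih =>
    have hc := h.coneU_iter n z hv
    rw [h.dIter_succ, ContinuousLinearMap.comp_apply]
    set u := dIter G n z v
    rw [h.dIter_apply]
    simp only [coneU, Set.mem_ofPred_eq, abs_of_pos ih] at hc
    have h1 := h.expansion' (G^[n] z)
    have h2 : |u.2| ≤ u.1 := hc.trans (mul_le_of_le_one_left ih.le h.hyp.χu_lt.le)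
    have h3 : |u.2 * partialD 1 (fun y => (G y).1) (G^[n] z)| <
        u.1 * partialD 0 (fun y => (G y).1) (G^[n] z) := by
      rw [abs_mul]
      have h4 := (abs_nonneg _).trans_lt h1
      calc _ ≤ u.1 * |partialD 1 (fun y => (G y).1) (G^[n] z)| :=
            mul_le_mul_of_nonneg_right h2 (abs_nonneg _)
        _ < _ := mul_lt_mul_of_pos_left h1 ih
    have := (abs_lt.1 h3).1
    simp only [Function.iterate_one]
    linarith

theorem coneC_iter (h : Sys r M G d D e) (n : ℕ) (z : ℝ × ℝ) {w : ℝ × ℝ}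
    (hw : dIter G n z w ∈ coneC d.χc) : w ∈ coneC d.χc := by
  induction n generalizing w with
  | zero => rw [dIter_zero] at hw; exact hw
  | succ n ih =>
    rw [h.dIter_succ, ContinuousLinearMap.comp_apply] at hw
    have := h.hyp.invC _ _ hw
    apply ih
    simp only [coneC, Set.mem_ofPred_eq] at this ⊢
    refine this.trans (mul_le_mul_of_nonneg_right ?_ (abs_nonneg _))
    nlinarith [h.hyp.ι_lt, h.hyp.χc_pos]

theorem e₁_mem (h : Sys r M G d D e) : ((1 : ℝ), (0 : ℝ)) ∈ coneU d.χu := by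
  simp [coneU, h.hyp.χu_pos.le]

theorem snd_le_of_mem (_h : Sys r M G d D e) {v : ℝ × ℝ} (hv : v ∈ coneU d.χu) (hp : 0 < v.1) :
    |v.2| ≤ d.χu * v.1 := by
  have : |v.2| ≤ d.χu * |v.1| := hv
  rwa [abs_of_pos hp] at this

theorem norm_eq_of_mem (h : Sys r M G d D e) {v : ℝ × ℝ} (hv : v ∈ coneU d.χu) (hp : 0 < v.1) :
    ‖v‖ = v.1 := by
  rw [Prod.norm_def, Real.norm_eq_abs, Real.norm_eq_abs, abs_of_pos hp]
  apply max_eq_left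
  exact (h.snd_le_of_mem hv hp).trans (mul_le_of_le_one_left hp.le h.hyp.χu_lt.le)

/-- As χ_u < 1 and χ_c ≤ 1, a nonzero vector of the unstable cone is outside the central cone and is
expanded. Its images stay in the unstable cone, where the Euclidean norm is at most twice the first
coordinate, so that coordinate alone can measure the size. -/
theorem lm_pow_le (h : Sys r M G d D e) (n : ℕ) (z : ℝ × ℝ) {v : ℝ × ℝ} (hv : v ∈ coneU d.χu)
    (hp : 0 < v.1) : d.lm ^ n * v.1 ≤ 2 * M * (dIter G n z v).1 := by
  have hnot : v ∉ coneC d.χc := by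
    intro hc
    have hc : |v.1| ≤ d.χc * |v.2| := hc
    rw [abs_of_pos hp] at hc
    have h1 := h.snd_le_of_mem hv hp
    have h2 : d.χc * |v.2| ≤ |v.2| := mul_le_of_le_one_left (abs_nonneg _) h.hyp.χc_le
    nlinarith [h.hyp.χu_lt]
  have hq := (h.hyp.expanding n z v hnot).1
  have hv0 : v ≠ 0 := by rintro rfl; simp at hp
  rw [le_div_iff₀ (eNorm_pos hv0)] at hq
  have hu := h.coneU_iter n z hv
  have hup := h.fst_iter_pos n z hv hp
  have h1 := eNorm_le (dIter G n z v)
  have h2 := h.snd_le_of_mem hu hup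
  rw [abs_of_pos hup] at h1
  have h3 : eNorm (dIter G n z v) ≤ 2 * (dIter G n z v).1 := by nlinarith [h.hyp.χu_lt]
  have h4 : v.1 ≤ eNorm v := (le_abs_self _).trans (abs_fst_le_eNorm v)
  have hC : 0 < d.Cs := zero_lt_one.trans_le h.hyp.one_le_Cs
  have hl : 0 < d.lm ^ n := pow_pos h.lm_pos n
  have h5 : d.lm ^ n * eNorm v ≤ d.Cs * eNorm (dIter G n z v) := by
    have := mul_le_mul_of_nonneg_left hq hC.le
    have e1 : d.Cs * (d.Cs⁻¹ * d.lm ^ n * eNorm v) = d.lm ^ n * eNorm v := by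
      field_simp
    linarith
  calc d.lm ^ n * v.1 ≤ d.lm ^ n * eNorm v := mul_le_mul_of_nonneg_left h4 hl.le
    _ ≤ d.Cs * eNorm (dIter G n z v) := h5
    _ ≤ M * (2 * (dIter G n z v).1) := mul_le_mul h.Cs_le h3 (Real.sqrt_nonneg _)
        (zero_le_one.trans h.one_le_M)
    _ = _ := by ring

theorem inv_pow_le_μ (h : Sys r M G d D e) (n : ℕ) : (d.μm ^ n)⁻¹ ≤ d.μ ^ n := by
  rw [← inv_pow]
  exact pow_le_pow_left₀ (inv_nonneg.2 h.hyp.μm_pos.le) (le_max_right _ _) n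

theorem eNorm_le_of_central (h : Sys r M G d D e) (n : ℕ) (z : ℝ × ℝ) {w : ℝ × ℝ} (hw : w ≠ 0)
    (hc : dIter G n z w ∈ coneC d.χc) :
    eNorm w ≤ M * d.μ ^ n * eNorm (dIter G n z w) ∧
      eNorm (dIter G n z w) ≤ M * d.μ ^ n * eNorm w := by
  obtain ⟨h1, h2⟩ := h.hyp.central n z w hw hc
  have hp := eNorm_pos (h.dIter_apply_ne n z hw)
  have hp' := eNorm_pos hw
  have hC : 0 < d.Cs := zero_lt_one.trans_le h.hyp.one_le_Cs
  have hμm : 0 < d.μm ^ n := pow_pos h.hyp.μm_pos n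
  constructor
  · rw [div_le_iff₀ hp] at h2
    refine h2.trans (mul_le_mul_of_nonneg_right ?_ hp.le)
    exact mul_le_mul h.Cs_le (pow_le_pow_left₀ (zero_le_one.trans h.hyp.one_lt_μp.le)
      (le_max_left _ _) n) (pow_nonneg (zero_le_one.trans h.hyp.one_lt_μp.le) n)
      (zero_le_one.trans h.one_le_M)
  · rw [le_div_iff₀ hp] at h1
    have : eNorm (dIter G n z w) ≤ d.Cs * (d.μm ^ n)⁻¹ * eNorm w := by
      have := mul_le_mul_of_nonneg_left h1 (by positivity : 0 ≤ d.Cs * (d.μm ^ n)⁻¹)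
      have e1 : d.Cs * (d.μm ^ n)⁻¹ * (d.Cs⁻¹ * d.μm ^ n * eNorm (dIter G n z w)) =
        eNorm (dIter G n z w) := by field_simp
      linarith
    refine this.trans (mul_le_mul_of_nonneg_right ?_ hp'.le)
    exact mul_le_mul h.Cs_le (h.inv_pow_le_μ n) (inv_nonneg.2 hμm.le)
      (zero_le_one.trans h.one_le_M)

/-- The preimage of a vertical vector is central by cone invariance, hence can be scaled to second
coordinate 1. Together with an unstable vector it is a basis in which DG^n is easy to estimate. -/
theorem exists_vertical (h : Sys r M G d D e) (n : ℕ) (z : ℝ × ℝ) :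
    ∃ a q : ℝ, |a| ≤ 1 ∧ dIter G n z (a, 1) = (0, q) ∧ 1 ≤ M * d.μ ^ n * |q| ∧
      |q| ≤ 2 * M * d.μ ^ n := by
  obtain ⟨w, hw⟩ := exists_clm_apply_eq (h.det_iter_pos n z).ne' ((0 : ℝ), (1 : ℝ))
  have hc : w ∈ coneC d.χc := h.coneC_iter n z (by rw [hw]; simp [coneC, h.hyp.χc_pos.le])
  have hc' : |w.1| ≤ |w.2| := by
    have hc : |w.1| ≤ d.χc * |w.2| := hc
    exact hc.trans (mul_le_of_le_one_left (abs_nonneg _) h.hyp.χc_le)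
  have hw2 : w.2 ≠ 0 := by
    intro h0
    rw [h0, abs_zero] at hc'
    have : w = 0 := Prod.ext (abs_nonpos_iff.1 hc') h0
    rw [this, map_zero] at hw
    simp [Prod.ext_iff] at hw
  have heq : (w.1 / w.2, (1 : ℝ)) = w.2⁻¹ • w := by
    ext
    · simp [div_eq_inv_mul]
    · simp [hw2]
  have ha : |w.1 / w.2| ≤ 1 := by
    rw [abs_div]; exact div_le_one_of_le₀ hc' (abs_nonneg _)
  have hA : dIter G n z (w.1 / w.2, 1) = (0, w.2⁻¹) := by
    rw [heq, map_smul, hw]; simp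
  refine ⟨w.1 / w.2, w.2⁻¹, ha, hA, ?_⟩
  have hne : (w.1 / w.2, (1 : ℝ)) ≠ 0 := by simp [Prod.ext_iff]
  have hcc : dIter G n z (w.1 / w.2, 1) ∈ coneC d.χc := by
    rw [hA]; simp only [coneC, Set.mem_ofPred_eq, abs_zero]
    exact mul_nonneg h.hyp.χc_pos.le (abs_nonneg _)
  obtain ⟨h1, h2⟩ := h.eNorm_le_of_central n z hne hcc
  rw [hA] at h1 h2
  have e1 : eNorm ((0 : ℝ), w.2⁻¹) ≤ |w.2⁻¹| := by simpa using eNorm_le ((0 : ℝ), w.2⁻¹)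
  have e2 : |w.2⁻¹| ≤ eNorm ((0 : ℝ), w.2⁻¹) := abs_snd_le_eNorm ((0 : ℝ), w.2⁻¹)
  have e3 : 1 ≤ eNorm (w.1 / w.2, (1 : ℝ)) := by
    simpa using abs_snd_le_eNorm (w.1 / w.2, (1 : ℝ))
  have e4 : eNorm (w.1 / w.2, (1 : ℝ)) ≤ 2 := by
    have := eNorm_le (w.1 / w.2, (1 : ℝ))
    simp only [abs_one] at this
    linarith
  have hMμ : 0 ≤ M * d.μ ^ n := mul_nonneg (zero_le_one.trans h.one_le_M) (pow_nonneg h.μ_pos.le n)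
  constructor
  · exact (e3.trans h1).trans (mul_le_mul_of_nonneg_left e1 hMμ)
  · refine (e2.trans h2).trans ((mul_le_mul_of_nonneg_left e4 hMμ).trans (le_of_eq (by ring)))

/-- The determinant of `DG^n` is uniformly bounded below. -/
theorem det_iter_ge (h : Sys r M G d D e) (n : ℕ) (z : ℝ × ℝ) :
    (2 * M ^ 2)⁻¹ ≤ (dIter G n z).det := by
  obtain ⟨a, q, -, hA, hq, -⟩ := h.exists_vertical n z
  -- The image of (a, 1) is vertical, so this reads det = v.1 · q. The growth λ₋^n of v.1 outweighs
  -- the possible decay μ^{-n} of q.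
  have hc := cross_map (dIter G n z) (1, 0) (a, 1)
  rw [hA] at hc
  simp only [cross] at hc
  set v := dIter G n z (1, 0) with hv
  have hvp : 0 < v.1 := h.fst_iter_pos n z h.e₁_mem (by simp)
  have hl := h.lm_pow_le n z h.e₁_mem (by simp)
  rw [← hv] at hl
  have hd := h.det_iter_pos n z
  have hdet : (dIter G n z).det = v.1 * |q| := by
    have : (dIter G n z).det = v.1 * q := by linarith
    rw [this] at hd ⊢
    rw [abs_of_pos ((mul_pos_iff_of_pos_left hvp).1 hd)]
  have hM := zero_lt_one.trans_le h.one_le_M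
  have hpow : d.μ ^ n ≤ d.lm ^ n := pow_le_pow_left₀ h.μ_pos.le h.μ_le_lm n
  rw [hdet, inv_le_iff_one_le_mul₀ (by positivity)]
  have h1 : M * d.μ ^ n * |q| ≤ M * (2 * M * v.1) * |q| := by
    apply mul_le_mul_of_nonneg_right _ (abs_nonneg _)
    apply mul_le_mul_of_nonneg_left _ hM.le
    simp only [mul_one] at hl
    exact hpow.trans hl
  calc (1 : ℝ) ≤ _ := hq
    _ ≤ _ := h1
    _ = _ := by ring

/-- Domination: unstable vectors realize the norm of `DG^m` up to a uniform constant. -/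
theorem norm_dIter_mul_le (h : Sys r M G d D e) (m : ℕ) (z v w : ℝ × ℝ) (hv : v ∈ coneU d.χu)
    (hp : 0 < v.1) :
    ‖dIter G m z w‖ * v.1 ≤ 20 * M ^ 3 * (dIter G m z v).1 * ‖w‖ := by
  obtain ⟨a, q, ha, hA, -, hq⟩ := h.exists_vertical m z
  have hM := zero_lt_one.trans_le h.one_le_M
  have hM1 := h.one_le_M
  have hv2 := h.snd_le_of_mem hv hp
  have hVp := h.fst_iter_pos m z hv hp
  have hVn := h.norm_eq_of_mem (h.coneU_iter m z hv) hVp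
  set V := dIter G m z v with hV
  have hden : M⁻¹ * v.1 ≤ v.1 - a * v.2 := by
    have h1 : |a * v.2| ≤ d.χu * v.1 := by
      rw [abs_mul]
      exact (mul_le_of_le_one_left (abs_nonneg _) ha).trans hv2
    have h2 := (abs_le.1 h1).2
    have h3 := mul_le_mul_of_nonneg_right h.inv_M_le_one_sub hp.le
    linarith
  have hden0 : 0 < v.1 - a * v.2 := (mul_pos h.M_inv_pos hp).trans_le hden
  have hw1 : |w.1| ≤ ‖w‖ := norm_fst_le w
  have hw2 : |w.2| ≤ ‖w‖ := norm_snd_le w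
  -- Coordinates of w in the basis formed by the unstable vector v and the vector (a, 1) with
  -- vertical image. The two are uniformly transverse, which bounds both coordinates.
  set α := (w.1 - a * w.2) / (v.1 - a * v.2) with hα
  set β := w.2 - α * v.2 with hβ
  have hdec : w = α • v + β • (a, (1 : ℝ)) := by
    ext
    · simp [hβ, hα]; field_simp; ring
    · simp [hβ]
  have hαb : |α| * v.1 ≤ 2 * M * ‖w‖ := by
    have h1 : |α| * (v.1 - a * v.2) ≤ 2 * ‖w‖ := by
      rw [hα, abs_div, abs_of_pos hden0, div_mul_cancel₀ _ hden0.ne']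
      have : |a * w.2| ≤ ‖w‖ := by
        rw [abs_mul]; exact (mul_le_of_le_one_left (abs_nonneg _) ha).trans hw2
      have := abs_sub w.1 (a * w.2)
      linarith
    have h2 := mul_le_mul_of_nonneg_left hden (abs_nonneg α)
    have h3 : |α| * (M⁻¹ * v.1) ≤ 2 * ‖w‖ := h2.trans h1
    have h4 := mul_le_mul_of_nonneg_left h3 hM.le
    have e1 : M * (|α| * (M⁻¹ * v.1)) = |α| * v.1 := by field_simp
    linarith
  have hβb : |β| ≤ 3 * M * ‖w‖ := by
    have h1 : |α * v.2| ≤ 2 * M * ‖w‖ := by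
      rw [abs_mul]
      refine le_trans (mul_le_mul_of_nonneg_left ?_ (abs_nonneg α)) hαb
      exact hv2.trans (mul_le_of_le_one_left hp.le h.hyp.χu_lt.le)
    have h2 := abs_sub w.2 (α * v.2)
    have h3 : ‖w‖ ≤ M * ‖w‖ := le_mul_of_one_le_left (norm_nonneg _) hM1
    linarith
  have hnorm : ‖dIter G m z w‖ ≤ |α| * V.1 + |β| * |q| := by
    conv_lhs => rw [hdec]
    rw [map_add, map_smul, map_smul, hA]
    refine (norm_add_le _ _).trans ?_
    rw [norm_smul, norm_smul, Real.norm_eq_abs, Real.norm_eq_abs, ← hV, hVn]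
    simp [Prod.norm_def]
  have hl := h.lm_pow_le m z hv hp
  rw [← hV] at hl
  have hqv : |q| * v.1 ≤ 4 * M ^ 2 * V.1 := by
    have hpow : d.μ ^ m ≤ d.lm ^ m := pow_le_pow_left₀ h.μ_pos.le h.μ_le_lm m
    calc |q| * v.1 ≤ 2 * M * d.μ ^ m * v.1 := mul_le_mul_of_nonneg_right hq hp.le
      _ ≤ 2 * M * d.lm ^ m * v.1 := by gcongr
      _ = 2 * M * (d.lm ^ m * v.1) := by ring
      _ ≤ 2 * M * (2 * M * V.1) := by gcongr
      _ = _ := by ring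
  have hwn := norm_nonneg w
  calc ‖dIter G m z w‖ * v.1 ≤ (|α| * V.1 + |β| * |q|) * v.1 :=
        mul_le_mul_of_nonneg_right hnorm hp.le
    _ = |α| * v.1 * V.1 + |β| * (|q| * v.1) := by ring
    _ ≤ 2 * M * ‖w‖ * V.1 + 3 * M * ‖w‖ * (4 * M ^ 2 * V.1) := by gcongr
    _ = (2 * M + 12 * M ^ 3) * (V.1 * ‖w‖) := by ring
    _ ≤ (20 * M ^ 3) * (V.1 * ‖w‖) := by
        apply mul_le_mul_of_nonneg_right _ (by positivity)
        nlinarith [sq_nonneg (M - 1), mul_pos hM hM, mul_nonneg hM.le (mul_nonneg hM.le (sub_nonneg.2 hM1))]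
    _ = _ := by ring

/-- One step expands a horizontal vector by at most ‖DG‖ ≤ M. Combined with `μ_le_lm` this makes μ a
bounded quantity, so single factors μ can be absorbed in uniform constants. -/
theorem lm_le (h : Sys r M G d D e) : d.lm ≤ 2 * M ^ 2 := by
  have hl := h.lm_pow_le 1 0 h.e₁_mem (by simp)
  have h1 : ‖fderiv ℝ G 0‖ ≤ M := by
    rw [← norm_iteratedFDeriv_one]
    exact h.bound.1 1 le_rfl (by have := h.two_le; omega) 0
  have h2 : (dIter G 1 0 (1, 0)).1 ≤ M := by
    refine (le_abs_self _).trans ((norm_fst_le (dIter G 1 0 (1, 0))).trans ?_)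
    refine ((fderiv ℝ G 0).le_opNorm (1, 0)).trans ?_
    have : ‖((1 : ℝ), (0 : ℝ))‖ = 1 := by simp [Prod.norm_def]
    rw [this, mul_one]; exact h1
  have hM := zero_lt_one.trans_le h.one_le_M
  simp only [pow_one, mul_one] at hl
  nlinarith

theorem norm_fderiv_fderiv_le (h : Sys r M G d D e) (z : ℝ × ℝ) :
    ‖fderiv ℝ (fderiv ℝ G) z‖ ≤ M := by
  rw [← norm_iteratedFDeriv_one, norm_iteratedFDeriv_fderiv]
  exact h.bound.1 2 (by norm_num) h.two_le z

theorem differentiable_fderiv (h : Sys r M G d D e) : Differentiable ℝ (fderiv ℝ G) := by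
  have h2 : ContDiff ℝ 2 G := h.smooth.of_le (by exact_mod_cast h.two_le)
  exact (h2.fderiv_right (m := 1) (by norm_num)).differentiable (by simp)

/-- The second horizontal derivative of `G^n` is controlled by the square of the first one. -/
theorem exists_hasDerivAt_dIter (h : Sys r M G d D e) (s x : ℝ) (n : ℕ) :
    ∃ w : ℝ × ℝ, HasDerivAt (fun x => dIter G n (x, s) (1, 0)) w x ∧
      ∀ m, ‖dIter G m (G^[n] (x, s)) w‖ ≤
        80 * M ^ 6 * (dIter G (m + n) (x, s) (1, 0)).1 ^ 2 * ((d.lm ^ m)⁻¹ * (d.lm - 1)⁻¹) := by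
  have hM := zero_lt_one.trans_le h.one_le_M
  have hlm := sub_pos.2 h.one_lt_lm
  have hlm0 := h.lm_pos
  induction n with
  | zero =>
    refine ⟨0, ?_, fun m => ?_⟩
    · have : (fun x : ℝ => dIter G 0 (x, s) (1, 0)) = fun _ => (1, 0) := by
        ext x <;> rw [dIter_zero] <;> rfl
      rw [this]; exact hasDerivAt_const _ _
    · rw [map_zero, norm_zero]; positivity
  | succ n ih =>
    obtain ⟨w, hw, hb⟩ := ih
    have hΓ : HasDerivAt (fun x => G^[n] (x, s)) (dIter G n (x, s) (1, 0)) x := by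
      have h1 : HasDerivAt (fun x : ℝ => (x, s)) ((1 : ℝ), (0 : ℝ)) x :=
        (hasDerivAt_id x).prodMk (hasDerivAt_const x s)
      exact HasFDerivAt.comp_hasDerivAt (f := fun x => (x, s)) x
        (h.differentiable_iter n (x, s)).hasFDerivAt h1
    set p := G^[n] (x, s) with hp
    set v := dIter G n (x, s) (1, 0) with hv
    have hc : HasDerivAt (fun x => fderiv ℝ G (G^[n] (x, s))) (fderiv ℝ (fderiv ℝ G) p v) x :=
      HasFDerivAt.comp_hasDerivAt (f := fun x => G^[n] (x, s)) x
        (h.differentiable_fderiv p).hasFDerivAt hΓ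
    have hsum := hc.clm_apply hw
    -- The chain rule produces a new quadratic term and transports the old one. The estimate is
    -- stated after a further transport by DG^m for all m, since the induction step for m uses the
    -- hypothesis for m + 1.
    refine ⟨fderiv ℝ (fderiv ℝ G) p v v + fderiv ℝ G p w, ?_, ?_⟩
    · have : (fun x => dIter G (n + 1) (x, s) (1, 0)) =
          fun x => fderiv ℝ G (G^[n] (x, s)) (dIter G n (x, s) (1, 0)) := by
        ext1 x; rw [h.dIter_succ]; rfl
      rw [this]
      exact hsum
    intro m
    set w2 := fderiv ℝ (fderiv ℝ G) p v v with hw2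
    have hvc := h.coneU_iter n (x, s) h.e₁_mem
    have hvp := h.fst_iter_pos n (x, s) h.e₁_mem (by simp)
    rw [← hv] at hvc hvp
    have hv1c := h.coneU_iter (n + 1) (x, s) h.e₁_mem
    have hv1p := h.fst_iter_pos (n + 1) (x, s) h.e₁_mem (by simp)
    set v1 := dIter G (n + 1) (x, s) (1, 0) with hv1
    set V := dIter G (m + (n + 1)) (x, s) (1, 0) with hV
    have hVp : 0 < V.1 := h.fst_iter_pos _ (x, s) h.e₁_mem (by simp)
    have e1 : G^[n + 1] (x, s) = G p := Function.iterate_succ_apply' _ _ _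
    have e2 : dIter G m (G p) v1 = V := by
      rw [hV, h.dIter_add, ← e1]; rfl
    have e3 : dIter G (m + 1) p v = V := by
      have : m + (n + 1) = m + 1 + n := by ring
      rw [hV, this, h.dIter_add (m + 1) n]; rfl
    have e4 : dIter G 1 p v = v1 := by rw [hv1, h.dIter_succ n]; rfl
    have hw2n : ‖w2‖ ≤ M * v.1 ^ 2 := by
      have h1 := (fderiv ℝ (fderiv ℝ G) p v).le_opNorm v
      have h2 := (fderiv ℝ (fderiv ℝ G) p).le_opNorm v
      rw [h.norm_eq_of_mem hvc hvp] at h1 h2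
      calc ‖w2‖ ≤ _ := h1
        _ ≤ M * v.1 * v.1 := by
          apply mul_le_mul_of_nonneg_right _ hvp.le
          exact h2.trans (mul_le_mul_of_nonneg_right (h.norm_fderiv_fderiv_le p) hvp.le)
        _ = _ := by ring
    -- The new term has size v.1², and transport costs V.1/v1.1. One factor v.1 cancels against
    -- v1.1; the other is at most 2M λ₋^{-(m+1)} V.1.
    have hA : ‖dIter G m (G p) w2‖ ≤ 80 * M ^ 6 * V.1 ^ 2 * (d.lm ^ (m + 1))⁻¹ := by
      have h1 := h.norm_dIter_mul_le m (G p) v1 w2 hv1c hv1p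
      rw [e2] at h1
      have h2 := h.lm_pow_le 1 p hvc hvp
      rw [e4, pow_one] at h2
      have h3 := h.lm_pow_le (m + 1) p hvc hvp
      rw [e3] at h3
      have h4 : v.1 ≤ 2 * M * v1.1 := by
        have := h.one_lt_lm
        nlinarith
      have h5 : ‖dIter G m (G p) w2‖ * v1.1 ≤ 40 * M ^ 5 * V.1 * v.1 * v1.1 := by
        refine h1.trans ?_
        calc 20 * M ^ 3 * V.1 * ‖w2‖ ≤ 20 * M ^ 3 * V.1 * (M * v.1 ^ 2) := by gcongr
          _ = 20 * M ^ 4 * V.1 * v.1 * v.1 := by ring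
          _ ≤ 20 * M ^ 4 * V.1 * v.1 * (2 * M * v1.1) := by gcongr
          _ = _ := by ring
      have h6 := le_of_mul_le_mul_right h5 hv1p
      have h7 : v.1 ≤ 2 * M * V.1 * (d.lm ^ (m + 1))⁻¹ := by
        rw [← div_eq_mul_inv, le_div_iff₀ (by positivity)]
        linarith
      calc _ ≤ _ := h6
        _ ≤ 40 * M ^ 5 * V.1 * (2 * M * V.1 * (d.lm ^ (m + 1))⁻¹) := by gcongr
        _ = _ := by ring
    have hB : ‖dIter G m (G p) (fderiv ℝ G p w)‖ ≤
        80 * M ^ 6 * V.1 ^ 2 * ((d.lm ^ (m + 1))⁻¹ * (d.lm - 1)⁻¹) := by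
      have h1 := hb (m + 1)
      have e5 : dIter G (m + 1) p w = dIter G m (G p) (fderiv ℝ G p w) := by
        rw [h.dIter_add m 1]; rfl
      have e6 : m + 1 + n = m + (n + 1) := by ring
      rw [e5, e6, ← hV] at h1
      exact h1
    rw [e1, map_add]
    -- The geometric series closes: λ₋^{-(m+1)} (1 + 1/(λ₋ - 1)) = λ₋^{-m}/(λ₋ - 1).
    refine (norm_add_le _ _).trans ?_
    refine (add_le_add hA hB).trans (le_of_eq ?_)
    rw [pow_succ]
    field_simp
    ring

theorem inv_lm_sub_one_le (h : Sys r M G d D e) : (d.lm - 1)⁻¹ ≤ M := by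
  have h1 := h.one_add_le_lm
  rw [inv_le_comm₀ (sub_pos.2 h.one_lt_lm) (zero_lt_one.trans_le h.one_le_M)]
  linarith

/-- The reciprocal of the horizontal expansion is uniformly Lipschitz. -/
theorem exists_hasDerivAt_fst (h : Sys r M G d D e) (s x : ℝ) (n : ℕ) :
    ∃ w : ℝ, HasDerivAt (fun x => ((dIter G n (x, s) (1, 0)).1)⁻¹) w x ∧ |w| ≤ 80 * M ^ 7 := by
  obtain ⟨w, hw, hb⟩ := h.exists_hasDerivAt_dIter s x n
  have hp : 0 < (dIter G n (x, s) (1, 0)).1 := h.fst_iter_pos n (x, s) h.e₁_mem (by simp)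
  have hM := zero_lt_one.trans_le h.one_le_M
  have h1 : HasDerivAt (fun x => (dIter G n (x, s) (1, 0)).1) w.1 x :=
    ((ContinuousLinearMap.fst ℝ ℝ ℝ).hasFDerivAt).comp_hasDerivAt x hw
  refine ⟨_, h1.fun_inv hp.ne', ?_⟩
  -- Without further transport, the second derivative is bounded by the square of the first, which
  -- is what the derivative of the reciprocal requires.
  have h2 := hb 0
  rw [dIter_zero, pow_zero, inv_one, one_mul, zero_add] at h2
  rw [abs_div, abs_neg, abs_of_pos (pow_pos hp 2), div_le_iff₀ (pow_pos hp 2)]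
  refine (norm_fst_le w).trans (h2.trans ?_)
  calc _ ≤ 80 * M ^ 6 * (dIter G n (x, s) (1, 0)).1 ^ 2 * M := by
        gcongr; exact h.inv_lm_sub_one_le
    _ = _ := by ring

/-! ### Bounds for the derivatives of the iterates -/

theorem norm_iteratedFDeriv_fst_le {f : ℝ × ℝ → ℝ × ℝ} {N i : ℕ} (hf : ContDiff ℝ N f) (hi : i ≤ N)
    (z : ℝ × ℝ) : ‖iteratedFDeriv ℝ i (fun z => (f z).1) z‖ ≤ ‖iteratedFDeriv ℝ i f z‖ := by
  have := (ContinuousLinearMap.fst ℝ ℝ ℝ).norm_iteratedFDeriv_comp_left (x := z) hf.contDiffAt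
    (n := i) (by exact_mod_cast hi)
  refine le_trans (le_of_eq rfl) (this.trans (mul_le_of_le_one_left (norm_nonneg _) ?_))
  exact ContinuousLinearMap.norm_fst_le ..

theorem norm_iteratedFDeriv_snd_le {f : ℝ × ℝ → ℝ × ℝ} {N i : ℕ} (hf : ContDiff ℝ N f) (hi : i ≤ N)
    (z : ℝ × ℝ) : ‖iteratedFDeriv ℝ i (fun z => (f z).2) z‖ ≤ ‖iteratedFDeriv ℝ i f z‖ := by
  have := (ContinuousLinearMap.snd ℝ ℝ ℝ).norm_iteratedFDeriv_comp_left (x := z) hf.contDiffAt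
    (n := i) (by exact_mod_cast hi)
  refine le_trans (le_of_eq rfl) (this.trans (mul_le_of_le_one_left (norm_nonneg _) ?_))
  exact ContinuousLinearMap.norm_snd_le ..

theorem Pl_partialD (h : Sys r M G d D e) (i : Fin 2) :
    Pl (r - 1) M (partialD i fun z => (G z).1) ∧ Pl (r - 1) M (partialD i fun z => (G z).2) := by
  obtain ⟨N, rfl⟩ : ∃ N, r = N + 1 := ⟨r - 1, by have := h.two_le; omega⟩
  rw [Nat.add_sub_cancel]
  have h1 : ContDiff ℝ (N + 1 : ℕ) fun z => (G z).1 := contDiff_fst.comp h.smooth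
  have h2 : ContDiff ℝ (N + 1 : ℕ) fun z => (G z).2 := contDiff_snd.comp h.smooth
  constructor
  · refine Pl.of_iteratedFDeriv (contDiff_partialD h1 i) fun j hj z => ?_
    refine (norm_iteratedFDeriv_partialD_le (h1.of_le ?_) i z).trans ?_
    · exact_mod_cast (by omega : j + 1 ≤ N + 1)
    · exact (norm_iteratedFDeriv_fst_le h.smooth (by omega) z).trans
        (h.bound.1 _ (by omega) (by omega) z)
  · refine Pl.of_iteratedFDeriv (contDiff_partialD h2 i) fun j hj z => ?_
    refine (norm_iteratedFDeriv_partialD_le (h2.of_le ?_) i z).trans ?_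
    · exact_mod_cast (by omega : j + 1 ≤ N + 1)
    · exact (norm_iteratedFDeriv_snd_le h.smooth (by omega) z).trans
        (h.bound.1 _ (by omega) (by omega) z)

end Sys

theorem exists_Pl_iter (r : ℕ) (M : ℝ) (n : ℕ) : ∃ K : ℝ, 0 ≤ K ∧
    ∀ {G : ℝ × ℝ → ℝ × ℝ} {d : HypConst} {D : ℕ} {e : ℤ}, Sys r M G d D e → ∀ i,
      Pl (r - 1) K (partialD i fun z => (G^[n] z).1) ∧
      Pl (r - 1) K (partialD i fun z => (G^[n] z).2) := by
  induction n with
  | zero =>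
    refine ⟨1, zero_le_one, fun {G d D e} h i => ?_⟩
    have h1 : (partialD i fun z => ((G^[0] z).1 : ℝ)) = fun _ => if i = 0 then 1 else 0 := by
      ext z; rw [h.partialD_fst, Sys.dIter_zero]; simp only [unitVec]; split_ifs <;> rfl
    have h2 : (partialD i fun z => ((G^[0] z).2 : ℝ)) = fun _ => if i = 0 then 0 else 1 := by
      ext z; rw [h.partialD_snd, Sys.dIter_zero]; simp only [unitVec]; split_ifs <;> rfl
    have hc : ∀ (N : ℕ) (a : ℝ), |a| ≤ 1 → Pl N 1 (fun _ => a) := by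
      intro N a ha
      cases N with
      | zero => exact ⟨continuous_const, fun _ => ha⟩
      | succ N =>
        refine ⟨differentiable_const _, fun _ => ha, fun i => ?_⟩
        rw [partialD_const]; exact Pl.zero N zero_le_one
    rw [h1, h2]
    constructor <;> apply hc <;> split_ifs <;> simp
  | succ n ih =>
    obtain ⟨K, hK, h⟩ := ih
    obtain ⟨C, hC, hcomp⟩ := Pl.comp (r - 1) hK
    refine ⟨2 * (2 ^ (r - 1) * (C * |M| * K)), by positivity, fun {G d D e} hs i => ?_⟩
    have hM : |M| = M := abs_of_pos (zero_lt_one.trans_le hs.one_le_M)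
    have hn := h hs
    have e1 : (fun z => (G^[n + 1] z).1) = fun z => (G (G^[n] z)).1 := by
      ext z; rw [Function.iterate_succ_apply']
    have e2 : (fun z => (G^[n + 1] z).2) = fun z => (G (G^[n] z)).2 := by
      ext z; rw [Function.iterate_succ_apply']
    have hd1 : Differentiable ℝ fun z => (G z).1 := fun z => (hs.differentiable z).fst
    have hd2 : Differentiable ℝ fun z => (G z).2 := fun z => (hs.differentiable z).snd
    have hP := hs.differentiable_iter n
    rw [e1, e2]
    have hb : ∀ m < r - 1, ∀ i, Pl m K (partialD i fun z => (G^[n] z).1) ∧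
        Pl m K (partialD i fun z => (G^[n] z).2) := fun m hm i =>
      ⟨(hn i).1.of_le hm.le, (hn i).2.of_le hm.le⟩
    constructor
    · rw [partialD_comp (f := fun z => (G z).1) hd1 hP]
      refine (((hcomp (hs.Pl_partialD 0).1 hP hb).mul (hn i).1).add
        ((hcomp (hs.Pl_partialD 1).1 hP hb).mul (hn i).2)).mono (le_of_eq ?_)
      rw [hM]; ring
    · rw [partialD_comp (f := fun z => (G z).2) hd2 hP]
      refine (((hcomp (hs.Pl_partialD 0).2 hP hb).mul (hn i).1).add
        ((hcomp (hs.Pl_partialD 1).2 hP hb).mul (hn i).2)).mono (le_of_eq ?_)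
      rw [hM]; ring

end SVPH

namespace SVPH

/-! ### Global inverse functions of the plane -/

/-- Near each point the inverse of the bijection coincides with the local inverse supplied by the
inverse function theorem, hence is as smooth as the map. -/
theorem exists_smooth_inverse {r : ℕ} (hr : r ≠ 0) {Q : ℝ × ℝ → ℝ × ℝ} (hQ : ContDiff ℝ r Q)
    (hbij : Function.Bijective Q) (hdet : ∀ z, (fderiv ℝ Q z).det ≠ 0) :
    ∃ H : ℝ × ℝ → ℝ × ℝ, ContDiff ℝ r H ∧ (∀ z, H (Q z) = z) ∧ ∀ z, Q (H z) = z := by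
  obtain ⟨H, hl, hr'⟩ := Function.bijective_iff_has_inverse.1 hbij
  refine ⟨H, contDiff_iff_contDiffAt.2 fun w => ?_, hl, hr'⟩
  have hn : (r : WithTop ℕ∞) ≠ 0 := by exact_mod_cast hr
  let A := (fderiv ℝ Q (H w)).toContinuousLinearEquivOfDetNeZero (hdet (H w))
  have hA : HasFDerivAt Q (A : ℝ × ℝ →L[ℝ] ℝ × ℝ) (H w) :=
    ((hQ.differentiable hn) (H w)).hasFDerivAt
  have h1 := (hQ.contDiffAt (x := H w)).to_localInverse hA hn
  rw [hr'] at h1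
  refine h1.congr_of_eventuallyEq ?_
  have hs := (hQ.contDiffAt (x := H w)).hasStrictFDerivAt' hA hn
  have h2 := hs.eventually_right_inverse
  rw [hr'] at h2
  filter_upwards [h2] with y hy
  exact hbij.1 ((hr' y).trans hy.symm)

theorem bijective_of_two_le_deriv {ψ : ℝ → ℝ} (hd : Differentiable ℝ ψ)
    (h : ∀ x, 2 ≤ deriv ψ x) : Function.Bijective ψ := by
  have hmono : StrictMono ψ := strictMono_of_deriv_pos fun x => by linarith [h x]
  have hm : Monotone fun x => ψ x - 2 * x := by
    apply monotone_of_deriv_nonneg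
    · exact hd.sub (differentiable_id.const_mul 2)
    · intro x
      have h1 : HasDerivAt (fun x => ψ x - 2 * x) (deriv ψ x - 2 * 1) x :=
        (hd x).hasDerivAt.sub ((hasDerivAt_id x).const_mul 2)
      rw [h1.deriv]; linarith [h x]
  refine ⟨hmono.injective, hd.continuous.surjective ?_ ?_⟩
  · refine Filter.tendsto_atTop_mono' _ ?_
      (Filter.tendsto_atTop_add_const_left _ (ψ 0) Filter.tendsto_id)
    filter_upwards [Filter.eventually_ge_atTop 0] with x hx
    have := hm hx
    simp at this ⊢
    linarith
  · refine Filter.tendsto_atBot_mono' _ ?_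
      (Filter.tendsto_atBot_add_const_left _ (ψ 0) Filter.tendsto_id)
    filter_upwards [Filter.eventually_le_atBot 0] with x hx
    have := hm hx
    simp at this ⊢
    linarith

/-! ### The graph transform -/

/-- `{(g t, t)}` is a closed curve in the central direction. -/
structure CentralGraph (r : ℕ) (χ : ℝ) (g : ℝ → ℝ) : Prop where
  smooth : ContDiff ℝ r g
  periodic : ∀ t, g (t + 1) = g t
  slope : ∀ t, |deriv g t| ≤ χ

/-- A sequence of central curves, each one a preimage of the previous one: `G` maps the graph of
`g (k + 1)` to the graph of `g k` with reparametrization `η k`. -/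
structure Chain (r : ℕ) (G : ℝ × ℝ → ℝ × ℝ) (d : HypConst) (g η : ℕ → ℝ → ℝ) : Prop where
  graph : ∀ k, CentralGraph r d.χc (g k)
  diffeo : ∀ k, IsCircleDiffeo r (η k)
  map : ∀ k s, G (g (k + 1) s, s) = (g k (η k s), η k s)

/-- The reparametrization between the curves `m + k` and `m` of a chain. -/
def climb (η : ℕ → ℝ → ℝ) : ℕ → ℕ → ℝ → ℝ
  | _, 0 => id
  | m, k + 1 => fun s => η m (climb η (m + 1) k s)

/-- The Jacobian `T' / det DG^k` of the reparametrization `T` from the curve `n` to the curve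
`m = n - k`. -/
def jac (G : ℝ × ℝ → ℝ × ℝ) (g η : ℕ → ℝ → ℝ) (n m k : ℕ) (s : ℝ) : ℝ :=
  deriv (climb η m k) s / (dIter G k (g n s, s)).det

namespace Sys

variable {r : ℕ} {M : ℝ} {G : ℝ × ℝ → ℝ × ℝ} {d : HypConst} {D : ℕ} {e : ℤ}

theorem hasDerivAt_iter_line (h : Sys r M G d D e) (n : ℕ) (x s : ℝ) :
    HasDerivAt (fun x => G^[n] (x, s)) (dIter G n (x, s) (1, 0)) x :=
  HasFDerivAt.comp_hasDerivAt (f := fun x => (x, s)) x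
    (h.differentiable_iter n (x, s)).hasFDerivAt
    ((hasDerivAt_id x).prodMk (hasDerivAt_const x s))

theorem hasDerivAt_iter_graph (h : Sys r M G d D e) (n : ℕ) {q : ℝ → ℝ}
    (hq : Differentiable ℝ q) (s : ℝ) :
    HasDerivAt (fun s => G^[n] (q s, s)) (dIter G n (q s, s) (deriv q s, 1)) s :=
  HasFDerivAt.comp_hasDerivAt (f := fun s => (q s, s)) s
    (h.differentiable_iter n (q s, s)).hasFDerivAt
    ((hq s).hasDerivAt.prodMk (hasDerivAt_id s))

/-- Transversality between unstable and central directions. -/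
theorem inv_M_mul_le (h : Sys r M G d D e) (n : ℕ) (z : ℝ × ℝ) {p : ℝ} (hp : |p| ≤ 1) :
    M⁻¹ * (dIter G n z (1, 0)).1 ≤ (dIter G n z (1, 0)).1 - (dIter G n z (1, 0)).2 * p := by
  have h1 := h.fst_iter_pos n z h.e₁_mem (by simp)
  have h2 := h.snd_le_of_mem (h.coneU_iter n z h.e₁_mem) h1
  set v := dIter G n z (1, 0)
  have h3 : |v.2 * p| ≤ d.χu * v.1 := by
    rw [abs_mul]
    exact (mul_le_of_le_one_right (abs_nonneg _) hp).trans h2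
  have h4 := mul_le_mul_of_nonneg_right h.inv_M_le_one_sub h1.le
  have := (abs_le.1 h3).2
  linarith

theorem transverse_pos (h : Sys r M G d D e) (n : ℕ) (z : ℝ × ℝ) {p : ℝ} (hp : |p| ≤ 1) :
    0 < (dIter G n z (1, 0)).1 - (dIter G n z (1, 0)).2 * p :=
  (mul_pos h.M_inv_pos (h.fst_iter_pos n z h.e₁_mem (by simp))).trans_le (h.inv_M_mul_le n z hp)

theorem slope_le_one (h : Sys r M G d D e) {g : ℝ → ℝ} (hg : CentralGraph r d.χc g) (t : ℝ) :
    |deriv g t| ≤ 1 := (hg.slope t).trans h.hyp.χc_le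

theorem diff_graph (h : Sys r M G d D e) {g : ℝ → ℝ} (hg : CentralGraph r d.χc g) :
    Differentiable ℝ g := hg.smooth.differentiable (by exact_mod_cast h.r_ne)

theorem diff_diffeo (h : Sys r M G d D e) {η : ℝ → ℝ} (hη : IsCircleDiffeo r η) :
    Differentiable ℝ η := hη.1.differentiable (by exact_mod_cast h.r_ne)

/-- The zeros of this function of x are the points at height s that G sends to the graph of g. Since
|g'| ≤ 1, the second term removes at most |∂_xω| from ∂_x f > 2(1 + |∂_xω|), which leaves at least
2. -/
theorem one_add_graph (h : Sys r M G d D e) {g : ℝ → ℝ} (hg : CentralGraph r d.χc g)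
    (x s : ℝ) :
    HasDerivAt (fun x => (G (x, s)).1 - g ((G (x, s)).2))
        ((dIter G 1 (x, s) (1, 0)).1 - (dIter G 1 (x, s) (1, 0)).2 * deriv g (G (x, s)).2) x ∧
      2 ≤ (dIter G 1 (x, s) (1, 0)).1 - (dIter G 1 (x, s) (1, 0)).2 * deriv g (G (x, s)).2 := by
  have h1 := h.hasDerivAt_iter_line 1 x s
  constructor
  · have h2 : HasDerivAt (fun x => (G (x, s)).1) (dIter G 1 (x, s) (1, 0)).1 x :=
      ((ContinuousLinearMap.fst ℝ ℝ ℝ).hasFDerivAt).comp_hasDerivAt x h1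
    have h3 : HasDerivAt (fun x => (G (x, s)).2) (dIter G 1 (x, s) (1, 0)).2 x :=
      ((ContinuousLinearMap.snd ℝ ℝ ℝ).hasFDerivAt).comp_hasDerivAt x h1
    have h4 := ((h.diff_graph hg (G (x, s)).2).hasDerivAt).comp x h3
    rw [mul_comm (dIter G 1 (x, s) (1, 0)).2]
    exact h2.sub h4
  · have h2 := h.expand_fst (x, s) (x, s)
    rw [h.dIter_apply]
    simp only [Function.iterate_one, one_mul, zero_mul, add_zero]
    set a := partialD 0 (fun y => (G y).2) (x, s)
    have h3 : |a * deriv g (G (x, s)).2| ≤ |a| := by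
      rw [abs_mul]; exact mul_le_of_le_one_right (abs_nonneg _) (h.slope_le_one hg _)
    have := (abs_le.1 h3).2
    have := abs_nonneg a
    linarith

theorem bijective_line (h : Sys r M G d D e) {g : ℝ → ℝ} (hg : CentralGraph r d.χc g) (s : ℝ) :
    Function.Bijective fun x => (G (x, s)).1 - g ((G (x, s)).2) := by
  refine bijective_of_two_le_deriv (fun x => (h.one_add_graph hg x s).1.differentiableAt)
    fun x => ?_
  rw [(h.one_add_graph hg x s).1.deriv]
  exact (h.one_add_graph hg x s).2

/-- At each height exactly one point is sent to the graph of g, so the preimage is again a graph.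
The straightening map Q is a diffeomorphism of the plane, and the graph is the image of the axis
under its inverse, which gives smoothness; uniqueness gives periodicity, invariance of the central
cone the slope, and positivity of the determinant the orientation of η. -/
theorem exists_pullback (h : Sys r M G d D e) {g : ℝ → ℝ} (hg : CentralGraph r d.χc g) :
    ∃ η q : ℝ → ℝ, CentralGraph r d.χc q ∧ IsCircleDiffeo r η ∧
      ∀ s, G (q s, s) = (g (η s), η s) := by
  let Q : ℝ × ℝ → ℝ × ℝ := fun z => ((G z).1 - g ((G z).2), z.2)
  have hQ : ContDiff ℝ r Q :=
    (h.smooth.fst.sub (hg.smooth.comp h.smooth.snd)).prodMk contDiff_snd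
  have hbij : Function.Bijective Q := by
    constructor
    · rintro ⟨x, s⟩ ⟨y, t⟩ hxy
      obtain ⟨h1, rfl⟩ := Prod.ext_iff.1 hxy
      exact Prod.ext ((h.bijective_line hg s).1 h1) rfl
    · rintro ⟨y, s⟩
      obtain ⟨x, hx⟩ := (h.bijective_line hg s).2 y
      exact ⟨(x, s), Prod.ext hx rfl⟩
  have hr0 : (r : WithTop ℕ∞) ≠ 0 := by exact_mod_cast h.r_ne
  have hQd : Differentiable ℝ Q := hQ.differentiable hr0
  have hdet : ∀ z, (fderiv ℝ Q z).det ≠ 0 := by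
    rintro ⟨x, s⟩
    have h1 : HasDerivAt (fun x => Q (x, s)) (fderiv ℝ Q (x, s) (1, 0)) x :=
      HasFDerivAt.comp_hasDerivAt (f := fun x => (x, s)) x (hQd (x, s)).hasFDerivAt
        ((hasDerivAt_id x).prodMk (hasDerivAt_const x s))
    have h2 : HasDerivAt (fun x => Q (x, s)) _ x :=
      (h.one_add_graph hg x s).1.prodMk (hasDerivAt_const x s)
    have h3 := h1.unique h2
    have h4 : (fderiv ℝ Q (x, s) (0, 1)).2 = 1 := by
      have : fderiv ℝ (fun z => (Q z).2) (x, s) = (ContinuousLinearMap.snd ℝ ℝ ℝ).comp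
        (fderiv ℝ Q (x, s)) := (hQd (x, s)).hasFDerivAt.snd.fderiv
      have h5 : fderiv ℝ (fun z => (Q z).2) (x, s) = ContinuousLinearMap.snd ℝ ℝ ℝ := _root_.fderiv_snd
      rw [h5] at this
      have := congrArg (fun A : ℝ × ℝ →L[ℝ] ℝ => A (0, 1)) this
      simpa using this.symm
    rw [clm_det_eq, h3]
    simp only [cross, h4]
    have := (h.one_add_graph hg x s).2
    intro h0
    simp only [mul_one, zero_mul, sub_zero] at h0
    linarith
  obtain ⟨H, hH, -, hr'⟩ := exists_smooth_inverse h.r_ne hQ hbij hdet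
  have hq2 : ∀ s, (H (0, s)).2 = s := fun s => (Prod.ext_iff.1 (hr' (0, s))).2
  have hpair : ∀ s, ((H (0, s)).1, s) = H (0, s) := fun s => Prod.ext rfl (hq2 s).symm
  let q : ℝ → ℝ := fun s => (H (0, s)).1
  let η : ℝ → ℝ := fun s => (G (q s, s)).2
  have hqs : ContDiff ℝ r q := (hH.comp (contDiff_const.prodMk contDiff_id)).fst
  have hηs : ContDiff ℝ r η := (h.smooth.comp (hqs.prodMk contDiff_id)).snd
  have hmap : ∀ s, G (q s, s) = (g (η s), η s) := by
    intro s
    refine Prod.ext ?_ rfl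
    have := (Prod.ext_iff.1 (hr' (0, s))).1
    rw [← hpair] at this
    exact sub_eq_zero.1 this
  have hper : ∀ s, q (s + 1) = q s := by
    intro s
    apply (h.bijective_line hg (s + 1)).1
    have e1 : G (q s, s + 1) = (g (η s), η s + 1) := by
      have := h.add_e₂ (q s, s)
      rw [hmap] at this
      simpa using this
    simp only
    rw [hmap, e1]
    simp [hg.periodic]
  have hηper : ∀ s, η (s + 1) = η s + 1 := by
    intro s
    have := h.add_e₂ (q s, s)
    simp only [Prod.mk_add_mk, add_zero] at this
    simp only [η]
    rw [hper, this]
    rfl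
  have hqd : Differentiable ℝ q := hqs.differentiable hr0
  have hηd : Differentiable ℝ η := hηs.differentiable hr0
  have htan : ∀ s, dIter G 1 (q s, s) (deriv q s, 1) = (deriv g (η s) * deriv η s, deriv η s) := by
    intro s
    have h1 := h.hasDerivAt_iter_graph 1 hqd s
    have h2 : HasDerivAt (fun s => (g (η s), η s)) (deriv g (η s) * deriv η s, deriv η s) s :=
      (((h.diff_graph hg (η s)).hasDerivAt).comp s (hηd s).hasDerivAt).prodMk (hηd s).hasDerivAt
    have h3 : (fun s => G^[1] (q s, s)) = fun s => (g (η s), η s) := funext hmap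
    rw [h3] at h1
    exact h1.unique h2
  refine ⟨η, q, ⟨hqs, hper, fun s => ?_⟩, ⟨hηs, hηper, fun s => ?_⟩, hmap⟩
  · have h1 := h.hyp.invC (q s, s) (deriv q s, 1) (by
      rw [htan]
      simp only [coneC, Set.mem_ofPred_eq, abs_mul]
      exact mul_le_mul_of_nonneg_right (hg.slope _) (abs_nonneg _))
    simp only [coneC, Set.mem_ofPred_eq, abs_one, mul_one] at h1
    refine h1.trans (mul_le_of_le_one_left h.hyp.χc_pos.le h.hyp.ι_lt.le)
  · have h1 := cross_map (dIter G 1 (q s, s)) (1, 0) (deriv q s, 1)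
    rw [htan] at h1
    simp only [cross] at h1
    have h2 := h.transverse_pos 1 (q s, s) (h.slope_le_one hg (η s))
    have h3 := h.det_pos (q s, s)
    set v := dIter G 1 (q s, s) (1, 0)
    have h4 : (v.1 - v.2 * deriv g (η s)) * deriv η s = (dIter G 1 (q s, s)).det := by
      linarith
    rw [← h4] at h3
    exact (mul_pos_iff_of_pos_left h2).1 h3

theorem exists_chain (h : Sys r M G d D e) {g₀ : ℝ → ℝ} (hg : CentralGraph r d.χc g₀) :
    ∃ g η : ℕ → ℝ → ℝ, Chain r G d g η ∧ g 0 = g₀ := by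
  choose η q hq hη hm using fun g : {g : ℝ → ℝ // CentralGraph r d.χc g} => h.exists_pullback g.2
  let g : ℕ → {g : ℝ → ℝ // CentralGraph r d.χc g} :=
    fun k => Nat.rec ⟨g₀, hg⟩ (fun _ p => ⟨q p, hq p⟩) k
  exact ⟨fun k => (g k).1, fun k => η (g k), ⟨fun k => (g k).2, fun k => hη (g k),
    fun k s => hm (g k) s⟩, rfl⟩

end Sys

/-! ### Reparametrizations and Jacobians along a chain -/

namespace Chain

variable {r : ℕ} {M : ℝ} {G : ℝ × ℝ → ℝ × ℝ} {d : HypConst} {D : ℕ} {e : ℤ} {g η : ℕ → ℝ → ℝ}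

theorem isCircleDiffeo_climb (h : Sys r M G d D e) (c : Chain r G d g η) (k : ℕ) :
    ∀ m, IsCircleDiffeo r (climb η m k) := by
  induction k with
  | zero => exact fun m => ⟨contDiff_id, fun t => rfl, fun t => by simp [climb]⟩
  | succ k ih =>
    intro m
    have h1 := ih (m + 1)
    have h2 := c.diffeo m
    refine ⟨h2.1.comp h1.1, fun t => ?_, fun t => ?_⟩
    · simp only [climb]; rw [h1.2.1, h2.2.1]
    · have := deriv_comp t (h.diff_diffeo h2 (climb η (m + 1) k t)) (h.diff_diffeo h1 t)
      change 0 < deriv (η m ∘ climb η (m + 1) k) t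
      rw [this]
      exact mul_pos (h2.2.2 _) (h1.2.2 _)

theorem deriv_climb_succ (h : Sys r M G d D e) (c : Chain r G d g η) (m k : ℕ) (s : ℝ) :
    deriv (climb η m (k + 1)) s =
      deriv (η m) (climb η (m + 1) k s) * deriv (climb η (m + 1) k) s :=
  deriv_comp s (h.diff_diffeo (c.diffeo m) _)
    (h.diff_diffeo (c.isCircleDiffeo_climb h k (m + 1)) s)

theorem iter_map (c : Chain r G d g η) (k : ℕ) : ∀ {m n : ℕ}, n = m + k → ∀ s,
    G^[k] (g n s, s) = (g m (climb η m k s), climb η m k s) := by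
  induction k with
  | zero => rintro m n rfl s; rfl
  | succ k ih =>
    intro m n hn s
    rw [Function.iterate_succ_apply', ih (m := m + 1) (by omega), c.map]
    rfl

theorem dIter_tangent (h : Sys r M G d D e) (c : Chain r G d g η) {k m n : ℕ} (hn : n = m + k)
    (s : ℝ) : dIter G k (g n s, s) (deriv (g n) s, 1) =
      (deriv (g m) (climb η m k s) * deriv (climb η m k) s, deriv (climb η m k) s) := by
  have h1 := h.hasDerivAt_iter_graph k (h.diff_graph (c.graph n)) s
  have hT := (h.diff_diffeo (c.isCircleDiffeo_climb h k m) s).hasDerivAt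
  have h2 : HasDerivAt (fun s => (g m (climb η m k s), climb η m k s))
      (deriv (g m) (climb η m k s) * deriv (climb η m k) s, deriv (climb η m k) s) s :=
    (((h.diff_graph (c.graph m) _).hasDerivAt).comp s hT).prodMk hT
  have h3 : (fun s => G^[k] (g n s, s)) = fun s => (g m (climb η m k s), climb η m k s) :=
    funext (c.iter_map k hn)
  rw [h3] at h1
  exact h1.unique h2

theorem deriv_climb_pos (h : Sys r M G d D e) (c : Chain r G d g η) (m k : ℕ) (s : ℝ) :
    0 < deriv (climb η m k) s := (c.isCircleDiffeo_climb h k m).2.2 s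

theorem jac_pos (h : Sys r M G d D e) (c : Chain r G d g η) (n m k : ℕ) (s : ℝ) :
    0 < jac G g η n m k s := div_pos (c.deriv_climb_pos h m k s) (h.det_iter_pos k _)

/-- Apply `cross_map` to the horizontal vector and the tangent vector. The Jacobian is thus the
inverse of the horizontal expansion measured modulo the tangent direction; this is the source of
every factor λ₋^{-n}. -/
theorem jac_mul (h : Sys r M G d D e) (c : Chain r G d g η) {k m n : ℕ} (hn : n = m + k) (s : ℝ) :
    jac G g η n m k s * ((dIter G k (g n s, s) (1, 0)).1 -
      (dIter G k (g n s, s) (1, 0)).2 * deriv (g m) (climb η m k s)) = 1 := by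
  have h1 := cross_map (dIter G k (g n s, s)) (1, 0) (deriv (g n) s, 1)
  rw [c.dIter_tangent h hn] at h1
  simp only [cross] at h1
  have h2 := (h.det_iter_pos k (g n s, s)).ne'
  rw [jac, div_mul_eq_mul_div, div_eq_one_iff_eq h2]
  linarith

theorem jac_succ (h : Sys r M G d D e) (c : Chain r G d g η) {k m n : ℕ} (hn : n = m + 1 + k)
    (s : ℝ) : jac G g η n m (k + 1) s =
      jac G g η (m + 1) m 1 (climb η (m + 1) k s) * jac G g η n (m + 1) k s := by
  rw [jac, jac, jac, c.deriv_climb_succ h, h.dIter_succ, det_comp, c.iter_map k hn]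
  have : climb η m 1 = η m := rfl
  rw [this, div_mul_div_comm]

theorem deriv_climb_le (h : Sys r M G d D e) (c : Chain r G d g η) {k m n : ℕ} (hn : n = m + k)
    (s : ℝ) : deriv (climb η m k) s ≤ 2 * M * d.μ ^ k ∧
      1 ≤ 2 * M * d.μ ^ k * deriv (climb η m k) s := by
  have ht := c.dIter_tangent h hn s
  have hne : (deriv (g n) s, (1 : ℝ)) ≠ 0 := by simp [Prod.ext_iff]
  have hT := c.deriv_climb_pos h m k s
  obtain ⟨h1, h2⟩ := h.eNorm_le_of_central k (g n s, s) hne (by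
    rw [ht]
    simp only [coneC, Set.mem_ofPred_eq, abs_mul]
    exact mul_le_mul_of_nonneg_right ((c.graph m).slope _) (abs_nonneg _))
  rw [ht] at h1 h2
  set T := deriv (climb η m k) s
  have hMμ : 0 ≤ M * d.μ ^ k := mul_nonneg (zero_le_one.trans h.one_le_M) (pow_nonneg h.μ_pos.le k)
  have e1 : eNorm (deriv (g n) s, (1 : ℝ)) ≤ 2 := by
    have h3 := eNorm_le (deriv (g n) s, (1 : ℝ))
    have h4 := h.slope_le_one (c.graph n) s
    simp only [abs_one] at h3
    linarith
  have e2 : 1 ≤ eNorm (deriv (g n) s, (1 : ℝ)) := by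
    simpa using abs_snd_le_eNorm (deriv (g n) s, (1 : ℝ))
  have e3 : eNorm (deriv (g m) (climb η m k s) * T, T) ≤ 2 * T := by
    have h3 := eNorm_le (deriv (g m) (climb η m k s) * T, T)
    have h4 := h.slope_le_one (c.graph m) (climb η m k s)
    simp only [abs_mul, abs_of_pos hT] at h3
    nlinarith
  have e4 : T ≤ eNorm (deriv (g m) (climb η m k s) * T, T) :=
    (le_abs_self _).trans (abs_snd_le_eNorm (deriv (g m) (climb η m k s) * T, T))
  constructor
  · calc T ≤ _ := e4
      _ ≤ _ := h2
      _ ≤ M * d.μ ^ k * 2 := mul_le_mul_of_nonneg_left e1 hMμ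
      _ = _ := by ring
  · calc (1 : ℝ) ≤ _ := e2
      _ ≤ _ := h1
      _ ≤ M * d.μ ^ k * (2 * T) := mul_le_mul_of_nonneg_left e3 hMμ
      _ = _ := by ring

theorem jac_le (h : Sys r M G d D e) (c : Chain r G d g η) {k m n : ℕ} (hn : n = m + k) (s : ℝ) :
    jac G g η n m k s ≤ M * ((dIter G k (g n s, s) (1, 0)).1)⁻¹ ∧
      jac G g η n m k s * d.lm ^ k ≤ 2 * M ^ 2 := by
  have h1 := c.jac_mul h hn s
  have h2 := h.inv_M_mul_le k (g n s, s) (h.slope_le_one (c.graph m) (climb η m k s))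
  have hv := h.fst_iter_pos k (g n s, s) h.e₁_mem (by simp)
  have hl := h.lm_pow_le k (g n s, s) h.e₁_mem (by simp)
  have hj := c.jac_pos h n m k s
  have hM := zero_lt_one.trans_le h.one_le_M
  set v := dIter G k (g n s, s) (1, 0)
  set J := jac G g η n m k s
  have h3 : J * v.1 ≤ M := by
    have h4 := mul_le_mul_of_nonneg_left h2 hj.le
    rw [h1] at h4
    have h5 := mul_le_mul_of_nonneg_left h4 hM.le
    have e1 : M * (J * (M⁻¹ * v.1)) = J * v.1 := by field_simp
    linarith
  constructor
  · rw [← div_eq_mul_inv, le_div_iff₀ hv]; exact h3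
  · simp only [mul_one] at hl
    calc J * d.lm ^ k ≤ J * (2 * M * v.1) := mul_le_mul_of_nonneg_left hl hj.le
      _ = 2 * M * (J * v.1) := by ring
      _ ≤ 2 * M * M := by gcongr
      _ = _ := by ring

/-- This is the weight with which an l-th derivative is transported along k steps of the chain.
Pinching makes it exponentially small. -/
theorem jac_mul_pow_le (h : Sys r M G d D e) (c : Chain r G d g η) {k m n : ℕ} (hn : n = m + k)
    (l : ℕ) (s : ℝ) : jac G g η n m k s * deriv (climb η m k) s ^ l ≤
      2 * M ^ 2 * (2 * M) ^ l * (d.μ ^ l / d.lm) ^ k := by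
  have h1 := (c.jac_le h hn s).2
  have h2 := (c.deriv_climb_le h hn s).1
  have hj := c.jac_pos h n m k s
  have hT := c.deriv_climb_pos h m k s
  have hM := zero_lt_one.trans_le h.one_le_M
  have hlm := pow_pos h.lm_pos k
  have hμ := h.μ_pos
  rw [← le_div_iff₀ hlm] at h1
  calc _ ≤ (2 * M ^ 2 / d.lm ^ k) * (2 * M * d.μ ^ k) ^ l := by gcongr
    _ = _ := by rw [mul_pow, div_pow, ← pow_mul, ← pow_mul, mul_comm k l]; ring

end Chain

end SVPH

/-! ### One step of the graph transform -/

namespace SVPH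

/-- The top order term of the derivatives of `w · q ∘ η`. -/
theorem Sc.iteratedDeriv_mul_comp (N : ℕ) {K₁ : ℝ} (hK₁ : 0 ≤ K₁) : ∃ C : ℝ, 0 ≤ C ∧
    ∀ {β Kq : ℝ} {w q η : ℝ → ℝ}, 0 ≤ β → 0 ≤ Kq → Sc N K₁ β w → ContDiff ℝ N η →
      Differentiable ℝ η → (∀ m < N, Sc m K₁ β (deriv η)) → ContDiff ℝ N q →
      (∀ m < N, Sc m Kq β q) → ∀ s,
      |_root_.iteratedDeriv N (fun s => w s * q (η s)) s -
        w s * deriv η s ^ N * _root_.iteratedDeriv N q (η s)| ≤ C * Kq * β ^ N := by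
  induction N generalizing K₁ with
  | zero => exact ⟨0, le_rfl, fun {β Kq w q η} _ _ _ _ _ _ _ _ s => by simp⟩
  | succ N ih =>
    obtain ⟨C2, hC2, hcomp⟩ := Sc.comp N (Q := max 1 K₁) (le_max_left _ _)
    obtain ⟨C', hC', h'⟩ := ih (K₁ := K₁ + 2 ^ N * (K₁ * K₁)) (by positivity)
    have hK' : 0 ≤ 2 ^ N * (K₁ * K₁) := by positivity
    refine ⟨C' + 2 ^ N * (K₁ * C2), by positivity, fun {β Kq w q η} hβ hKq hw hηc hηd hη hqc hq s => ?_⟩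
    have hqd : Differentiable ℝ q := hqc.differentiable (by simp)
    -- Only the second summand can carry the top derivative of q, and it has the original shape with
    -- w replaced by w·η' and q by q'.
    have hd : deriv (fun s => w s * q (η s)) = fun s =>
        deriv w s * q (η s) + (w s * deriv η s) * deriv q (η s) := by
      ext s
      have h1 : HasDerivAt (fun s => q (η s)) (deriv q (η s) * deriv η s) s :=
        (hqd (η s)).hasDerivAt.comp s (hηd s).hasDerivAt
      rw [((hw.1 s).hasDerivAt.fun_mul h1).deriv]
      ring
    rw [Nat.cast_succ] at hqc
    have hqc' : ContDiff ℝ N (deriv q) := (contDiff_succ_iff_deriv.1 hqc).2.2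
    have hηc' : ContDiff ℝ N η := hηc.of_le (by exact_mod_cast Nat.le_succ N)
    have hqη : Sc N (C2 * Kq) β (fun s => q (η s)) :=
      hcomp (hq N (by omega)) hηd (fun m hm => hη m (by omega)) hβ hβ
        (by rw [mul_comm]; exact mul_le_mul_of_nonneg_right (le_max_right _ _) hβ)
    have hA := hw.2.2.mul hqη
    have hη1 : ContDiff ℝ N (deriv η) := (hη N (by omega)).contDiff
    have hwη := hw.of_succ.mul (hη N (by omega))
    have hBc : ContDiff ℝ N (fun s => (w s * deriv η s) * deriv q (η s)) :=
      hwη.contDiff.mul (hqc'.comp hηc')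
    rw [iteratedDeriv_succ', hd, iteratedDeriv_fun_add hA.contDiff.contDiffAt hBc.contDiffAt]
    have hq' : ∀ m < N, Sc m (Kq * β) β (deriv q) := fun m hm => (hq (m + 1) (by omega)).2.2
    have hB := h' (w := fun s => w s * deriv η s) hβ (mul_nonneg hKq hβ)
      (hwη.mono (by linarith) hβ) hηc' hηd
      (fun m hm => (hη m (by omega)).mono (by linarith) hβ) hqc' hq' s
    have hA' := hA.iteratedDeriv N le_rfl s
    rw [iteratedDeriv_succ']
    set X := _root_.iteratedDeriv N (fun s => deriv w s * q (η s)) s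
    set Y := _root_.iteratedDeriv N (fun s => (w s * deriv η s) * deriv q (η s)) s
    have e1 : X + Y - w s * deriv η s ^ (N + 1) * _root_.iteratedDeriv N (deriv q) (η s) =
        X + (Y - w s * deriv η s * deriv η s ^ N * _root_.iteratedDeriv N (deriv q) (η s)) := by
      ring
    rw [e1]
    refine (abs_add_le _ _).trans ((add_le_add hA' hB).trans (le_of_eq ?_))
    ring

/-- Data of one step of the graph transform, at scale `β`. -/
theorem Chain.step_classes (r : ℕ) (M K₀ : ℝ) (hK₀ : 0 ≤ K₀) (N : ℕ) (hN : N + 1 ≤ r) :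
    ∃ C : ℝ, 0 ≤ C ∧ ∀ {G : ℝ × ℝ → ℝ × ℝ} {d : HypConst} {D : ℕ} {e : ℤ} {g η : ℕ → ℝ → ℝ},
      Sys r M G d D e → Chain r G d g η → ∀ {β : ℝ} (k : ℕ), 1 ≤ β →
      Sc N K₀ β (deriv (g k)) → Sc N K₀ β (deriv (g (k + 1))) →
      Sc N C β (deriv (η k)) ∧ Sc N C β (fun s => deriv (g k) (η k s)) ∧
      Sc N C β (jac G g η (k + 1) k 1) ∧
      Sc N C β (fun s => (dIter G 1 (g (k + 1) s, s)).det) ∧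
      ∀ {f : ℝ × ℝ → ℝ}, Pl (r - 1) M f → Sc N C β (fun s => f (g (k + 1) s, s)) := by
  have hD : (0 : ℝ) < 2 := two_pos
  obtain ⟨C1, hC1, hgr⟩ := Pl.comp_graph N hK₀
  set Kη := 2 ^ N * (C1 * |M| * K₀) + C1 * |M| with hKη
  have hKη0 : 0 ≤ Kη := by positivity
  obtain ⟨C2, hC2, hcomp⟩ := Sc.comp N (Q := max 1 Kη) (le_max_left _ _)
  set KD := C1 * |M| + 2 ^ N * (C1 * |M| * (C2 * K₀)) with hKD
  obtain ⟨C3, hC3, hinv⟩ := Sc.inv N (K := KD) (by positivity) hD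
  set Kdet := 2 ^ N * (C1 * |M| * (C1 * |M|)) + 2 ^ N * (C1 * |M| * (C1 * |M|)) with hKdet
  have h0 : 0 ≤ C2 * K₀ := by positivity
  have h1 : 0 ≤ C1 * |M| := by positivity
  have h2 : 0 ≤ Kdet := by positivity
  refine ⟨Kη + C2 * K₀ + C3 + Kdet + C1 * |M|, by positivity,
    fun {G d D e g η} hs c β k hβ hg hg' => ?_⟩
  have hβ0 : 0 ≤ β := zero_le_one.trans hβ
  have hM : |M| = M := abs_of_pos (zero_lt_one.trans_le hs.one_le_M)
  have hq := hs.diff_graph (c.graph (k + 1))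
  have hηd := hs.diff_diffeo (c.diffeo k)
  have hf : ∀ {f : ℝ × ℝ → ℝ}, Pl (r - 1) M f →
      Sc N (C1 * |M|) β (fun s => f (g (k + 1) s, s)) := by
    intro f hf
    rw [hM]
    exact hgr (hf.of_le (by omega)) hq (fun m hm => hg'.of_le hm.le) hβ
  have hP0 := hs.Pl_partialD 0
  have hP1 := hs.Pl_partialD 1
  have hclimb : climb η k 1 = η k := rfl
  have htan := fun s => c.dIter_tangent hs (k := 1) (m := k) rfl s
  simp only [hclimb] at htan
  have hηeq : deriv (η k) = fun s => partialD 0 (fun z => (G z).2) (g (k + 1) s, s) *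
      deriv (g (k + 1)) s + partialD 1 (fun z => (G z).2) (g (k + 1) s, s) := by
    ext s
    have := (Prod.ext_iff.1 (htan s)).2
    rw [hs.dIter_apply] at this
    simp only [Function.iterate_one] at this
    rw [← this]; ring
  have hη : Sc N Kη β (deriv (η k)) := by
    rw [hηeq]
    exact ((hf hP0.2).mul hg').add (hf hP1.2)
  have hp : Sc N (C2 * K₀) β (fun s => deriv (g k) (η k s)) :=
    hcomp hg hηd (fun m hm => hη.of_le hm.le) hβ0 hβ0
      (by rw [mul_comm]; exact mul_le_mul_of_nonneg_right (le_max_right _ _) hβ0)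
  have hDen : Sc N KD β (fun s => partialD 0 (fun z => (G z).1) (g (k + 1) s, s) -
      partialD 0 (fun z => (G z).2) (g (k + 1) s, s) * deriv (g k) (η k s)) :=
    (hf hP0.1).sub ((hf hP0.2).mul hp)
  have hv : ∀ s, (dIter G 1 (g (k + 1) s, s) (1, 0)).1 -
      (dIter G 1 (g (k + 1) s, s) (1, 0)).2 * deriv (g k) (η k s) =
      partialD 0 (fun z => (G z).1) (g (k + 1) s, s) -
      partialD 0 (fun z => (G z).2) (g (k + 1) s, s) * deriv (g k) (η k s) := by
    intro s
    rw [hs.dIter_apply]; simp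
  have hge : ∀ s, 2 ≤ partialD 0 (fun z => (G z).1) (g (k + 1) s, s) -
      partialD 0 (fun z => (G z).2) (g (k + 1) s, s) * deriv (g k) (η k s) := by
    intro s
    have := (hs.one_add_graph (c.graph k) (g (k + 1) s) s).2
    rw [c.map] at this
    rw [← hv]; exact this
  have hjeq : jac G g η (k + 1) k 1 = fun s => (partialD 0 (fun z => (G z).1) (g (k + 1) s, s) -
      partialD 0 (fun z => (G z).2) (g (k + 1) s, s) * deriv (g k) (η k s))⁻¹ := by
    ext s
    have := c.jac_mul hs (k := 1) (m := k) rfl s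
    rw [hclimb, hv] at this
    exact eq_inv_of_mul_eq_one_left this
  have hj : Sc N C3 β (jac G g η (k + 1) k 1) := by
    rw [hjeq]; exact hinv hDen hge hβ0
  have hdet : Sc N Kdet β (fun s => (dIter G 1 (g (k + 1) s, s)).det) := by
    simp only [hs.det_eq, Function.iterate_one]
    exact ((hf hP0.1).mul (hf hP1.2)).sub ((hf hP0.2).mul (hf hP1.1))
  refine ⟨hη.mono (by linarith) hβ0, hp.mono (by linarith) hβ0, hj.mono (by linarith) hβ0,
    hdet.mono (by linarith) hβ0, fun {f} h => (hf h).mono (by linarith) hβ0⟩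

/-- One step of the graph transform contracts the derivatives of order `N + 2`, up to terms
of lower order. -/
theorem Chain.step_contraction (r : ℕ) (M K₀ : ℝ) (hK₀ : 0 ≤ K₀) (N : ℕ) (hN : N + 2 ≤ r) :
    ∃ C : ℝ, 0 ≤ C ∧ ∀ {G : ℝ × ℝ → ℝ × ℝ} {d : HypConst} {D : ℕ} {e : ℤ} {g η : ℕ → ℝ → ℝ},
      Sys r M G d D e → Chain r G d g η → ∀ {β : ℝ} (k : ℕ), 1 ≤ β →
      Sc N K₀ β (deriv (g k)) → Sc N K₀ β (deriv (g (k + 1))) → ∀ s,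
      |iteratedDeriv (N + 2) (g (k + 1)) s - jac G g η (k + 1) k 1 s * deriv (η k) s ^ (N + 2) *
        iteratedDeriv (N + 2) (g k) (η k s)| ≤ C * β ^ (N + 1) := by
  obtain ⟨C, hC, hcl⟩ := Chain.step_classes r M K₀ hK₀ N (by omega)
  obtain ⟨C1, hC1, hgr⟩ := Pl.comp_graph (N + 1) hK₀
  set Kw := 2 ^ N * (C * (2 ^ N * (C * C))) with hKw
  obtain ⟨C2, hC2, hsp⟩ := Sc.iteratedDeriv_mul_comp N (K₁ := C + Kw) (by positivity)
  set Ka := C1 * |M| with hKa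
  have hKa0 : 0 ≤ Ka := by positivity
  set KE := (2 ^ N * (C * Ka) + Ka) + 2 ^ N * ((Ka + 2 ^ N * (C * Ka)) * K₀) with hKE
  have hKE0 : 0 ≤ KE := by positivity
  refine ⟨2 ^ N * (C * KE) + C2 * K₀, by positivity, fun {G d D e g η} hs c β k hβ hg hg' s => ?_⟩
  have hβ0 : 0 ≤ β := zero_le_one.trans hβ
  obtain ⟨hη, hp, hj, -, hf⟩ := hcl hs c k hβ hg hg'
  have hM : |M| = M := abs_of_pos (zero_lt_one.trans_le hs.one_le_M)
  have hq := hs.diff_graph (c.graph (k + 1))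
  have hηd := hs.diff_diffeo (c.diffeo k)
  have hf1 : ∀ {f : ℝ × ℝ → ℝ}, Pl (r - 1) M f →
      Sc (N + 1) Ka β (fun s => f (g (k + 1) s, s)) := by
    intro f hf
    rw [hKa, hM]
    exact hgr (hf.of_le (by omega)) hq (fun m hm => hg'.of_le (by omega)) hβ
  have hP0 := hs.Pl_partialD 0
  have hP1 := hs.Pl_partialD 1
  have ha := hf1 hP0.1
  have hb := hf1 hP1.1
  have hcc := hf1 hP0.2
  have hee := hf1 hP1.2
  set a : ℝ → ℝ := fun s => partialD 0 (fun z => (G z).1) (g (k + 1) s, s) with had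
  set b : ℝ → ℝ := fun s => partialD 1 (fun z => (G z).1) (g (k + 1) s, s) with hbd
  set cc : ℝ → ℝ := fun s => partialD 0 (fun z => (G z).2) (g (k + 1) s, s) with hcd
  set ee : ℝ → ℝ := fun s => partialD 1 (fun z => (G z).2) (g (k + 1) s, s) with hed
  set u := deriv (g (k + 1)) with hu
  set p : ℝ → ℝ := fun s => deriv (g k) (η k s) with hpd
  have hclimb : climb η k 1 = η k := rfl
  have htan := fun s => c.dIter_tangent hs (k := 1) (m := k) rfl s
  simp only [hclimb, hs.dIter_apply, Function.iterate_one, one_mul] at htan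
  have ht2 : ∀ s, u s * cc s + ee s = deriv (η k) s := fun s => (Prod.ext_iff.1 (htan s)).2
  have ht1 : ∀ s, u s * a s + b s = p s * deriv (η k) s := fun s => (Prod.ext_iff.1 (htan s)).1
  have hJ : ∀ s, jac G g η (k + 1) k 1 s * (a s - cc s * p s) = 1 := by
    intro s
    have := c.jac_mul hs (k := 1) (m := k) rfl s
    rw [hclimb, hs.dIter_apply] at this
    simpa using this
  have hgk2 : ContDiff ℝ (N + 2 : ℕ) (g k) := (c.graph k).smooth.of_le (by exact_mod_cast hN)
  have hgk2' : ContDiff ℝ (N + 2 : ℕ) (g (k + 1)) :=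
    (c.graph (k + 1)).smooth.of_le (by exact_mod_cast hN)
  have hdd : ∀ {f : ℝ → ℝ}, ContDiff ℝ (N + 2 : ℕ) f → ContDiff ℝ (N + 1 : ℕ) (deriv f) := by
    intro f hf
    rw [show N + 2 = (N + 1) + 1 from rfl, Nat.cast_succ (N + 1)] at hf
    exact (contDiff_succ_iff_deriv.1 hf).2.2
  have hud : Differentiable ℝ u := (hdd hgk2').differentiable (by simp)
  have hgd : Differentiable ℝ (deriv (g k)) := (hdd hgk2).differentiable (by simp)
  -- Invariance of the curves reads u·a + b = p·(u·cc + ee). After differentiation the coefficient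
  -- of u' is a - p·cc, the inverse of the Jacobian. Solving for u' isolates the second derivative
  -- of g k with weight J η'²; E only involves first derivatives of the two curves.
  set E : ℝ → ℝ := fun s => (p s * deriv ee s - deriv b s) -
    (deriv a s - p s * deriv cc s) * u s with hE
  have hu' : deriv u = fun s => (jac G g η (k + 1) k 1 s * (deriv (η k) s * deriv (η k) s)) *
      deriv (deriv (g k)) (η k s) + jac G g η (k + 1) k 1 s * E s := by
    ext s
    have hpD : HasDerivAt p (deriv (deriv (g k)) (η k s) * deriv (η k) s) s :=
      (hgd (η k s)).hasDerivAt.comp s (hηd s).hasDerivAt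
    have e1 : (fun s => u s * a s + b s) = fun s => p s * (u s * cc s + ee s) := by
      ext s; rw [ht1, ht2]
    have d1 := ((hud s).hasDerivAt.mul (ha.1 s).hasDerivAt).add (hb.1 s).hasDerivAt
    have d2 := hpD.mul (((hud s).hasDerivAt.mul (hcc.1 s).hasDerivAt).add (hee.1 s).hasDerivAt)
    have e2 := HasDerivAt.unique (d1.congr_of_eventuallyEq
      (Filter.Eventually.of_forall fun x => (congrFun e1 x).symm)) d2
    have e3 := hJ s
    have e4 := ht2 s
    simp only [Pi.mul_apply, Pi.add_apply] at e2
    rw [e4] at e2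
    simp only [hE]
    linear_combination (-deriv u s) * e3 + (jac G g η (k + 1) k 1 s) * e2
  have hw : Sc N Kw β (fun s => jac G g η (k + 1) k 1 s * (deriv (η k) s * deriv (η k) s)) :=
    hj.mul (hη.mul hη)
  have hEs : Sc N (KE * β) β E := by
    have := ((hp.mul hee.2.2).sub hb.2.2).sub ((ha.2.2.sub (hp.mul hcc.2.2)).mul hg')
    refine this.mono (le_of_eq ?_) hβ0
    rw [hKE]; ring
  have hJE := hj.mul hEs
  have hq2 : ∀ m < N, Sc m (K₀ * β) β (deriv (deriv (g k))) :=
    fun m hm => (hg.of_le (N' := m + 1) (by omega)).2.2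
  have hq2c : ContDiff ℝ N (deriv (deriv (g k))) := by
    have := hdd hgk2
    rw [Nat.cast_succ] at this
    exact (contDiff_succ_iff_deriv.1 this).2.2
  have hηc : ContDiff ℝ N (η k) := (c.diffeo k).1.of_le (by exact_mod_cast (by omega : N ≤ r))
  have hKw0 : 0 ≤ Kw := by positivity
  have hmain := hsp hβ0 (mul_nonneg hK₀ hβ0) (hw.mono (by linarith) hβ0) hηc hηd
    (fun m hm => (hη.of_le hm.le).mono (by linarith) hβ0) hq2c hq2 s
  have hw2c : ContDiff ℝ N (fun s => (jac G g η (k + 1) k 1 s *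
      (deriv (η k) s * deriv (η k) s)) * deriv (deriv (g k)) (η k s)) :=
    hw.contDiff.mul (hq2c.comp hηc)
  have e1 : iteratedDeriv (N + 2) (g (k + 1)) s =
      iteratedDeriv N (fun s => (jac G g η (k + 1) k 1 s *
      (deriv (η k) s * deriv (η k) s)) * deriv (deriv (g k)) (η k s)) s +
      iteratedDeriv N (fun s => jac G g η (k + 1) k 1 s * E s) s := by
    rw [iteratedDeriv_succ', iteratedDeriv_succ', ← hu, hu',
      iteratedDeriv_fun_add hw2c.contDiffAt hJE.contDiff.contDiffAt]
  have e2 : iteratedDeriv (N + 2) (g k) (η k s) = iteratedDeriv N (deriv (deriv (g k))) (η k s) := by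
    rw [iteratedDeriv_succ', iteratedDeriv_succ']
  have hJE' := hJE.iteratedDeriv N le_rfl s
  rw [e1, e2]
  set X := iteratedDeriv N (fun s => (jac G g η (k + 1) k 1 s *
      (deriv (η k) s * deriv (η k) s)) * deriv (deriv (g k)) (η k s)) s
  set Y := iteratedDeriv N (fun s => jac G g η (k + 1) k 1 s * E s) s
  set Z := iteratedDeriv N (deriv (deriv (g k))) (η k s)
  have e3 : X + Y - jac G g η (k + 1) k 1 s * deriv (η k) s ^ (N + 2) * Z =
      Y + (X - jac G g η (k + 1) k 1 s * (deriv (η k) s * deriv (η k) s) *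
        deriv (η k) s ^ N * Z) := by ring
  rw [e3]
  refine (abs_add_le _ _).trans ((add_le_add hJE' hmain).trans (le_of_eq ?_))
  ring

end SVPH

/-! ### Derivative bounds along a whole chain -/

namespace SVPH

/-- The pinching condition makes `μ^l / λ₋` uniformly small for all relevant exponents. -/
theorem exists_pinching_rate (r : ℕ) (M : ℝ) : ∃ θ : ℝ, 0 < θ ∧ θ < 1 ∧
    ∀ {G : ℝ × ℝ → ℝ × ℝ} {d : HypConst} {D : ℕ} {e : ℤ}, Sys r M G d D e →
      ∀ l ≤ r, d.μ ^ l / d.lm ≤ θ ^ 2 := by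
  have hm : (0 : ℝ) < (max 1 M)⁻¹ := inv_pos.2 (lt_max_of_lt_left one_pos)
  -- From μ^{2l} ≤ λ₋ follows (μ^l/λ₋)² ≤ 1/λ₋, and λ₋ ≥ 1 + 1/M bounds this by q. The maximum with
  -- 1 keeps q in (0, 1) for every M and equals M as soon as a system exists.
  set q := (1 + (max 1 M)⁻¹)⁻¹ with hq
  have hq0 : 0 < q := inv_pos.2 (by linarith)
  have hq1 : q < 1 := inv_lt_one_of_one_lt₀ (by linarith)
  -- By Bernoulli's inequality the fourth power of (3 + q)/4 is at least q, so this is an explicit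
  -- upper bound for the fourth root of q.
  refine ⟨(3 + q) / 4, by linarith, by linarith, fun {G d D e} h l hl => ?_⟩
  have hM : max 1 M = M := max_eq_right h.one_le_M
  have hlm := h.lm_pos
  have h1 : (d.μ ^ l / d.lm) ^ 2 ≤ q := by
    have h2 : d.μ ^ (l * 2) ≤ d.lm := h.μ_pow_le (by
      have := Nat.self_le_factorial (r + 1)
      omega)
    rw [div_pow, ← pow_mul, div_le_iff₀ (by positivity), hq, hM]
    have h3 : 1 ≤ (1 + M⁻¹)⁻¹ * d.lm := by
      rw [← div_eq_inv_mul, one_le_div (by have := h.M_inv_pos; linarith)]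
      exact h.one_add_le_lm
    nlinarith
  have h2 : q ≤ (((3 + q) / 4) ^ 2) ^ 2 := by
    have := one_add_mul_le_pow (a := (q - 1) / 4) (by linarith) 4
    rw [← pow_mul]
    have e1 : 1 + (q - 1) / 4 = (3 + q) / 4 := by ring
    rw [e1] at this
    refine le_trans (le_of_eq ?_) this
    push_cast; ring
  exact le_of_sq_le_sq (h1.trans h2) (by positivity)

/-- The one-step factors J η'^l need not be less than one, because of the constant in front of the
exponential rate; only their products are controlled. The induction therefore estimates the
derivative on the k-th curve multiplied by the weight of the j steps still to come. Weights decay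
like θ^{2j}, and the spare factor θ absorbs the errors, which decay like θ^k. -/
theorem Chain.iteratedDeriv_le_of_step {r : ℕ} {M : ℝ} {G : ℝ × ℝ → ℝ × ℝ} {d : HypConst} {D : ℕ}
    {e : ℤ} {g η : ℕ → ℝ → ℝ} (h : Sys r M G d D e) (c : Chain r G d g η) {l : ℕ} {θ A A' E : ℝ}
    (hθ0 : 0 < θ) (hθ1 : θ < 1) (hθ : d.μ ^ l / d.lm ≤ θ ^ 2) (hA : 0 ≤ A) (hA' : 0 ≤ A')
    (hE : 0 ≤ E) (h0 : ∀ s, |iteratedDeriv l (g 0) s| ≤ A)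
    (hstep : ∀ k s, |iteratedDeriv l (g (k + 1)) s - jac G g η (k + 1) k 1 s *
      deriv (η k) s ^ l * iteratedDeriv l (g k) (η k s)| ≤ E * (θ ^ k * A + A')) (k : ℕ) (s : ℝ) :
    |iteratedDeriv l (g k) s| ≤
      2 * M ^ 2 * (2 * M) ^ l * (1 + E / (θ * (1 - θ))) * (θ ^ k * A + A') := by
  have hM := zero_lt_one.trans_le h.one_le_M
  set K₁ := 2 * M ^ 2 * (2 * M) ^ l with hK₁
  have hK₁0 : 0 < K₁ := by positivity
  have h1θ : 0 < 1 - θ := sub_pos.2 hθ1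
  -- Chosen so that θ²K₂ + E ≤ θK₂.
  set K₂ := 1 + E / (θ * (1 - θ)) with hK₂
  have hE2 : E ≤ K₂ * (θ * (1 - θ)) := by
    rw [hK₂, add_mul, div_mul_cancel₀ _ (by positivity)]
    have : 0 ≤ 1 * (θ * (1 - θ)) := by positivity
    linarith
  have hK₂1 : 1 ≤ K₂ := by rw [hK₂]; have : 0 ≤ E / (θ * (1 - θ)) := by positivity
                           linarith
  have hP : ∀ {n m j : ℕ}, n = m + j → ∀ s,
      jac G g η n m j s * deriv (climb η m j) s ^ l ≤ K₁ * θ ^ (2 * j) := by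
    intro n m j hn s
    refine (c.jac_mul_pow_le h hn l s).trans ?_
    rw [pow_mul]
    apply mul_le_mul_of_nonneg_left _ hK₁0.le
    exact pow_le_pow_left₀ (div_nonneg (pow_nonneg h.μ_pos.le l) h.lm_pos.le) hθ j
  have hP0 : ∀ n m j s, 0 ≤ jac G g η n m j s * deriv (climb η m j) s ^ l := fun n m j s =>
    mul_nonneg (c.jac_pos h n m j s).le (pow_nonneg (c.deriv_climb_pos h m j s).le l)
  have key : ∀ k j n s, n = k + j →
      jac G g η n k j s * deriv (climb η k j) s ^ l * |iteratedDeriv l (g k) (climb η k j s)| ≤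
        K₁ * θ ^ (2 * j) * (K₂ * (θ ^ k * A + A')) := by
    intro k
    induction k with
    | zero =>
      intro j n s hn
      apply mul_le_mul (hP hn s) _ (abs_nonneg _) (by positivity)
      refine (h0 _).trans ?_
      rw [pow_zero, one_mul]
      nlinarith
    | succ k ih =>
      intro j n s hn
      have hs := hstep k (climb η (k + 1) j s)
      have h1 := ih (j + 1) n s (by omega)
      rw [c.jac_succ h hn, c.deriv_climb_succ h, mul_pow] at h1
      have e0 : climb η k (j + 1) s = η k (climb η (k + 1) j s) := rfl
      rw [e0] at h1
      set t := climb η (k + 1) j s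
      set P := jac G g η n (k + 1) j s * deriv (climb η (k + 1) j) s ^ l with hPdef
      have hPn : 0 ≤ P := hP0 n (k + 1) j s
      set b := jac G g η (k + 1) k 1 t * deriv (η k) t ^ l with hb
      have hbn : 0 ≤ b := hP0 (k + 1) k 1 t
      have h2 : |iteratedDeriv l (g (k + 1)) t| ≤ b * |iteratedDeriv l (g k) (η k t)| +
          E * (θ ^ k * A + A') := by
        have := abs_sub_abs_le_abs_sub (iteratedDeriv l (g (k + 1)) t)
          (b * iteratedDeriv l (g k) (η k t))
        rw [abs_mul, abs_of_nonneg hbn] at this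
        linarith
      have h3 : P * (b * |iteratedDeriv l (g k) (η k t)|) ≤
          K₁ * θ ^ (2 * (j + 1)) * (K₂ * (θ ^ k * A + A')) := by
        refine le_trans (le_of_eq ?_) h1
        rw [hPdef, hb]; ring
      have h4 : P * (E * (θ ^ k * A + A')) ≤ K₁ * θ ^ (2 * j) * (E * (θ ^ k * A + A')) :=
        mul_le_mul_of_nonneg_right (hP hn s) (by positivity)
      have h5 : P * |iteratedDeriv l (g (k + 1)) t| ≤
          K₁ * θ ^ (2 * j) * ((θ ^ 2 * K₂ + E) * (θ ^ k * A + A')) := by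
        refine (mul_le_mul_of_nonneg_left h2 hPn).trans ?_
        rw [mul_add]
        refine (add_le_add h3 h4).trans (le_of_eq ?_)
        ring
      refine h5.trans (mul_le_mul_of_nonneg_left ?_ (by positivity))
      have h6 : θ ^ 2 * K₂ + E ≤ θ * K₂ := by nlinarith
      have h7 : θ ^ 2 * K₂ + E ≤ K₂ := by nlinarith
      have h8 : 0 ≤ θ ^ k * A := by positivity
      calc (θ ^ 2 * K₂ + E) * (θ ^ k * A + A')
          = (θ ^ 2 * K₂ + E) * (θ ^ k * A) + (θ ^ 2 * K₂ + E) * A' := by ring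
        _ ≤ θ * K₂ * (θ ^ k * A) + K₂ * A' := by gcongr
        _ = _ := by rw [pow_succ]; ring
  have := key k 0 k s rfl
  have e1 : jac G g η k k 0 s = 1 := by
    rw [jac, Sys.dIter_zero, clm_det_eq]
    simp [climb, cross]
  have e2 : climb η k 0 = id := rfl
  rw [e1, e2] at this
  simp only [deriv_id, one_pow, mul_one, one_mul, id, mul_zero, pow_zero] at this
  rw [mul_assoc K₁]
  exact this

/-- Together with `factorial_mul_lt` this explains the exponents (l-1)!. At scale β = c^{(L-2)!} the
bounds c^{i!} of the derivatives of order i < L are at most β^i, whereas β^L is still a full factor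
c below c^{L!}. -/
theorem factorial_sub_le {L i : ℕ} (hi : 1 ≤ i) (hiL : i + 1 ≤ L) :
    i ! ≤ (L - 2)! * i := by
  obtain ⟨j, rfl⟩ : ∃ j, i = j + 1 := ⟨i - 1, by omega⟩
  rw [Nat.factorial_succ, mul_comm]
  exact Nat.mul_le_mul_right _ (Nat.factorial_le (by omega))

theorem factorial_mul_lt {L : ℕ} (hL : 3 ≤ L) : (L - 2)! * L ≤ L.factorial - 1 := by
  obtain ⟨j, rfl⟩ : ∃ j, L = j + 3 := ⟨L - 3, by omega⟩
  have h1 : (j + 3)! = (j + 3) * ((j + 2) * (j + 1)!) := by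
    rw [Nat.factorial_succ, Nat.factorial_succ]
  have h2 : 0 < (j + 1)! := Nat.factorial_pos _
  have e : j + 3 - 2 = j + 1 := by omega
  rw [e, h1]
  have : (j + 1)! * (j + 3) + 1 ≤ (j + 3) * ((j + 2) * (j + 1)!) := by nlinarith
  omega

/-- Derivative bounds for all the curves of a chain, with a contraction at the top order. -/
theorem Chain.exists_bounds (r : ℕ) (M θ : ℝ) (hθ0 : 0 < θ) (hθ1 : θ < 1) (L : ℕ) (hL1 : 1 ≤ L)
    (hLr : L ≤ r) : ∃ K : ℝ, 1 ≤ K ∧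
    ∀ {G : ℝ × ℝ → ℝ × ℝ} {d : HypConst} {D : ℕ} {e : ℤ} {g η : ℕ → ℝ → ℝ},
      Sys r M G d D e → Chain r G d g η → (∀ l ≤ r, d.μ ^ l / d.lm ≤ θ ^ 2) → ∀ {c : ℝ}, 1 ≤ c →
      (∀ i, 2 ≤ i → i ≤ L → ∀ s, |iteratedDeriv i (g 0) s| ≤ c ^ (i - 1)!) →
      ∀ l, 2 ≤ l → l ≤ L → ∀ k s,
        |iteratedDeriv l (g k) s| ≤ K * (θ ^ k * c ^ (l - 1)! + c ^ ((l - 1)! - 1)) := by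
  induction L, hL1 using Nat.le_induction with
  | base => exact ⟨1, le_rfl, fun {G d D e g η} _ _ _ c _ _ l h2 h1 => by omega⟩
  | succ L hL ih =>
    obtain ⟨K, hK, ih⟩ := ih (by omega)
    obtain ⟨N, rfl⟩ : ∃ N, L = N + 1 := ⟨L - 1, by omega⟩
    obtain ⟨C, hC, hstep⟩ := Chain.step_contraction r M (2 * K) (by linarith) N (by omega)
    set K' := 2 * |M| ^ 2 * (2 * |M|) ^ (N + 2) * (1 + 2 * C / (θ * (1 - θ))) with hK'
    have h1θ : 0 < 1 - θ := sub_pos.2 hθ1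
    have hK'0 : 0 ≤ K' := by positivity
    refine ⟨K + K', by linarith, fun {G d D e g η} hs ch hθ c hc h0 l hl2 hlL k s => ?_⟩
    have hc0 : 0 < c := zero_lt_one.trans_le hc
    have ih' := ih hs ch hθ hc (fun i hi hi' => h0 i hi (by omega))
    have hX : 0 ≤ θ ^ k * c ^ (l - 1)! + c ^ ((l - 1)! - 1) := by positivity
    rcases Nat.lt_or_ge l (N + 2) with hlt | hge
    · exact (ih' l hl2 (by omega) k s).trans (mul_le_mul_of_nonneg_right (by linarith) hX)
    obtain rfl : l = N + 2 := by omega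
    have hM : |M| = M := abs_of_pos (zero_lt_one.trans_le hs.one_le_M)
    suffices h : ∀ k s, |iteratedDeriv (N + 2) (g (k + 1)) s - jac G g η (k + 1) k 1 s *
        deriv (η k) s ^ (N + 2) * iteratedDeriv (N + 2) (g k) (η k s)| ≤
        2 * C * (θ ^ k * c ^ (N + 2 - 1)! + c ^ ((N + 2 - 1)! - 1)) by
      have := ch.iteratedDeriv_le_of_step hs hθ0 hθ1 (hθ (N + 2) hLr)
        (pow_nonneg hc0.le _) (pow_nonneg hc0.le _) (by positivity)
        (h0 (N + 2) hl2 hlL) h k s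
      rw [← hM, ← hK'] at this
      exact this.trans (mul_le_mul_of_nonneg_right (by linarith) hX)
    intro k s
    -- the scale of the derivatives of lower order
    have hmk : ∀ β : ℝ, 1 ≤ β → (∀ i, 1 ≤ i → i ≤ N → ∀ j, k ≤ j → j ≤ k + 1 →
        K * (θ ^ j * c ^ i ! + c ^ (i.factorial - 1)) ≤ 2 * K * β ^ i) → ∀ j, k ≤ j → j ≤ k + 1 →
        Sc N (2 * K) β (deriv (g j)) := by
      intro β hβ hb j hj1 hj2
      have hsm : ContDiff ℝ (N + 1 : ℕ) (g j) := (ch.graph j).smooth.of_le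
        (by exact_mod_cast (by omega : N + 1 ≤ r))
      rw [Nat.cast_succ] at hsm
      refine Sc.of_contDiff (contDiff_succ_iff_deriv.1 hsm).2.2 fun i hi s => ?_
      rcases Nat.eq_zero_or_pos i with rfl | hi0
      · simp only [iteratedDeriv_zero, pow_zero, mul_one]
        have := hs.slope_le_one (ch.graph j) s
        linarith
      · rw [← iteratedDeriv_succ']
        have := ih' (i + 1) (by omega) (by omega) j s
        rw [Nat.add_sub_cancel] at this
        exact this.trans (hb i hi0 hi j hj1 hj2)
    have hθk : ∀ j, 0 < θ ^ j := fun j => pow_pos hθ0 j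
    have hθk1 : ∀ j, θ ^ j ≤ 1 := fun j => pow_le_one₀ hθ0.le hθ1.le
    have concl : ∀ β : ℝ, 1 ≤ β → (∀ i, 1 ≤ i → i ≤ N → ∀ j, k ≤ j → j ≤ k + 1 →
        K * (θ ^ j * c ^ i ! + c ^ (i.factorial - 1)) ≤ 2 * K * β ^ i) →
        β ^ (N + 1) ≤ 2 * (θ ^ k * c ^ (N + 2 - 1)! + c ^ ((N + 2 - 1)! - 1)) →
        |iteratedDeriv (N + 2) (g (k + 1)) s - jac G g η (k + 1) k 1 s *
          deriv (η k) s ^ (N + 2) * iteratedDeriv (N + 2) (g k) (η k s)| ≤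
          2 * C * (θ ^ k * c ^ (N + 2 - 1)! + c ^ ((N + 2 - 1)! - 1)) := by
      intro β hβ hb hβN
      refine (hstep hs ch k hβ (hmk β hβ hb k le_rfl (by omega))
        (hmk β hβ hb (k + 1) (by omega) le_rfl) s).trans ?_
      exact (mul_le_mul_of_nonneg_left hβN hC).trans (le_of_eq (by ring))
    -- For N ≥ 2 the scale c^{(N-1)!} leaves a factor c to spare. For N = 0 no higher derivative
    -- enters and the scale is 1. For N = 1 the general choice would give c² = c^{2!} without any
    -- gain, so the decay of the second derivative is kept in the scale θ^k c + 1.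
    rcases Nat.lt_or_ge N 2 with hN | hN
    · interval_cases N
      · refine concl 1 le_rfl (fun i h1 h2 => by omega) ?_
        have : 0 ≤ θ ^ k * c ^ (0 + 2 - 1)! := mul_nonneg (hθk k).le (pow_nonneg hc0.le _)
        norm_num at this ⊢
        linarith
      · refine concl (θ ^ k * c + 1) ?_ ?_ ?_
        · have := mul_pos (hθk k) hc0
          linarith
        · intro i h1 h2 j hj1 hj2
          obtain rfl : i = 1 := by omega
          have : θ ^ j ≤ θ ^ k := pow_le_pow_of_le_one hθ0.le hθ1.le hj1
          have := mul_le_mul_of_nonneg_right this hc0.le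
          have h3 := mul_pos (hθk k) hc0
          norm_num
          nlinarith
        · norm_num [Nat.factorial]
          have h3 : θ ^ k * c ≤ c := mul_le_of_le_one_left hc0.le (hθk1 k)
          have h4 := mul_pos (hθk k) hc0
          have h5 : (θ ^ k * c) ^ 2 ≤ θ ^ k * c ^ 2 := by
            rw [mul_pow]
            apply mul_le_mul_of_nonneg_right _ (sq_nonneg c)
            nlinarith [hθk k, hθk1 k]
          nlinarith [sq_nonneg (θ ^ k * c - 1)]
    · refine concl (c ^ (N + 1 - 2)!) (one_le_pow₀ hc) ?_ ?_
      · intro i h1 h2 j hj1 hj2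
        rw [← pow_mul]
        have h3 : c ^ i ! ≤ c ^ ((N + 1 - 2)! * i) :=
          pow_le_pow_right₀ hc (factorial_sub_le h1 (by omega))
        have h4 : c ^ (i.factorial - 1) ≤ c ^ ((N + 1 - 2)! * i) :=
          (pow_le_pow_right₀ hc (Nat.sub_le _ _)).trans h3
        have h5 : θ ^ j * c ^ i ! ≤ c ^ i ! := mul_le_of_le_one_left (by positivity) (hθk1 j)
        have h6 : θ ^ j * c ^ i ! + c ^ (i.factorial - 1) ≤ 2 * c ^ ((N + 1 - 2)! * i) := by linarith
        calc _ ≤ K * (2 * c ^ ((N + 1 - 2)! * i)) := by gcongr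
          _ = _ := by ring
      · rw [← pow_mul]
        have h3 : c ^ ((N + 1 - 2)! * (N + 1)) ≤ c ^ ((N + 2 - 1)! - 1) := by
          apply pow_le_pow_right₀ hc
          have := factorial_mul_lt (L := N + 1) (by omega)
          exact this
        have h4 : 0 ≤ θ ^ k * c ^ (N + 2 - 1)! := by have := hθk k; positivity
        have h5 : 0 ≤ c ^ ((N + 2 - 1)! - 1) := by positivity
        linarith

end SVPH

/-! ### Distortion: logarithmic derivatives of cocycles along a chain -/

namespace SVPH

/-- The logarithmic derivative of a multiplicative cocycle along a chain of reparametrizations,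
when `a m` is the logarithmic derivative of the `m`-th factor. -/
def logSum (η a : ℕ → ℝ → ℝ) : ℕ → ℕ → ℝ → ℝ
  | _, 0 => fun _ => 0
  | m, k + 1 => fun s => a m (climb η (m + 1) k s) * deriv (climb η (m + 1) k) s +
      logSum η a (m + 1) k s

/-- The sum `1 + μ + ⋯ + μ^(n-1)`. -/
def geomS (μ : ℝ) (n : ℕ) : ℝ := ∑ k ∈ Finset.range n, μ ^ k

theorem geomS_succ (μ : ℝ) (n : ℕ) : geomS μ (n + 1) = geomS μ n + μ ^ n :=
  Finset.sum_range_succ _ _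

theorem natCast_le_geomS {μ : ℝ} (hμ : 1 ≤ μ) (n : ℕ) : (n : ℝ) ≤ geomS μ n := by
  induction n with
  | zero => simp [geomS]
  | succ n ih =>
    rw [geomS_succ]; push_cast
    have := one_le_pow₀ hμ (n := n)
    linarith

theorem one_le_geomS {μ : ℝ} (hμ : 1 ≤ μ) {n : ℕ} (hn : 1 ≤ n) : 1 ≤ geomS μ n :=
  (by exact_mod_cast hn : (1 : ℝ) ≤ n).trans (natCast_le_geomS hμ n)

theorem pow_le_mul_geomS {μ : ℝ} (hμ : 1 ≤ μ) {k n : ℕ} (hn : 1 ≤ n) (h : k ≤ n) :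
    μ ^ k ≤ μ * geomS μ n := by
  obtain ⟨n, rfl⟩ : ∃ j, n = j + 1 := ⟨n - 1, by omega⟩
  have hμ0 := zero_le_one.trans hμ
  have h1 : μ ^ k ≤ μ ^ (n + 1) := pow_le_pow_right₀ hμ h
  have h2 : μ ^ n ≤ geomS μ (n + 1) := by
    rw [geomS_succ]
    have : 0 ≤ geomS μ n := Finset.sum_nonneg fun i _ => pow_nonneg hμ0 i
    linarith
  rw [pow_succ'] at h1
  exact h1.trans (mul_le_mul_of_nonneg_left h2 hμ0)

namespace Chain

variable {r : ℕ} {M : ℝ} {G : ℝ × ℝ → ℝ × ℝ} {d : HypConst} {D : ℕ} {e : ℤ} {g η : ℕ → ℝ → ℝ}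

/-- Logarithmic derivatives of cocycles. -/
theorem hasDerivAt_cocycle (h : Sys r M G d D e) (c : Chain r G d g η) {a : ℕ → ℝ → ℝ}
    {f : ℕ → ℝ → ℝ} {P : ℕ → ℕ → ℝ → ℝ} (hf : ∀ m s, HasDerivAt (f m) (a m s * f m s) s)
    (h0 : ∀ m s, P m 0 s = 1)
    (hP : ∀ m k s, P m (k + 1) s = f m (climb η (m + 1) k s) * P (m + 1) k s) (k : ℕ) :
    ∀ m s, HasDerivAt (P m k) (logSum η a m k s * P m k s) s := by
  induction k with
  | zero =>
    intro m s
    have : P m 0 = fun _ => 1 := funext (h0 m)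
    rw [this]
    simpa [logSum] using hasDerivAt_const s (1 : ℝ)
  | succ k ih =>
    intro m s
    have hT := (h.diff_diffeo (c.isCircleDiffeo_climb h k (m + 1)) s).hasDerivAt
    have h1 := ((hf m (climb η (m + 1) k s)).comp s hT).mul (ih (m + 1) s)
    have : P m (k + 1) = (f m ∘ climb η (m + 1) k) * P (m + 1) k := funext (hP m k)
    rw [this]
    refine h1.congr_deriv ?_
    simp only [logSum, Pi.mul_apply, Function.comp_apply]
    ring

theorem hasDerivAt_deriv_climb (h : Sys r M G d D e) (c : Chain r G d g η) (m k : ℕ) (s : ℝ) :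
    HasDerivAt (deriv (climb η m k)) (logSum η (fun m s => deriv (deriv (η m)) s * (deriv (η m) s)⁻¹)
      m k s * deriv (climb η m k) s) s := by
  refine c.hasDerivAt_cocycle h (f := fun m => deriv (η m)) (P := fun m k => deriv (climb η m k))
    (fun m s => ?_) (fun m s => by simp [climb]) (fun m k s => c.deriv_climb_succ h m k s) k m s
  have h2 : ContDiff ℝ ((1 : ℕ) + 1) (η m) := (c.diffeo m).1.of_le (by exact_mod_cast h.two_le)
  have hd : Differentiable ℝ (deriv (η m)) :=
    (contDiff_succ_iff_deriv.1 h2).2.2.differentiable (by simp)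
  rw [mul_assoc, inv_mul_cancel₀ ((c.diffeo m).2.2 s).ne', mul_one]
  exact (hd s).hasDerivAt

/-- The summand carried over k steps contains the derivative of a reparametrization, which is at
most 2Mμ^k. The resulting geometric sum is the quantity behind C_{μ,n}. -/
theorem logSum_le (h : Sys r M G d D e) (c : Chain r G d g η) {a : ℕ → ℝ → ℝ} {A : ℝ}
    (ha : ∀ m s, |a m s| ≤ A) (k : ℕ) : ∀ m s, |logSum η a m k s| ≤ A * (2 * M) * geomS d.μ k := by
  have hA : 0 ≤ A := (abs_nonneg _).trans (ha 0 0)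
  induction k with
  | zero => intro m s; simp [logSum, geomS]
  | succ k ih =>
    intro m s
    have hT := (c.deriv_climb_le h (k := k) (m := m + 1) rfl s).1
    have hTp := c.deriv_climb_pos h (m + 1) k s
    simp only [logSum]
    refine (abs_add_le _ _).trans ?_
    rw [abs_mul, abs_of_pos hTp, geomS_succ]
    have h1 : |a m (climb η (m + 1) k s)| * deriv (climb η (m + 1) k) s ≤ A * (2 * M * d.μ ^ k) :=
      mul_le_mul (ha _ _) hT hTp.le hA
    have h2 := ih (m + 1) s
    calc _ ≤ _ := add_le_add h1 h2
      _ = _ := by ring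

/-- The composition estimate enters as a hypothesis so that its constants are fixed before the
length of the chain. -/
theorem Sc_logSum (h : Sys r M G d D e) (c : Chain r G d g η) {a : ℕ → ℝ → ℝ} {N : ℕ} {A B R T C Q : ℝ}
    (hB : 0 ≤ B) (hR : 0 ≤ R) (n : ℕ)
    (hcomp : ∀ {K B T R : ℝ} {f H : ℝ → ℝ}, Sc N K B f → Differentiable ℝ H →
      (∀ m < N, Sc m T R (deriv H)) → 0 ≤ B → 0 ≤ R → B * T ≤ Q * R →
      Sc N (C * K) R (fun s => f (H s)))
    (ha : ∀ m, Sc N A B (a m)) (hBT : B * T ≤ Q * R)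
    (hT : ∀ m k, m + k = n → Sc N T R (deriv (climb η m k))) (k : ℕ) :
    ∀ m, m + k = n → Sc N (k * (2 ^ N * (C * A * T))) R (logSum η a m k) := by
  induction k with
  | zero => intro m _; simpa [logSum] using Sc.zero N R le_rfl hR
  | succ k ih =>
    intro m hm
    have hT' := hT (m + 1) k (by omega)
    have h1 := (hcomp (ha m) (h.diff_diffeo (c.isCircleDiffeo_climb h k (m + 1)))
      (fun j hj => hT'.of_le hj.le) hB hR hBT).mul hT'
    refine (h1.add (ih (m + 1) (by omega))).mono (le_of_eq ?_) hR
    push_cast; ring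

end Chain

/-- Logarithmic derivatives of the one-step factors. -/
theorem Chain.exists_log_classes (r : ℕ) (M K₀ : ℝ) (hK₀ : 0 ≤ K₀) (N : ℕ) (hN : N + 2 ≤ r) :
    ∃ C : ℝ, 0 ≤ C ∧ ∀ {G : ℝ × ℝ → ℝ × ℝ} {d : HypConst} {D : ℕ} {e : ℤ} {g η : ℕ → ℝ → ℝ},
      Sys r M G d D e → Chain r G d g η → ∀ {B : ℝ}, 1 ≤ B →
      (∀ k, Sc (N + 1) K₀ B (deriv (g k))) → ∀ k,
      Sc N (C * B) B (fun s => deriv (deriv (η k)) s * (deriv (η k) s)⁻¹) ∧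
      Sc N (C * B) B (fun s => deriv (jac G g η (k + 1) k 1) s * (jac G g η (k + 1) k 1 s)⁻¹) ∧
      ∀ s, HasDerivAt (jac G g η (k + 1) k 1)
        (deriv (jac G g η (k + 1) k 1) s * (jac G g η (k + 1) k 1 s)⁻¹ *
          jac G g η (k + 1) k 1 s) s := by
  obtain ⟨C, hC, hcl⟩ := Chain.step_classes r M K₀ hK₀ (N + 1) (by omega)
  set M' := max 1 M with hM'
  have hM'1 : 1 ≤ M' := le_max_left _ _
  have hM'0 : 0 < M' := zero_lt_one.trans_le hM'1
  -- Lower bound for η', from 1 ≤ 2Mμη' and μ ≤ 2M². Dividing by a bound for the determinant turns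
  -- it into the lower bound δ' for the one-step Jacobian.
  set δ := (4 * M' ^ 3)⁻¹ with hδd
  have hδ : 0 < δ := by positivity
  set δ' := δ / (C + 1) with hδd'
  have hδ' : 0 < δ' := by positivity
  obtain ⟨C1, hC1, hinv⟩ := Sc.inv N (K := C) hC hδ
  obtain ⟨C2, hC2, hinv'⟩ := Sc.inv N (K := C) hC hδ'
  refine ⟨2 ^ N * (C * C1) + 2 ^ N * (C * C2), by positivity,
    fun {G d D e g η} hs c B hB hg k => ?_⟩
  have hB0 : 0 ≤ B := zero_le_one.trans hB
  obtain ⟨hη, -, hj, hdet, -⟩ := hcl hs c k hB (hg k) (hg (k + 1))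
  have hMM : M' = M := max_eq_right hs.one_le_M
  have hηge : ∀ s, δ ≤ deriv (η k) s := by
    intro s
    have h1 := (c.deriv_climb_le hs (k := 1) (m := k) rfl s).2
    have e0 : climb η k 1 = η k := rfl
    rw [e0, pow_one] at h1
    have h2 := (c.diffeo k).2.2 s
    have h3 : d.μ ≤ 2 * M ^ 2 := hs.μ_le_lm.trans hs.lm_le
    have hMp := zero_lt_one.trans_le hs.one_le_M
    rw [hδd, hMM, inv_le_iff_one_le_mul₀ (by positivity)]
    calc (1 : ℝ) ≤ _ := h1
      _ ≤ 2 * M * (2 * M ^ 2) * deriv (η k) s := by gcongr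
      _ = _ := by ring
  have hjge : ∀ s, δ' ≤ jac G g η (k + 1) k 1 s := by
    intro s
    have e0 : climb η k 1 = η k := rfl
    rw [jac, e0, hδd']
    have h2 := (abs_le.1 (hdet.bound s)).2
    exact div_le_div₀ (hδ.le.trans (hηge s)) (hηge s) (hs.det_pos _) (by linarith)
  have hi := hinv hη.of_succ hηge hB0
  have hi' := hinv' hj.of_succ hjge hB0
  have p1 : 0 ≤ 2 ^ N * (C * C1) := by positivity
  have p2 : 0 ≤ 2 ^ N * (C * C2) := by positivity
  refine ⟨(hη.2.2.mul hi).mono ?_ hB0, (hj.2.2.mul hi').mono ?_ hB0, fun s => ?_⟩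
  · nlinarith
  · nlinarith
  · rw [mul_assoc, inv_mul_cancel₀ (hδ'.trans_le (hjge s)).ne', mul_one]
    exact (hj.1 s).hasDerivAt

/-- Distortion: the derivatives of the reparametrizations of a chain of length `n`. -/
theorem Chain.exists_climb_class (r : ℕ) (M K₀ : ℝ) (hK₀ : 0 ≤ K₀) (N : ℕ) (hN : N + 1 ≤ r) :
    ∃ C : ℝ, 0 ≤ C ∧ ∀ {G : ℝ × ℝ → ℝ × ℝ} {d : HypConst} {D : ℕ} {e : ℤ} {g η : ℕ → ℝ → ℝ},
      Sys r M G d D e → Chain r G d g η → ∀ {B : ℝ}, 1 ≤ B →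
      (∀ k, Sc N K₀ B (deriv (g k))) → ∀ {n : ℕ}, 1 ≤ n → ∀ m k, m + k = n →
      Sc N (C * geomS d.μ n) (B * geomS d.μ n ^ 2) (deriv (climb η m k)) := by
  induction N with
  | zero =>
    refine ⟨4 * |M| ^ 3, by positivity, fun {G d D e g η} hs c B hB hg n hn m k hmk => ?_⟩
    refine ⟨(c.isCircleDiffeo_climb hs k m).1.continuous_deriv (by
      exact_mod_cast (by omega : 1 ≤ r)), fun s => ?_⟩
    rw [abs_of_pos (c.deriv_climb_pos hs m k s)]
    refine (c.deriv_climb_le hs (k := k) (m := m) rfl s).1.trans ?_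
    have hMp := zero_lt_one.trans_le hs.one_le_M
    rw [abs_of_pos hMp]
    have h1 := pow_le_mul_geomS hs.one_lt_μ.le hn (by omega : k ≤ n)
    have h3 : d.μ ≤ 2 * M ^ 2 := hs.μ_le_lm.trans hs.lm_le
    have hS := zero_le_one.trans (one_le_geomS hs.one_lt_μ.le hn)
    calc 2 * M * d.μ ^ k ≤ 2 * M * (2 * M ^ 2 * geomS d.μ n) := by
          gcongr
          exact h1.trans (mul_le_mul_of_nonneg_right h3 hS)
      _ = _ := by ring
  | succ N ih =>
    obtain ⟨C, hC, ih⟩ := ih (by omega)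
    obtain ⟨A, hA, hlog⟩ := Chain.exists_log_classes r M K₀ hK₀ N (by omega)
    obtain ⟨C2, hC2, hcomp⟩ := Sc.comp N (Q := max 1 C) (le_max_left _ _)
    have hP : 0 ≤ 2 ^ N * (2 ^ N * (C2 * A * C) * C) := by positivity
    refine ⟨C + 2 ^ N * (2 ^ N * (C2 * A * C) * C), by positivity,
      fun {G d D e g η} hs c B hB hg n hn m k hmk => ?_⟩
    have hS := one_le_geomS hs.one_lt_μ.le hn
    set S := geomS d.μ n with hSd
    have hS0 := zero_le_one.trans hS
    have hB0 : 0 ≤ B := zero_le_one.trans hB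
    have hR : 0 ≤ B * S ^ 2 := by positivity
    have ih' := fun m k hmk => ih hs c hB (fun k => (hg k).of_succ) hn m k hmk
    rw [← hSd] at ih'
    have hTm := ih' m k hmk
    have hL := c.Sc_logSum hs (a := fun m s => deriv (deriv (η m)) s * (deriv (η m) s)⁻¹)
      hB0 hR n hcomp (fun m => (hlog hs c hB hg m).1) (T := C * S) (by
        have : B * (C * S) ≤ C * (B * S ^ 2) := by
          have : S ≤ S ^ 2 := by nlinarith
          calc B * (C * S) = C * (B * S) := by ring
            _ ≤ _ := by gcongr
        exact this.trans (mul_le_mul_of_nonneg_right (le_max_right _ _) hR)) ih' k m hmk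
    have hd := c.hasDerivAt_deriv_climb hs m k
    refine ⟨fun s => (hd s).differentiableAt, fun s => (hTm.bound s).trans ?_, ?_⟩
    · apply mul_le_mul_of_nonneg_right _ hS0; linarith
    -- The logarithmic derivative is a sum of at most n ≤ S terms of size B·S, so each further
    -- derivative costs B·S². This is where the scale comes from.
    · have : deriv (deriv (climb η m k)) = fun s => logSum η
          (fun m s => deriv (deriv (η m)) s * (deriv (η m) s)⁻¹) m k s * deriv (climb η m k) s :=
        funext fun s => (hd s).deriv
      rw [this]
      refine (hL.mul hTm).mono ?_ hR
      have hk : (k : ℝ) ≤ S := (by exact_mod_cast (by omega : k ≤ n) : (k : ℝ) ≤ n).trans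
        (natCast_le_geomS hs.one_lt_μ.le n)
      calc 2 ^ N * (↑k * (2 ^ N * (C2 * (A * B) * (C * S))) * (C * S))
          = k * (2 ^ N * (2 ^ N * (C2 * A * C) * C) * (B * S ^ 2)) := by ring
        _ ≤ S * (2 ^ N * (2 ^ N * (C2 * A * C) * C) * (B * S ^ 2)) := by gcongr
        _ = (2 ^ N * (2 ^ N * (C2 * A * C) * C)) * S * (B * S ^ 2) := by ring
        _ ≤ _ := by gcongr; linarith

theorem Chain.hasDerivAt_jac {r : ℕ} {M : ℝ} {G : ℝ × ℝ → ℝ × ℝ} {d : HypConst} {D : ℕ} {e : ℤ}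
    {g η : ℕ → ℝ → ℝ} (h : Sys r M G d D e) (c : Chain r G d g η)
    (hd : ∀ k s, HasDerivAt (jac G g η (k + 1) k 1)
        (deriv (jac G g η (k + 1) k 1) s * (jac G g η (k + 1) k 1 s)⁻¹ *
          jac G g η (k + 1) k 1 s) s) (m k : ℕ) (s : ℝ) :
    HasDerivAt (jac G g η (m + k) m k) (logSum η (fun k s => deriv (jac G g η (k + 1) k 1) s *
      (jac G g η (k + 1) k 1 s)⁻¹) m k s * jac G g η (m + k) m k s) s := by
  refine c.hasDerivAt_cocycle h (f := fun m => jac G g η (m + 1) m 1)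
    (P := fun m k => jac G g η (m + k) m k) hd (fun m s => ?_) (fun m k s => ?_) k m s
  · simp only [jac, Sys.dIter_zero, clm_det_eq]
    simp [climb, cross]
  · have e1 : m + (k + 1) = m + 1 + k := by ring
    simp only [e1]
    exact c.jac_succ h rfl s

/-- Distortion: the derivatives of the Jacobian of a chain of length `n`. -/
theorem Chain.exists_jac_class (r : ℕ) (M K₀ : ℝ) (hK₀ : 0 ≤ K₀) (N : ℕ) (hN : N + 1 ≤ r) :
    ∃ C : ℝ, 1 ≤ C ∧
    ∀ {G : ℝ × ℝ → ℝ × ℝ} {d : HypConst} {D : ℕ} {e : ℤ} {g η : ℕ → ℝ → ℝ},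
      Sys r M G d D e → Chain r G d g η → ∀ {B : ℝ}, 1 ≤ B →
      (∀ k, Sc N K₀ B (deriv (g k))) → (∀ k s, HasDerivAt (jac G g η (k + 1) k 1)
        (deriv (jac G g η (k + 1) k 1) s * (jac G g η (k + 1) k 1 s)⁻¹ *
          jac G g η (k + 1) k 1 s) s) → ∀ {n : ℕ}, 1 ≤ n → ∀ {P : ℝ},
      (∀ s, jac G g η n 0 n s ≤ P) →
      Sc N (C * P) (B * geomS d.μ n ^ 2) (jac G g η n 0 n) := by
  cases N with
  | zero =>
    refine ⟨1, le_rfl, fun {G d D e g η} hs c B hB hg hd n hn P hP => ⟨?_, fun s => ?_⟩⟩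
    · have := c.hasDerivAt_jac hs hd 0 n
      rw [zero_add] at this
      exact continuous_iff_continuousAt.2 fun s => (this s).continuousAt
    · rw [abs_of_pos (c.jac_pos hs _ _ _ s), one_mul]; exact hP s
  | succ N =>
    obtain ⟨C, hC, hcl⟩ := Chain.exists_climb_class r M K₀ hK₀ N (by omega)
    obtain ⟨A, hA, hlog⟩ := Chain.exists_log_classes r M K₀ hK₀ N (by omega)
    obtain ⟨C2, hC2, hcomp⟩ := Sc.comp N (Q := max 1 C) (le_max_left _ _)
    -- The Jacobian solves a linear equation J' = LJ, so all its derivatives stay proportional to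
    -- its supremum P. Keeping P as a factor is what later permits the summation over the branches.
    obtain ⟨C3, hC3, hode⟩ := Sc.of_deriv_eq_mul (N + 1) (K₁ := 2 ^ N * (C2 * A * C)) (by positivity)
    refine ⟨C3, hC3, fun {G d D e g η} hs c B hB hg hd n hn P hP => ?_⟩
    have hS := one_le_geomS hs.one_lt_μ.le hn
    set S := geomS d.μ n with hSd
    have hS0 := zero_le_one.trans hS
    have hB0 : 0 ≤ B := zero_le_one.trans hB
    have hR : 0 ≤ B * S ^ 2 := by positivity
    have ih' := fun m k hmk => hcl hs c hB (fun k => (hg k).of_succ) hn m k hmk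
    rw [← hSd] at ih'
    have hL := c.Sc_logSum hs (a := fun k s => deriv (jac G g η (k + 1) k 1) s *
        (jac G g η (k + 1) k 1 s)⁻¹)
      hB0 hR n hcomp (fun m => (hlog hs c hB hg m).2.1) (T := C * S) (by
        have : B * (C * S) ≤ C * (B * S ^ 2) := by
          have : S ≤ S ^ 2 := by nlinarith
          calc B * (C * S) = C * (B * S) := by ring
            _ ≤ _ := by gcongr
        exact this.trans (mul_le_mul_of_nonneg_right (le_max_right _ _) hR)) ih' n 0 (zero_add n)
    have hJ := c.hasDerivAt_jac hs hd 0 n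
    rw [zero_add] at hJ
    refine hode (fun s => (hJ s).differentiableAt) (fun s => ?_) (fun s => (hJ s).deriv)
      (fun m hm => (hL.of_le (by omega)).mono ?_ hR) hR
    · rw [abs_of_pos (c.jac_pos hs _ _ _ s)]; exact hP s
    · have hk : (n : ℝ) ≤ S := natCast_le_geomS hs.one_lt_μ.le n
      calc ↑n * (2 ^ N * (C2 * (A * B) * (C * S))) = n * (2 ^ N * (C2 * A * C) * B * S) := by ring
        _ ≤ S * (2 ^ N * (C2 * A * C) * B * S) := by gcongr
        _ = _ := by ring

end SVPH

namespace SVPH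

namespace Sys

variable {r : ℕ} {M : ℝ} {G : ℝ × ℝ → ℝ × ℝ} {d : HypConst} {D : ℕ} {e : ℤ}

/-! ### Integer translations -/

theorem add_int_snd (h : Sys r M G d D e) (b : ℤ) (z : ℝ × ℝ) :
    G (z + (0, (b : ℝ))) = G z + (0, (b : ℝ)) := by
  induction b using Int.induction_on generalizing z with
  | zero => simp [← Prod.zero_eq_mk]
  | succ i ih =>
    have e1 : z + (0, ((i + 1 : ℤ) : ℝ)) = (z + (0, ((i : ℤ) : ℝ))) + (0, 1) := by
      ext <;> simp [add_assoc]
    rw [e1, h.add_e₂, ih]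
    ext <;> simp [add_assoc]
  | pred i ih =>
    have h1 := h.add_e₂ (z + (0, ((-i - 1 : ℤ) : ℝ)))
    have e1 : z + (0, ((-i - 1 : ℤ) : ℝ)) + (0, 1) = z + (0, ((-i : ℤ) : ℝ)) := by
      ext <;> simp [add_assoc]
    rw [e1, ih] at h1
    have h2 := eq_sub_of_add_eq h1.symm
    rw [h2]
    ext <;> simp [add_sub_assoc]

theorem add_int_fst (h : Sys r M G d D e) (a : ℤ) (z : ℝ × ℝ) :
    G (z + ((a : ℝ), 0)) = G z + ((D : ℝ) * a, (e : ℝ) * a) := by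
  induction a using Int.induction_on generalizing z with
  | zero => simp [← Prod.zero_eq_mk]
  | succ i ih =>
    have e1 : z + (((i + 1 : ℤ) : ℝ), 0) = (z + (((i : ℤ) : ℝ), 0)) + (1, 0) := by
      ext <;> simp [add_assoc]
    rw [e1, h.add_e₁, ih]
    ext <;> simp <;> ring
  | pred i ih =>
    have h1 := h.add_e₁ (z + (((-i - 1 : ℤ) : ℝ), 0))
    have e1 : z + (((-i - 1 : ℤ) : ℝ), 0) + (1, 0) = z + (((-i : ℤ) : ℝ), 0) := by
      ext <;> simp [add_assoc]
    rw [e1, ih] at h1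
    have h2 := eq_sub_of_add_eq h1.symm
    rw [h2]
    ext <;> simp <;> ring

theorem exists_iter_add_int (h : Sys r M G d D e) (n : ℕ) : ∃ E : ℤ, ∀ (a b : ℤ) (z : ℝ × ℝ),
    G^[n] (z + ((a : ℝ), (b : ℝ))) = G^[n] z + ((D : ℝ) ^ n * a, (E : ℝ) * a + b) := by
  induction n with
  | zero => exact ⟨0, fun a b z => by simp⟩
  | succ n ih =>
    obtain ⟨E, hE⟩ := ih
    refine ⟨e * D ^ n + E, fun a b z => ?_⟩
    rw [Function.iterate_succ_apply', Function.iterate_succ_apply', hE]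
    have e1 : G^[n] z + ((D : ℝ) ^ n * a, (E : ℝ) * a + b) =
        (G^[n] z + (((D ^ n * a : ℤ) : ℝ), 0)) + (0, ((E * a + b : ℤ) : ℝ)) := by
      ext <;> simp
    rw [e1, h.add_int_snd, h.add_int_fst]
    ext <;> simp <;> ring

theorem dIter_add_int (h : Sys r M G d D e) (n : ℕ) (a b : ℤ) (z : ℝ × ℝ) :
    dIter G n (z + ((a : ℝ), (b : ℝ))) = dIter G n z := by
  obtain ⟨E, hE⟩ := h.exists_iter_add_int n
  have h1 := fderiv_comp_add_right (𝕜 := ℝ) (f := G^[n]) (x := z) ((a : ℝ), (b : ℝ))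
  simp only [hE a b] at h1
  rw [fderiv_add_const] at h1
  exact h1.symm

theorem dIter_add_int' (h : Sys r M G d D e) (n : ℕ) (b : ℤ) (x s : ℝ) :
    dIter G n (x, s + b) = dIter G n (x, s) := by
  have := h.dIter_add_int n 0 b (x, s)
  simpa using this

end Sys

/-! ### The norm of `ω` -/

theorem supSquare_nonneg (f : ℝ × ℝ → ℝ) : 0 ≤ supSquare f :=
  Real.sSup_nonneg (by rintro _ ⟨z, -, rfl⟩; exact abs_nonneg _)

theorem supSquare_le_ckNorm (k : ℕ) : ∀ f, supSquare f ≤ ckNorm k f := by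
  induction k with
  | zero => exact fun f => le_rfl
  | succ k ih =>
    intro f
    have h1 := supSquare_nonneg f
    have h2 := (supSquare_nonneg _).trans (ih (partialD 0 f))
    have h3 := h2.trans (le_max_left _ (ckNorm k (partialD 1 f)))
    have h4 : (1 : ℝ) ≤ 2 ^ (k + 1) := one_le_pow₀ (by norm_num)
    simp only [ckNorm]
    nlinarith

theorem ckNorm_nonneg (k : ℕ) (f : ℝ × ℝ → ℝ) : 0 ≤ ckNorm k f :=
  (supSquare_nonneg f).trans (supSquare_le_ckNorm k f)

theorem abs_le_supSquare {f : ℝ × ℝ → ℝ} (hf : Continuous f) {z : ℝ × ℝ}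
    (hz : z ∈ Set.Icc (0 : ℝ) 1 ×ˢ Set.Icc (0 : ℝ) 1) : |f z| ≤ supSquare f := by
  refine le_csSup ?_ ⟨z, hz, rfl⟩
  exact ((isCompact_Icc.prod isCompact_Icc).bddAbove_image hf.abs.continuousOn)

namespace Sys

variable {r : ℕ} {M : ℝ} {G : ℝ × ℝ → ℝ × ℝ} {d : HypConst} {D : ℕ} {e : ℤ}

theorem CF_nonneg (h : Sys r M G d D e) : 0 ≤ CF r G d :=
  add_nonneg h.hyp.χu_pos.le (ckNorm_nonneg _ _)

/-- The norm of ω only sees the unit square; integer translations leave DG unchanged, so the bound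
extends to the whole plane. -/
theorem abs_partialD_le_CF (h : Sys r M G d D e) (z : ℝ × ℝ) :
    |partialD 0 (fun y => (G y).2) z| ≤ CF r G d := by
  have h1 : ∀ w, |partialD 0 (omega G) w| ≤ ckNorm r (omega G) →
      |partialD 0 (omega G) w| ≤ CF r G d := fun w hw => by
    have := h.hyp.χu_pos; simp only [CF]; linarith
  have hper : partialD 0 (fun y => (G y).2) z =
      partialD 0 (fun y => (G y).2) (Int.fract z.1, Int.fract z.2) := by
    have h2 := h.dIter_add_int 1 ⌊z.1⌋ ⌊z.2⌋ (Int.fract z.1, Int.fract z.2)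
    have e1 : (Int.fract z.1, Int.fract z.2) + ((⌊z.1⌋ : ℝ), (⌊z.2⌋ : ℝ)) = z :=
      Prod.ext (Int.fract_add_floor _) (Int.fract_add_floor _)
    rw [e1] at h2
    have h3 := h.partialD_snd 1 0
    simp only [Function.iterate_one] at h3
    rw [h3, h3, h2]
  rw [hper, ← h.partialD_omega]
  apply h1
  obtain ⟨k, rfl⟩ : ∃ k, r = k + 1 := ⟨r - 1, by have := h.two_le; omega⟩
  have hc : Continuous (partialD 0 (omega G)) := by
    have : partialD 0 (omega G) = partialD 0 (fun y => (G y).2) := funext h.partialD_omega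
    rw [this]; exact (h.Pl_partialD 0).2.continuous
  have h4 := abs_le_supSquare hc (z := (Int.fract z.1, Int.fract z.2))
    ⟨⟨Int.fract_nonneg _, (Int.fract_lt_one _).le⟩, ⟨Int.fract_nonneg _, (Int.fract_lt_one _).le⟩⟩
  refine h4.trans ((supSquare_le_ckNorm k _).trans ?_)
  simp only [ckNorm]
  have h5 := supSquare_nonneg (omega G)
  have h6 : 0 ≤ (2 : ℝ) ^ (k + 1) * supSquare (omega G) := by positivity
  have := le_max_left (ckNorm k (partialD 0 (omega G))) (ckNorm k (partialD 1 (omega G)))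
  linarith

end Sys

/-- Since f' ≤ Lf, the function f minus L times its integral is nonincreasing. Hence f(s) exceeds
f(t) by at most L times the mean for every t in the period before s, and averaging over t gives the
claim. -/
theorem le_integral_of_abs_deriv_le {f f' : ℝ → ℝ} {L : ℝ} (hd : ∀ s, HasDerivAt f (f' s) s)
    (hpos : ∀ s, 0 ≤ f s) (hL : ∀ s, |f' s| ≤ L * f s) (hL0 : 0 ≤ L)
    (hp : Function.Periodic f 1) (s : ℝ) : f s ≤ (1 + L) * ∫ t in (0 : ℝ)..1, f t := by
  have hc : Continuous f := continuous_iff_continuousAt.2 fun s => (hd s).continuousAt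
  have hI : ∀ a b, IntervalIntegrable f MeasureTheory.volume a b := fun a b =>
    hc.intervalIntegrable a b
  have hI1 : ∫ t in (s - 1)..s, f t = ∫ t in (0 : ℝ)..1, f t := by
    have := hp.intervalIntegral_add_eq (s - 1) 0
    simpa using this
  have key : ∀ t ∈ Set.Icc (s - 1) s, f s ≤ f t + L * ∫ x in (0 : ℝ)..1, f x := by
    intro t ht
    have hanti : Antitone fun x => f x - L * ∫ y in t..x, f y := by
      have hder : ∀ x, HasDerivAt (fun x => f x - L * ∫ y in t..x, f y) (f' x - L * f x) x :=
        fun x => (hd x).sub ((intervalIntegral.integral_hasDerivAt_right (hI _ _)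
          hc.stronglyMeasurable.stronglyMeasurableAtFilter hc.continuousAt).const_mul L)
      refine antitone_of_deriv_nonpos (fun x => (hder x).differentiableAt) fun x => ?_
      rw [(hder x).deriv]
      have := (abs_le.1 (hL x)).2
      linarith
    have h1 := hanti ht.2
    simp only [intervalIntegral.integral_same, mul_zero, sub_zero] at h1
    have h2 : ∫ y in t..s, f y ≤ ∫ y in (s - 1)..s, f y := by
      rw [← intervalIntegral.integral_add_adjacent_intervals (hI (s - 1) t) (hI t s)]
      have := intervalIntegral.integral_nonneg (f := f) (μ := MeasureTheory.volume) ht.1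
        fun u _ => hpos u
      linarith
    rw [hI1] at h2
    have := mul_le_mul_of_nonneg_left h2 hL0
    linarith
  have h3 := intervalIntegral.integral_mono_on (a := s - 1) (b := s) (by linarith)
    (f := fun _ => f s) (g := fun t => f t + L * ∫ x in (0 : ℝ)..1, f x)
    (intervalIntegrable_const) ((hI _ _).add intervalIntegrable_const) key
  rw [intervalIntegral.integral_const, intervalIntegral.integral_add (hI _ _)
    intervalIntegrable_const, hI1, intervalIntegral.integral_const] at h3
  simp only [sub_sub_cancel, one_smul] at h3
  linarith

/-! ### Suprema and means of the Jacobian -/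

namespace Chain

variable {r : ℕ} {M : ℝ} {G : ℝ × ℝ → ℝ × ℝ} {d : HypConst} {D : ℕ} {e : ℤ} {g η : ℕ → ℝ → ℝ}

theorem deriv_climb_periodic (h : Sys r M G d D e) (c : Chain r G d g η) (m k : ℕ) (s : ℝ) :
    deriv (climb η m k) (s + 1) = deriv (climb η m k) s := by
  have h1 := (c.isCircleDiffeo_climb h k m).2.1
  rw [← deriv_comp_add_const]
  have : (fun x => climb η m k (x + 1)) = fun x => climb η m k x + 1 := funext h1
  rw [this, deriv_add_const]

theorem jac_periodic (h : Sys r M G d D e) (c : Chain r G d g η) (n m k : ℕ) :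
    Function.Periodic (jac G g η n m k) 1 := by
  intro s
  simp only [jac]
  rw [c.deriv_climb_periodic h, (c.graph n).periodic]
  have := h.dIter_add_int' k 1 (g n s) s
  rw [Int.cast_one] at this
  rw [this]

/-- The Jacobian is the inverse of a - cc·p, and X is the derivative of this denominator. The second
derivative of the curve occurs only multiplied by cc = ∂_xω, which is at most C_F: this is the
origin of the factor 1 + C_F c in the theorem. -/
theorem hasDerivAt_jac_step (h : Sys r M G d D e) (c : Chain r G d g η) (k : ℕ) (s : ℝ) :
    ∃ X : ℝ, HasDerivAt (jac G g η (k + 1) k 1) (-(X * jac G g η (k + 1) k 1 s) *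
      jac G g η (k + 1) k 1 s) s ∧ jac G g η (k + 1) k 1 s ≤ 1 / 2 ∧
      |X| ≤ 4 * M + 4 * M ^ 3 * CF r G d * |deriv (deriv (g k)) (η k s)| := by
  have hMp := zero_lt_one.trans_le h.one_le_M
  have hP0 := h.Pl_partialD 0
  obtain ⟨N, hN⟩ : ∃ N, r - 1 = N + 1 := ⟨r - 2, by have := h.two_le; omega⟩
  rw [hN] at hP0
  have hq := h.diff_graph (c.graph (k + 1))
  have hηd := h.diff_diffeo (c.diffeo k)
  have h2 : ContDiff ℝ ((1 : ℕ) + 1) (g k) := (c.graph k).smooth.of_le (by exact_mod_cast h.two_le)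
  have hgd : Differentiable ℝ (deriv (g k)) :=
    (contDiff_succ_iff_deriv.1 h2).2.2.differentiable (by simp)
  set a : ℝ → ℝ := fun s => partialD 0 (fun z => (G z).1) (g (k + 1) s, s) with had
  set cc : ℝ → ℝ := fun s => partialD 0 (fun z => (G z).2) (g (k + 1) s, s) with hcd
  set p : ℝ → ℝ := fun s => deriv (g k) (η k s) with hpd
  have hclimb : climb η k 1 = η k := rfl
  have hbd : ∀ {f : ℝ × ℝ → ℝ}, Pl (N + 1) M f → HasDerivAt (fun s => f (g (k + 1) s, s))
      (deriv (fun s => f (g (k + 1) s, s)) s) s ∧ |deriv (fun s => f (g (k + 1) s, s)) s| ≤ 2 * M := by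
    intro f hf
    constructor
    · exact (hf.1.comp (hq.prodMk differentiable_id) s).hasDerivAt
    · rw [deriv_comp_graph hf.1 hq]
      have h3 := (hf.2.2 0).bound (g (k + 1) s, s)
      have h4 := (hf.2.2 1).bound (g (k + 1) s, s)
      have h5 := h.slope_le_one (c.graph (k + 1)) s
      refine (abs_add_le _ _).trans ?_
      rw [abs_mul]
      have := mul_le_mul h3 h5 (abs_nonneg _) hMp.le
      linarith
  have hηs : deriv (η k) s ≤ 4 * M ^ 3 := by
    have h1 := (c.deriv_climb_le h (k := 1) (m := k) rfl s).1
    rw [hclimb, pow_one] at h1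
    have h3 : d.μ ≤ 2 * M ^ 2 := h.μ_le_lm.trans h.lm_le
    calc _ ≤ _ := h1
      _ ≤ 2 * M * (2 * M ^ 2) := by gcongr
      _ = _ := by ring
  have hηp := (c.diffeo k).2.2 s
  have hpD : HasDerivAt p (deriv (deriv (g k)) (η k s) * deriv (η k) s) s :=
    (hgd (η k s)).hasDerivAt.comp s (hηd s).hasDerivAt
  have hDD : HasDerivAt (fun s => a s - cc s * p s) (deriv a s - (deriv cc s * p s +
      cc s * (deriv (deriv (g k)) (η k s) * deriv (η k) s))) s :=
    (hbd hP0.1).1.fun_sub ((hbd hP0.2).1.fun_mul hpD)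
  have hge : ∀ s, 2 ≤ a s - cc s * p s := by
    intro s
    have := (h.one_add_graph (c.graph k) (g (k + 1) s) s).2
    rw [c.map, h.dIter_apply] at this
    simpa using this
  have hJ : ∀ s, jac G g η (k + 1) k 1 s = (a s - cc s * p s)⁻¹ := by
    intro s
    have := c.jac_mul h (k := 1) (m := k) rfl s
    rw [hclimb, h.dIter_apply] at this
    apply eq_inv_of_mul_eq_one_left
    simpa using this
  have hne : a s - cc s * p s ≠ 0 := by have := hge s; linarith
  refine ⟨deriv a s - (deriv cc s * p s + cc s * (deriv (deriv (g k)) (η k s) * deriv (η k) s)),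
    ?_, ?_, ?_⟩
  · have := hDD.fun_inv hne
    rw [show jac G g η (k + 1) k 1 = fun s => (a s - cc s * p s)⁻¹ from funext hJ]
    refine this.congr_deriv ?_
    rw [neg_mul, ← inv_inv ((a s - cc s * p s) ^ 2), ← inv_pow, div_eq_mul_inv, inv_inv, neg_mul]
    ring
  · rw [hJ, one_div]; exact inv_anti₀ two_pos (hge s)
  · have h3 := (hbd hP0.1).2
    have h4 := (hbd hP0.2).2
    have h5 : |p s| ≤ 1 := h.slope_le_one (c.graph k) _
    have h6 : |cc s| ≤ CF r G d := h.abs_partialD_le_CF _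
    have h7 : |deriv cc s * p s| ≤ 2 * M := by
      rw [abs_mul]; have := mul_le_mul h4 h5 (abs_nonneg _) (by positivity); linarith
    have h8 : |cc s * (deriv (deriv (g k)) (η k s) * deriv (η k) s)| ≤
        4 * M ^ 3 * CF r G d * |deriv (deriv (g k)) (η k s)| := by
      rw [abs_mul, abs_mul, abs_of_pos hηp]
      have := mul_le_mul h6 (mul_le_mul_of_nonneg_left hηs
        (abs_nonneg (deriv (deriv (g k)) (η k s)))) (by positivity) h.CF_nonneg
      refine this.trans (le_of_eq (by ring))
    refine (abs_sub _ _).trans ?_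
    have := abs_add_le (deriv cc s * p s) (cc s * (deriv (deriv (g k)) (η k s) * deriv (η k) s))
    linarith

theorem hasDerivAt_jac_self (h : Sys r M G d D e) (c : Chain r G d g η) (k : ℕ) (s : ℝ) :
    HasDerivAt (jac G g η (k + 1) k 1)
        (deriv (jac G g η (k + 1) k 1) s * (jac G g η (k + 1) k 1 s)⁻¹ *
          jac G g η (k + 1) k 1 s) s := by
  obtain ⟨X, hX, -⟩ := c.hasDerivAt_jac_step h k s
  rw [mul_assoc, inv_mul_cancel₀ (c.jac_pos h _ _ _ s).ne', mul_one]
  exact hX.differentiableAt.hasDerivAt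

/-- The supremum of the Jacobian is controlled by its mean. -/
theorem jac_le_integral (h : Sys r M G d D e) (c : Chain r G d g η) {A : ℝ}
    (hA : ∀ k s, |deriv (deriv (g k)) s| ≤ A) (n : ℕ) (s : ℝ) :
    jac G g η n 0 n s ≤ (1 + (4 * M + 4 * M ^ 3 * CF r G d * A) * (2 * M) * geomS d.μ n) *
      ∫ t in (0 : ℝ)..1, jac G g η n 0 n t := by
  have hMp := zero_lt_one.trans_le h.one_le_M
  have hCF := h.CF_nonneg
  have hA0 : 0 ≤ A := (abs_nonneg _).trans (hA 0 0)
  have hd := c.hasDerivAt_jac h (c.hasDerivAt_jac_self h) 0 n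
  rw [zero_add] at hd
  have hS : 0 ≤ geomS d.μ n := Finset.sum_nonneg fun i _ => pow_nonneg h.μ_pos.le i
  refine le_integral_of_abs_deriv_le hd (fun s => (c.jac_pos h _ _ _ s).le) (fun s => ?_)
    (by positivity) (c.jac_periodic h n 0 n) s
  rw [abs_mul, abs_of_pos (c.jac_pos h _ _ _ s)]
  refine mul_le_mul_of_nonneg_right ?_ (c.jac_pos h _ _ _ s).le
  refine c.logSum_le h (fun m s => ?_) n 0 s
  obtain ⟨X, hX, hj, hXb⟩ := c.hasDerivAt_jac_step h m s
  have hjp := c.jac_pos h (m + 1) m 1 s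
  rw [hX.deriv, mul_assoc, mul_inv_cancel₀ hjp.ne', mul_one, abs_neg, abs_mul, abs_of_pos hjp]
  have h1 : 4 * M ^ 3 * CF r G d * |deriv (deriv (g m)) (η m s)| ≤ 4 * M ^ 3 * CF r G d * A := by
    have := hA m (η m s)
    gcongr
  have h2 : |X| * jac G g η (m + 1) m 1 s ≤ |X| * 1 :=
    mul_le_mul_of_nonneg_left (by linarith) (abs_nonneg _)
  linarith

end Chain

/-! ### Summing over the preimages -/

namespace Sys

variable {r : ℕ} {M : ℝ} {G : ℝ × ℝ → ℝ × ℝ} {d : HypConst} {D : ℕ} {e : ℤ}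

theorem periodic_int {g : ℝ → ℝ} (hg : ∀ t, g (t + 1) = g t) (m : ℤ) (t : ℝ) :
    g (t + m) = g t := by
  have : Function.Periodic g 1 := hg
  have := this.int_mul m t
  simpa using this

/-- The Jacobians of all the preimages of a central curve have a uniformly bounded sum. -/
theorem sum_jac_le (h : Sys r M G d D e) {g₀ : ℝ → ℝ} (hg₀ : CentralGraph r d.χc g₀)
    {g η : ℕ → ℕ → ℝ → ℝ} (c : ∀ j, Chain r G d (g j) (η j)) (h0 : ∀ j t, g j 0 t = g₀ t + j)
    (n : ℕ) (s : ℝ) :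
    ∑ j ∈ Finset.range (D ^ n), jac G (g j) (η j) n 0 n s ≤ M * (2 + 80 * M ^ 7) := by
  have hMp := zero_lt_one.trans_le h.one_le_M
  set v : ℝ → ℝ × ℝ := fun x => dIter G n (x, s) (1, 0) with hv
  have hvp : ∀ x, 0 < (v x).1 := fun x => h.fst_iter_pos n (x, s) h.e₁_mem (by simp)
  have hvc : ∀ x, |(v x).2| ≤ (v x).1 := fun x =>
    (h.snd_le_of_mem (h.coneU_iter n (x, s) h.e₁_mem) (hvp x)).trans
      (mul_le_of_le_one_left (hvp x).le h.hyp.χu_lt.le)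
  -- On the horizontal line at height s the branch j passes where ψ = j. As ψ increases, and by D^n
  -- over a unit interval, the D^n branches cut one period into consecutive gaps.
  set ψ : ℝ → ℝ := fun x => (G^[n] (x, s)).1 - g₀ (G^[n] (x, s)).2 with hψ
  have hψd : ∀ x, HasDerivAt ψ ((v x).1 - (v x).2 * deriv g₀ (G^[n] (x, s)).2) x := by
    intro x
    have h1 := h.hasDerivAt_iter_line n x s
    have h2 : HasDerivAt (fun x => (G^[n] (x, s)).1) (v x).1 x :=
      ((ContinuousLinearMap.fst ℝ ℝ ℝ).hasFDerivAt).comp_hasDerivAt x h1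
    have h3 : HasDerivAt (fun x => (G^[n] (x, s)).2) (v x).2 x :=
      ((ContinuousLinearMap.snd ℝ ℝ ℝ).hasFDerivAt).comp_hasDerivAt x h1
    have h4 := ((h.diff_graph hg₀ (G^[n] (x, s)).2).hasDerivAt).comp x h3
    rw [mul_comm (v x).2]
    exact h2.sub h4
  have hψm : StrictMono ψ := by
    refine strictMono_of_deriv_pos fun x => ?_
    rw [(hψd x).deriv]
    exact h.transverse_pos n (x, s) (h.slope_le_one hg₀ _)
  set x : ℕ → ℝ := fun j => g j n s with hx
  have hψx : ∀ j : ℕ, ψ (x j) = j := by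
    intro j
    have := (c j).iter_map n (m := 0) (zero_add n).symm s
    simp only [hψ, hx, this, h0]
    ring
  have hxlt : ∀ j, x j < x (j + 1) := fun j => hψm.lt_iff_lt.1 (by rw [hψx, hψx]; push_cast; linarith)
  have hxD : x (D ^ n) = x 0 + 1 := by
    apply hψm.injective
    obtain ⟨E, hE⟩ := h.exists_iter_add_int n
    have h1 := hE 1 0 (x 0, s)
    simp only [Int.cast_one, Int.cast_zero, Prod.mk_add_mk, add_zero, mul_one] at h1
    have h2 := hψx 0
    rw [hψx]
    simp only [hψ] at h2 ⊢
    rw [h1]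
    simp only [Prod.fst_add, Prod.snd_add]
    rw [periodic_int hg₀.periodic]
    push_cast at h2 ⊢
    linarith
  have hterm : ∀ j, jac G (g j) (η j) n 0 n s ≤ M * ((2 + 80 * M ^ 7) * (x (j + 1) - x j)) := by
    intro j
    refine ((c j).jac_le h (zero_add n).symm s).1.trans (mul_le_mul_of_nonneg_left ?_ hMp.le)
    change ((v (x j)).1)⁻¹ ≤ _
    have hpos := sub_pos.2 (hxlt j)
    -- ψ grows by 1 across the gap and ψ' ≤ 2 (v ξ).1, so somewhere in the gap the reciprocal
    -- expansion is at most twice its length.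
    obtain ⟨ξ, hξ, hξe⟩ := exists_deriv_eq_slope ψ (hxlt j)
      (fun y _ => (hψd y).continuousAt.continuousWithinAt)
      (fun y _ => (hψd y).differentiableAt.differentiableWithinAt)
    rw [hψx, hψx, (hψd ξ).deriv, eq_div_iff hpos.ne'] at hξe
    have hξ2 : ((v ξ).1)⁻¹ ≤ 2 * (x (j + 1) - x j) := by
      rw [inv_le_iff_one_le_mul₀ (hvp ξ)]
      have h1 : (v ξ).1 - (v ξ).2 * deriv g₀ (G^[n] (ξ, s)).2 ≤ 2 * (v ξ).1 := by
        have h2 : |(v ξ).2 * deriv g₀ (G^[n] (ξ, s)).2| ≤ (v ξ).1 := by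
          rw [abs_mul]
          exact (mul_le_of_le_one_right (abs_nonneg _) (h.slope_le_one hg₀ _)).trans (hvc ξ)
        have := (abs_le.1 h2).1
        linarith
      have h3 := mul_le_mul_of_nonneg_right h1 hpos.le
      push_cast at hξe
      nlinarith
    choose w hw hwb using fun y => h.exists_hasDerivAt_fst s y n
    -- The uniform Lipschitz bound carries the estimate from ξ to the branch itself, again at the
    -- cost of a multiple of the gap. The gaps then telescope to 1.
    have hlip : |((v ξ).1)⁻¹ - ((v (x j)).1)⁻¹| ≤ 80 * M ^ 7 * |ξ - x j| := by
      have := Convex.norm_image_sub_le_of_norm_hasDerivWithin_le (f := fun y => ((v y).1)⁻¹)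
        (f' := w) (s := Set.univ) (C := 80 * M ^ 7) (x := x j) (y := ξ)
        (fun y _ => (hw y).hasDerivWithinAt) (fun y _ => hwb y) convex_univ trivial trivial
      exact this
    rw [abs_of_pos (sub_pos.2 hξ.1)] at hlip
    have h1 := (abs_le.1 hlip).1
    have h2 : 80 * M ^ 7 * (ξ - x j) ≤ 80 * M ^ 7 * (x (j + 1) - x j) := by
      have := hξ.2.le
      gcongr
    linarith
  calc _ ≤ ∑ j ∈ Finset.range (D ^ n), M * ((2 + 80 * M ^ 7) * (x (j + 1) - x j)) :=
        Finset.sum_le_sum fun j _ => hterm j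
    _ = M * ((2 + 80 * M ^ 7) * ∑ j ∈ Finset.range (D ^ n), (x (j + 1) - x j)) := by
        rw [Finset.mul_sum, Finset.mul_sum]
    _ = M * (2 + 80 * M ^ 7) := by
        rw [Finset.sum_range_sub, hxD]; ring

/-- Uniform bounds for the Jacobians of the preimages of a central curve. -/
theorem exists_jac_sup (h : Sys r M G d D e) {g₀ : ℝ → ℝ} (hg₀ : CentralGraph r d.χc g₀)
    {g η : ℕ → ℕ → ℝ → ℝ} (c : ∀ j, Chain r G d (g j) (η j)) (h0 : ∀ j t, g j 0 t = g₀ t + j)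
    {K A : ℝ} (hK : 1 ≤ K) (hA0 : 0 ≤ A) (hA : ∀ j k s, |deriv (deriv (g j k)) s| ≤ K * A) {n : ℕ}
    (hn : 1 ≤ n) :
    ∃ P : ℕ → ℝ, (∀ j s, jac G (g j) (η j) n 0 n s ≤ P j) ∧ (∀ j, 0 ≤ P j) ∧
      ∑ j ∈ Finset.range (D ^ n), P j ≤
        9 * M ^ 4 * K * (M * (2 + 80 * M ^ 7)) * ((1 + CF r G d * A) * geomS d.μ n) := by
  have hMp := zero_lt_one.trans_le h.one_le_M
  have hCF := h.CF_nonneg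
  have hS := one_le_geomS h.one_lt_μ.le hn
  set S := geomS d.μ n
  set L := (4 * M + 4 * M ^ 3 * CF r G d * (K * A)) * (2 * M) * S with hL
  have hL0 : 0 ≤ L := by positivity
  have hcont : ∀ j, Continuous (jac G (g j) (η j) n 0 n) := by
    intro j
    have hd := (c j).hasDerivAt_jac h ((c j).hasDerivAt_jac_self h) 0 n
    rw [zero_add] at hd
    exact continuous_iff_continuousAt.2 fun s => (hd s).continuousAt
  -- By distortion the supremum on a branch is at most 1 + L times the mean, and the sum of the
  -- means is the integral of the pointwise bounded sum.
  refine ⟨fun j => (1 + L) * ∫ t in (0 : ℝ)..1, jac G (g j) (η j) n 0 n t,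
    fun j s => (c j).jac_le_integral h (hA j) n s, fun j => ?_, ?_⟩
  · exact mul_nonneg (by linarith) (intervalIntegral.integral_nonneg zero_le_one
      fun t _ => ((c j).jac_pos h _ _ _ t).le)
  · rw [← Finset.mul_sum, ← intervalIntegral.integral_finsetSum
      fun j _ => (hcont j).intervalIntegrable _ _]
    have h1 : ∫ t in (0 : ℝ)..1, ∑ j ∈ Finset.range (D ^ n), jac G (g j) (η j) n 0 n t ≤
        M * (2 + 80 * M ^ 7) := by
      have h2 := intervalIntegral.integral_mono_on (a := (0 : ℝ)) (b := 1) zero_le_one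
        (μ := MeasureTheory.volume)
        (f := fun t => ∑ j ∈ Finset.range (D ^ n), jac G (g j) (η j) n 0 n t)
        (g := fun _ => M * (2 + 80 * M ^ 7))
        ((continuous_finsetSum _ fun j _ => hcont j).intervalIntegrable _ _)
        intervalIntegrable_const (fun t _ => h.sum_jac_le hg₀ c h0 n t)
      simpa using h2
    have h3 : 1 + L ≤ 9 * M ^ 4 * K * ((1 + CF r G d * A) * S) := by
      have hM1 := h.one_le_M
      have e1 : L = 8 * M ^ 2 * S + 8 * M ^ 4 * K * (CF r G d * A) * S := by rw [hL]; ring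
      have h5 : M ^ 2 ≤ M ^ 4 * K := by
        have : M ^ 2 ≤ M ^ 4 := pow_le_pow_right₀ hM1 (by norm_num)
        exact this.trans (le_mul_of_one_le_right (by positivity) hK)
      have h6 : 1 ≤ M ^ 4 * K := one_le_mul_of_one_le_of_one_le (one_le_pow₀ hM1) hK
      have hX : 0 ≤ CF r G d * A := by positivity
      have hXS : 0 ≤ CF r G d * A * S := by positivity
      have h7 : 8 * M ^ 2 * S ≤ 8 * (M ^ 4 * K) * S := by gcongr
      have h8 : (1 : ℝ) ≤ M ^ 4 * K * S := one_le_mul_of_one_le_of_one_le h6 hS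
      have h9 : 0 ≤ M ^ 4 * K * (CF r G d * A * S) := by positivity
      rw [e1]
      nlinarith
    calc _ ≤ (1 + L) * (M * (2 + 80 * M ^ 7)) := mul_le_mul_of_nonneg_left h1 (by linarith)
      _ ≤ 9 * M ^ 4 * K * ((1 + CF r G d * A) * S) * (M * (2 + 80 * M ^ 7)) :=
          mul_le_mul_of_nonneg_right h3 (by positivity)
      _ = _ := by ring

end Sys

end SVPH

namespace SVPH

/-! ### Lifting to the plane -/

theorem unitAddCircle_coe_eq_iff {x y : ℝ} :
    (x : UnitAddCircle) = (y : UnitAddCircle) ↔ ∃ a : ℤ, x = y + a := by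
  rw [← sub_eq_zero, ← AddCircle.coe_sub, AddCircle.coe_eq_zero_iff]
  constructor
  · rintro ⟨a, ha⟩
    refine ⟨a, ?_⟩
    simp at ha
    linarith
  · rintro ⟨a, ha⟩
    refine ⟨a, ?_⟩
    simp
    linarith

theorem proj_eq_iff {z w : ℝ × ℝ} : proj z = proj w ↔ ∃ a b : ℤ, z = w + ((a : ℝ), (b : ℝ)) := by
  simp only [proj, unitAddCircle_coe_eq_iff, Prod.ext_iff, Prod.fst_add,
    Prod.snd_add]
  constructor
  · rintro ⟨⟨a, ha⟩, ⟨b, hb⟩⟩; exact ⟨a, b, ha, hb⟩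
  · rintro ⟨a, b, ha, hb⟩; exact ⟨⟨a, ha⟩, ⟨b, hb⟩⟩

theorem proj_add_int (z : ℝ × ℝ) (a b : ℤ) : proj (z + ((a : ℝ), (b : ℝ))) = proj z :=
  proj_eq_iff.2 ⟨a, b, rfl⟩

theorem proj_rep (p : Torus) : proj (rep p) = p :=
  Prod.ext ((AddCircle.equivIco (1 : ℝ) 0).symm_apply_apply p.1)
    ((AddCircle.equivIco (1 : ℝ) 0).symm_apply_apply p.2)

theorem exists_int_eq_const {X : Type*} [TopologicalSpace X] [PreconnectedSpace X] [Nonempty X]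
    {f : X → ℝ} (hf : Continuous f) (h : ∀ x, ∃ n : ℤ, f x = n) : ∃ n : ℤ, ∀ x, f x = n := by
  choose n hn using h
  have hc : Continuous n := by
    rw [Int.isClosedEmbedding_coe_real.isEmbedding.continuous_iff]
    exact hf.congr hn
  obtain ⟨x₀⟩ := ‹Nonempty X›
  exact ⟨n x₀, fun x => by rw [hn, PreconnectedSpace.constant inferInstance hc]⟩

theorem exists_int_translation {X : Type*} [TopologicalSpace X] [PreconnectedSpace X] [Nonempty X]
    {f g : X → ℝ × ℝ} (hf : Continuous f) (hg : Continuous g) (h : ∀ x, proj (f x) = proj (g x)) :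
    ∃ a b : ℤ, ∀ x, f x = g x + ((a : ℝ), (b : ℝ)) := by
  have h' := fun x => proj_eq_iff.1 (h x)
  obtain ⟨a, ha⟩ := exists_int_eq_const (f := fun x => (f x).1 - (g x).1)
    (hf.fst.sub hg.fst) fun x => by
      obtain ⟨a, b, hab⟩ := h' x
      exact ⟨a, by simp [hab]⟩
  obtain ⟨b, hb⟩ := exists_int_eq_const (f := fun x => (f x).2 - (g x).2)
    (hf.snd.sub hg.snd) fun x => by
      obtain ⟨a, b, hab⟩ := h' x
      exact ⟨b, by simp [hab]⟩
  exact ⟨a, b, fun x => Prod.ext (by simp [← ha x]) (by simp [← hb x])⟩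

theorem vertical_mem_Upsilon (r : ℕ) {χ : ℝ} (hχ : 0 < χ) :
    (fun t : ℝ => ((0 : ℝ), t)) ∈ Upsilon r χ := by
  refine ⟨contDiff_const.prodMk contDiff_id, fun t => by simp, fun t => ?_⟩
  have h1 : deriv (fun t : ℝ => ((0 : ℝ), t)) t = (0, 1) :=
    ((hasDerivAt_const t (0 : ℝ)).prodMk (hasDerivAt_id t)).deriv
  rw [h1]
  exact ⟨by simp [Prod.ext_iff], by simp [coneC, hχ.le]⟩

/-- The increments of G along the periods are continuous with integer values, hence constant.
Monotonicity of f in x makes D positive. The increment along (0, 1) must be (0, 1): the preimage of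
the vertical circle is nonempty by surjectivity, and it contains a closed curve of class (0, 1) that
is mapped onto the circle with degree one. -/
theorem IsSVPH.exists_sys {r : ℕ} (hr : 5 ≤ r) {M : ℝ} {F : Torus → Torus} {G : ℝ × ℝ → ℝ × ℝ}
    {d : HypConst} (h : IsSVPH r F G d) (hb : UniformBound r M G d) :
    ∃ (D : ℕ) (e : ℤ), Sys r M G d D e := by
  have hG := h.lift.1
  have hGd : Differentiable ℝ G := hG.differentiable (by exact_mod_cast (by omega : r ≠ 0))
  have htr : ∀ w : ℝ × ℝ, (∃ a b : ℤ, w = ((a : ℝ), (b : ℝ))) →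
      ∃ a b : ℤ, ∀ z, G (z + w) = G z + ((a : ℝ), (b : ℝ)) := by
    rintro w ⟨a, b, rfl⟩
    refine exists_int_translation (hG.continuous.comp (continuous_id.add continuous_const))
      hG.continuous fun z => ?_
    rw [← h.lift.2, ← h.lift.2, proj_add_int]
  obtain ⟨a, e, hae⟩ := htr (1, 0) ⟨1, 0, by simp⟩
  obtain ⟨a', b', hab⟩ := htr (0, 1) ⟨0, 1, by simp⟩
  have ha : 0 < a := by
    have hd : ∀ x : ℝ, HasDerivAt (fun x => (G (x, 0)).1)
        (partialD 0 (fun y => (G y).1) (x, 0)) x := by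
      intro x
      have h1 : DifferentiableAt ℝ (fun y => (G y).1) (x, 0) := (hGd _).fst
      exact h1.hasFDerivAt.comp_hasDerivAt (f := fun x : ℝ => (x, (0 : ℝ))) x
        ((hasDerivAt_id x).prodMk (hasDerivAt_const x (0 : ℝ)))
    have hm : StrictMono fun x => (G (x, 0)).1 := by
      refine strictMono_of_deriv_pos fun x => ?_
      rw [(hd x).deriv]
      have := h.expansion (x, 0) 0
      have := abs_nonneg (partialD 0 (omega G) 0)
      linarith
    have h1 := hm (zero_lt_one' ℝ)
    have h2 := hae 0
    rw [zero_add] at h2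
    simp only [h2, Prod.fst_add] at h1
    have h3 : (0 : ℝ × ℝ) = (0, 0) := rfl
    rw [h3] at h1
    exact_mod_cast (lt_add_iff_pos_right _).1 h1
  obtain ⟨D, rfl⟩ := Int.eq_ofNat_of_zero_le ha.le
  have hvert : G (0 + (0, 1)) = G 0 + (0, 1) → ∀ z, G (z + (0, 1)) = G z + (0, 1) := by
    intro h0 z
    rw [hab] at h0 ⊢
    rw [add_left_cancel h0]
  refine ⟨D, e, by omega, hG, h.det_pos, h.hyp, h.pinching, h.expansion, h.expansion',
    hvert ?_, fun z => by simpa using hae z, by exact_mod_cast ha, hb⟩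
  obtain ⟨N, ν, hν, hpre⟩ := h.preimage _ (vertical_mem_Upsilon r h.hyp.χc_pos)
  obtain ⟨y, hy⟩ := h.surj (proj (0, 0))
  have hmem : y ∈ F ⁻¹' (Set.range fun t : ℝ => proj ((0 : ℝ), t)) := ⟨0, hy.symm⟩
  rw [hpre, Set.mem_iUnion] at hmem
  obtain ⟨i, -⟩ := hmem
  obtain ⟨⟨hνs, hνp, -⟩, η, hη, hmap⟩ := hν i
  obtain ⟨p, q, hpq⟩ := exists_int_translation (X := ℝ) (f := fun t => G (ν i t))
    (g := fun t => ((0 : ℝ), η t)) (hG.continuous.comp hνs.continuous)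
    (continuous_const.prodMk hη.1.continuous) fun t => by rw [← h.lift.2, hmap]
  have h1 := hpq (0 + 1)
  rw [hνp, hab, hpq, hη.2.1] at h1
  have h2 : ((a' : ℝ), (b' : ℝ)) = (0, 1) := by
    have h3 := congrArg Prod.fst h1
    have h4 := congrArg Prod.snd h1
    simp only [Prod.fst_add, Prod.snd_add] at h3 h4
    exact Prod.ext (by simp; exact_mod_cast (by linarith : (a' : ℝ) = 0)) (by simp only; linarith)
  rw [hab, h2]

theorem IsCircleDiffeo.strictMono {r : ℕ} {η : ℝ → ℝ} (h : IsCircleDiffeo r η) : StrictMono η :=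
  strictMono_of_deriv_pos h.2.2

theorem IsCircleDiffeo.surjective {r : ℕ} {η : ℝ → ℝ} (h : IsCircleDiffeo r η) :
    Function.Surjective η := by
  have hn : ∀ m : ℕ, η m = η 0 + m ∧ η (-m) = η 0 - m := by
    intro m
    induction m with
    | zero => simp
    | succ m ih =>
      constructor
      · push_cast; rw [h.2.1, ih.1]; ring
      · have := h.2.1 (-((m : ℝ) + 1))
        rw [show -((m : ℝ) + 1) + 1 = -m by ring, ih.2] at this
        push_cast; linarith
  refine h.1.continuous.surjective ?_ ?_
  · refine Filter.tendsto_atTop_atTop_of_monotone h.strictMono.monotone fun b => ?_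
    obtain ⟨m, hm⟩ := exists_nat_ge (b - η 0)
    exact ⟨m, by rw [(hn m).1]; linarith⟩
  · refine Filter.tendsto_atBot_atBot_of_monotone h.strictMono.monotone fun b => ?_
    obtain ⟨m, hm⟩ := exists_nat_ge (η 0 - b)
    exact ⟨-m, by rw [(hn m).2]; linarith⟩

theorem iterate_proj {r : ℕ} {F : Torus → Torus} {G : ℝ × ℝ → ℝ × ℝ} (h : IsLift r F G) (n : ℕ)
    (z : ℝ × ℝ) : F^[n] (proj z) = proj (G^[n] z) :=
  (Function.Semiconj.iterate_right (f := proj) (ga := G) (gb := F)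
    (fun z => (h.2 z).symm) n z).symm

namespace Sys

variable {r : ℕ} {M : ℝ} {G : ℝ × ℝ → ℝ × ℝ} {d : HypConst} {D : ℕ} {e : ℤ}

theorem centralGraph_const (h : Sys r M G d D e) (X : ℝ) : CentralGraph r d.χc fun _ => X :=
  ⟨contDiff_const, fun _ => rfl, fun t => by simpa using h.hyp.χc_pos.le⟩

/-- The points whose image has first coordinate X form the pullback of the vertical line over X, and
G maps this graph to that line by the bijection η. -/
theorem bijective (h : Sys r M G d D e) : Function.Bijective G := by
  constructor
  · rintro ⟨x, s⟩ ⟨x', s'⟩ hz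
    obtain ⟨η, q, hq, hη, hm⟩ := h.exists_pullback (h.centralGraph_const (G (x, s)).1)
    have key : ∀ x' s', (G (x', s')).1 = (G (x, s)).1 → x' = q s' := fun x' s' hx =>
      (h.bijective_line (h.centralGraph_const (G (x, s)).1) s').1 (by
        simp only [hm s']; rw [hx])
    have h1 := key x s rfl
    have h2 := key x' s' (by rw [hz])
    have h3 : η s = η s' := by
      have := congrArg Prod.snd hz
      rwa [h1, h2, hm, hm] at this
    have h4 := hη.strictMono.injective h3
    rw [h1, h2, h4]
  · rintro ⟨X, Y⟩
    obtain ⟨η, q, hq, hη, hm⟩ := h.exists_pullback (h.centralGraph_const X)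
    obtain ⟨s, hs⟩ := hη.surjective Y
    exact ⟨(q s, s), by rw [hm, hs]⟩

theorem exists_inverse (h : Sys r M G d D e) : ∃ H : ℝ × ℝ → ℝ × ℝ, ContDiff ℝ r H ∧
    (∀ z, H (G z) = z) ∧ ∀ z, G (H z) = z :=
  exists_smooth_inverse h.r_ne h.smooth h.bijective fun z => (h.det_pos z).ne'

/-- Every point of the plane can be moved by an integer vector so that its image is moved to a
prescribed strip. -/
theorem exists_shift (h : Sys r M G d D e) (n : ℕ) {w z : ℝ × ℝ} {a b : ℤ}
    (hw : G^[n] w = z + ((a : ℝ), (b : ℝ))) :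
    ∃ j < D ^ n, ∃ p q : ℤ, G^[n] (w + ((p : ℝ), (q : ℝ))) = z + ((j : ℝ), 0) := by
  obtain ⟨E, hE⟩ := h.exists_iter_add_int n
  have hD : (0 : ℤ) < (D : ℤ) ^ n := pow_pos (by exact_mod_cast h.D_pos) n
  have h1 := Int.emod_nonneg a hD.ne'
  have h2 := Int.emod_lt_of_pos a hD
  -- A horizontal translation by p moves the image horizontally by D^n p, so a can be reduced to its
  -- residue modulo D^n; the vertical translation then corrects the height.
  refine ⟨(a % (D : ℤ) ^ n).toNat, by zify; rw [Int.toNat_of_nonneg h1]; exact h2,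
    -(a / (D : ℤ) ^ n), E * (a / (D : ℤ) ^ n) - b, ?_⟩
  have h3 : (((a % (D : ℤ) ^ n).toNat : ℕ) : ℝ) = a - (D : ℝ) ^ n * (a / (D : ℤ) ^ n : ℤ) := by
    have h4 := Int.emod_add_mul_ediv a ((D : ℤ) ^ n)
    have h5 := Int.toNat_of_nonneg h1
    have h6 : (((a % (D : ℤ) ^ n).toNat : ℤ) : ℝ) = ((a % (D : ℤ) ^ n : ℤ) : ℝ) := by rw [h5]
    rw [Int.cast_natCast] at h6
    rw [h6]
    have h7 : ((a % (D : ℤ) ^ n + (D : ℤ) ^ n * (a / (D : ℤ) ^ n) : ℤ) : ℝ) = a := by rw [h4]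
    push_cast at h7
    linarith
  rw [hE, hw, h3]
  ext
  · push_cast; simp; ring
  · push_cast; simp; ring

/-- The preimage of a central curve is the union of the curves at the end of the chains starting
from its integer translates. -/
theorem preimage_range (h : Sys r M G d D e) {F : Torus → Torus} (hF : IsLift r F G) {g₀ : ℝ → ℝ}
    {g η : ℕ → ℕ → ℝ → ℝ} (c : ∀ j, Chain r G d (g j) (η j)) (h0 : ∀ j t, g j 0 t = g₀ t + j)
    (n : ℕ) : F^[n] ⁻¹' (Set.range fun t => proj (g₀ t, t)) =
      ⋃ i : Fin (D ^ n), Set.range fun s => proj (g i n s, s) := by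
  ext y
  simp only [Set.mem_preimage, Set.mem_range, Set.mem_iUnion]
  constructor
  · rintro ⟨t, ht⟩
    rw [← proj_rep y, iterate_proj hF] at ht
    obtain ⟨a, b, hab⟩ := proj_eq_iff.1 ht.symm
    obtain ⟨j, hj, p, q, hpq⟩ := h.exists_shift n hab
    refine ⟨⟨j, hj⟩, ?_⟩
    obtain ⟨s, hs⟩ := ((c j).isCircleDiffeo_climb h n 0).surjective t
    refine ⟨s, ?_⟩
    have h1 := (c j).iter_map n (zero_add n).symm s
    have h2 : rep y + ((p : ℝ), (q : ℝ)) = (g j n s, s) := by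
      apply h.bijective.1.iterate n
      rw [hpq, h1, hs, h0]
      simp
    rw [← h2, proj_add_int, proj_rep]
  · rintro ⟨j, s, rfl⟩
    refine ⟨climb (η j) 0 n s, ?_⟩
    rw [iterate_proj hF, (c j).iter_map n (zero_add n).symm s, h0]
    refine (proj_eq_iff.2 ⟨j, 0, ?_⟩).symm
    simp

/-! ### The transfer operator on the plane -/

/-- The fibre over a point consists of the projections of H(z + j e₁) for 0 ≤ j < D: any preimage
can be shifted to this form, and different residues modulo D give different points of the torus. -/
theorem transfer_proj (h : Sys r M G d D e) {F : Torus → Torus} (hF : IsLift r F G)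
    {H : ℝ × ℝ → ℝ × ℝ} (hl : ∀ z, H (G z) = z) (hr : ∀ z, G (H z) = z) (w : Torus → ℝ)
    (z : ℝ × ℝ) : transfer F G w (proj z) = ∑ j ∈ Finset.range D,
      w (proj (H (z + ((j : ℝ), 0)))) / (dIter G 1 (H (z + ((j : ℝ), 0)))).det := by
  have hinj : Set.InjOn (fun j : ℕ => proj (H (z + ((j : ℝ), 0)))) (Finset.range D) := by
    intro i hi j hj hij
    obtain ⟨a, b, hab⟩ := proj_eq_iff.1 hij
    obtain ⟨E, hE⟩ := h.exists_iter_add_int 1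
    have h1 := hE a b (H (z + ((j : ℝ), 0)))
    simp only [Function.iterate_one] at h1
    rw [← hab, hr, hr] at h1
    have h2 := congrArg Prod.fst h1
    simp only [Prod.fst_add, pow_one] at h2
    have h3 : (i : ℤ) = j + D * a := by
      have : (i : ℝ) = j + D * a := by linarith
      exact_mod_cast this
    have hi' := Finset.mem_range.1 (Finset.mem_coe.1 hi)
    have hj' := Finset.mem_range.1 (Finset.mem_coe.1 hj)
    have h4 : (i : ℤ) % D = j % D := by rw [h3, Int.add_mul_emod_self_left]
    rw [Int.emod_eq_of_lt (by omega) (by omega), Int.emod_eq_of_lt (by omega) (by omega)] at h4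
    exact_mod_cast h4
  have hset : F ⁻¹' {proj z} =
      ((Finset.range D).image fun j : ℕ => proj (H (z + ((j : ℝ), 0))) : Finset Torus) := by
    ext y
    simp only [Set.mem_preimage, Set.mem_singleton_iff, Finset.coe_image, Set.mem_image,
      Finset.mem_coe, Finset.mem_range]
    constructor
    · intro hy
      rw [← proj_rep y, hF.2] at hy
      obtain ⟨a, b, hab⟩ := proj_eq_iff.1 hy
      obtain ⟨j, hj, p, q, hpq⟩ := h.exists_shift 1 hab
      refine ⟨j, by simpa using hj, ?_⟩
      simp only [Function.iterate_one] at hpq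
      rw [← hpq, hl, proj_add_int, proj_rep]
    · rintro ⟨j, -, rfl⟩
      rw [hF.2, hr]
      simpa using proj_add_int z j 0
  rw [transfer, hset, finsum_mem_coe_finset, Finset.sum_image hinj]
  refine Finset.sum_congr rfl fun j _ => ?_
  congr 1
  -- The representative used in `transfer` and the point H(z + j e₁) differ by an integer vector,
  -- which does not affect the determinant.
  obtain ⟨a, b, hab⟩ := proj_eq_iff.1 (proj_rep (proj (H (z + ((j : ℝ), 0)))))
  rw [hab, h.dIter_add_int, abs_of_pos (h.det_pos _)]

theorem sum_range_mul {α : Type*} [AddCommMonoid α] (f : ℕ → α) (N m : ℕ) :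
    ∑ i ∈ Finset.range m, ∑ j ∈ Finset.range N, f (j + N * i) = ∑ k ∈ Finset.range (N * m), f k := by
  induction m with
  | zero => simp
  | succ m ih =>
    rw [Finset.sum_range_succ, ih, Nat.mul_succ, Finset.sum_range_add]
    simp only [add_comm]

theorem iterate_inverse_add_int (h : Sys r M G d D e) {H : ℝ × ℝ → ℝ × ℝ}
    (hr : ∀ z, G (H z) = z) (n : ℕ) (z : ℝ × ℝ) (j i : ℕ) :
    ∃ b : ℤ, H^[n] (z + (((j + D ^ n * i : ℕ) : ℝ), 0)) =
      H^[n] (z + ((j : ℝ), 0)) + ((i : ℝ), (b : ℝ)) := by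
  obtain ⟨E, hE⟩ := h.exists_iter_add_int n
  refine ⟨-(E * i), ?_⟩
  apply h.bijective.1.iterate n
  have hr' := Function.RightInverse.iterate (f := G) (g := H) hr n
  have := hE i (-(E * i)) (H^[n] (z + ((j : ℝ), 0)))
  rw [hr' (z + ((j : ℝ), 0))] at this
  rw [hr']
  push_cast at this ⊢
  rw [this]
  ext <;> simp; ring

/-- An index below D^{n+1} is written as j + D^n i: the residue j selects the branch of G^{-n}, and
i the branch of the last inverse step. -/
theorem transfer_iterate_proj (h : Sys r M G d D e) {F : Torus → Torus} (hF : IsLift r F G)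
    {H : ℝ × ℝ → ℝ × ℝ} (hl : ∀ z, H (G z) = z) (hr : ∀ z, G (H z) = z) (n : ℕ) (u : Torus → ℝ)
    (z : ℝ × ℝ) : (transfer F G)^[n] u (proj z) = ∑ j ∈ Finset.range (D ^ n),
      u (proj (H^[n] (z + ((j : ℝ), 0)))) / (dIter G n (H^[n] (z + ((j : ℝ), 0)))).det := by
  induction n generalizing u z with
  | zero => simp [dIter_zero, ← Prod.zero_eq_mk, clm_det_eq, cross]
  | succ n ih =>
    have hr' := Function.RightInverse.iterate (f := G) (g := H) hr
    rw [Function.iterate_succ_apply, ih, pow_succ, ← sum_range_mul, Finset.sum_comm]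
    refine Finset.sum_congr rfl fun j _ => ?_
    rw [h.transfer_proj hF hl hr, Finset.sum_div]
    refine Finset.sum_congr rfl fun i _ => ?_
    obtain ⟨b, hb⟩ := h.iterate_inverse_add_int hr n z j i
    set y := H^[n] (z + ((j : ℝ), 0)) with hy
    rw [Function.iterate_succ_apply', hb]
    have e1 : y + ((i : ℝ), (b : ℝ)) = (y + ((i : ℝ), 0)) + (0, (b : ℝ)) := by ext <;> simp
    have e2 : H (y + ((i : ℝ), (b : ℝ))) = H (y + ((i : ℝ), 0)) + (0, (b : ℝ)) := by
      apply h.bijective.1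
      rw [hr, h.add_int_snd, hr, e1]
    rw [e2]
    have e3 := proj_add_int (H (y + ((i : ℝ), 0))) 0 b
    have e4 := h.dIter_add_int (n + 1) 0 b (H (y + ((i : ℝ), 0)))
    rw [Int.cast_zero] at e3 e4
    rw [e3, e4, h.dIter_add n 1, det_comp, div_div, Function.iterate_one, hr]
    rw [show dIter G n (y + ((i : ℝ), 0)) = dIter G n y by simpa using h.dIter_add_int n i 0 y,
      mul_comm]

theorem contDiff_branch (h : Sys r M G d D e) {H : ℝ × ℝ → ℝ × ℝ} (hH : ContDiff ℝ r H) (n : ℕ)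
    {u : Torus → ℝ} (hu : IsCk (r - 1) u) :
    ContDiff ℝ (r - 1 : ℕ) fun z => u (proj (H^[n] z)) / (dIter G n (H^[n] z)).det := by
  have hHr : ContDiff ℝ r (H^[n]) := by
    induction n with
    | zero => exact contDiff_id
    | succ n ih => rw [Function.iterate_succ']; exact hH.comp ih
  have hHn : ContDiff ℝ (r - 1 : ℕ) (H^[n]) :=
    hHr.of_le (by exact_mod_cast (by omega : r - 1 ≤ r))
  refine ContDiff.div (ContDiff.comp (g := fun z => u (proj z)) hu hHn) ?_
    fun z => (h.det_iter_pos n _).ne'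
  have hGn : ContDiff ℝ ((r - 1 : ℕ) + 1 : ℕ) (G^[n]) := by
    rw [Nat.sub_add_cancel (by have := h.two_le; omega)]
    exact h.smooth_iter n
  refine ContDiff.comp (g := fun z => (dIter G n z).det) ?_ hHn
  simp only [h.det_eq]
  exact ((contDiff_partialD hGn.fst 0).mul (contDiff_partialD hGn.snd 1)).sub
    ((contDiff_partialD hGn.snd 0).mul (contDiff_partialD hGn.fst 1))

theorem isCk_transfer_iterate (h : Sys r M G d D e) {F : Torus → Torus} (hF : IsLift r F G)
    (n : ℕ) {u : Torus → ℝ} (hu : IsCk (r - 1) u) : IsCk (r - 1) ((transfer F G)^[n] u) := by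
  obtain ⟨H, hH, hl, hr⟩ := h.exists_inverse
  simp only [IsCk, h.transfer_iterate_proj hF hl hr n u]
  exact ContDiff.sum fun j _ =>
    (h.contDiff_branch hH n hu).comp (contDiff_id.add contDiff_const)

end Sys

end SVPH

namespace SVPH

/-! ### Admissible curves as graphs -/

theorem iteratedDeriv_graph {r : ℕ} {g : ℝ → ℝ} (hg : ContDiff ℝ r g) (i : ℕ) (hi : i + 1 ≤ r) :
    iteratedDeriv (i + 1) (fun t => (g t, t)) =
      fun t => (iteratedDeriv (i + 1) g t, if i = 0 then 1 else 0) := by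
  induction i with
  | zero =>
    have hd : Differentiable ℝ g := hg.differentiable (by exact_mod_cast (by omega : r ≠ 0))
    ext1 t
    simpa [iteratedDeriv_one] using ((hd t).hasDerivAt.prodMk (hasDerivAt_id t)).deriv
  | succ i ih =>
    rw [iteratedDeriv_succ, ih (by omega)]
    ext1 t
    have hd : Differentiable ℝ (iteratedDeriv (i + 1) g) :=
      hg.differentiable_iteratedDeriv (i + 1) (by exact_mod_cast (by omega : i + 1 < r))
    rw [((hd t).hasDerivAt.prodMk (hasDerivAt_const t (if i = 0 then (1 : ℝ) else 0))).deriv,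
      ← iteratedDeriv_succ]
    simp

theorem eNorm_fst (a : ℝ) : eNorm (a, 0) = |a| := by simp [eNorm, Real.sqrt_sq_eq_abs]

theorem eNorm_iteratedDeriv_graph {r : ℕ} {g : ℝ → ℝ} (hg : ContDiff ℝ r g) {l : ℕ} (h2 : 2 ≤ l)
    (hl : l ≤ r) (t : ℝ) : eNorm (iteratedDeriv l (fun t => (g t, t)) t) = |iteratedDeriv l g t| := by
  obtain ⟨i, rfl⟩ : ∃ i, l = i + 1 := ⟨l - 1, by omega⟩
  rw [iteratedDeriv_graph hg i hl, if_neg (by omega), eNorm_fst]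

theorem eq_graph_of_mem_Gam {r j : ℕ} {χ c : ℝ} {γ : ℝ → ℝ × ℝ} (h : γ ∈ Gam r χ j c) :
    γ = fun t => ((γ t).1, t) := by
  ext t
  · rfl
  · exact h.2.1 t

theorem graph_mem_Gam_iff {r j : ℕ} (hr : r ≠ 0) (hj : j ≤ r) {χ c : ℝ} {g : ℝ → ℝ} :
    (fun t => (g t, t)) ∈ Gam r χ j c ↔ CentralGraph r χ g ∧
      ∀ l, 2 ≤ l → l ≤ j → ∀ t, |iteratedDeriv l g t| ≤ c ^ (l - 1)! := by
  have hderiv : ContDiff ℝ r g → ∀ t, deriv (fun t => (g t, t)) t = (deriv g t, 1) := by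
    intro hg t
    have hd : Differentiable ℝ g := hg.differentiable (by exact_mod_cast hr)
    exact ((hd t).hasDerivAt.prodMk (hasDerivAt_id t)).deriv
  constructor
  · rintro ⟨⟨h1, h2, h3⟩, -, h4⟩
    have hg : ContDiff ℝ r g := h1.fst
    refine ⟨⟨hg, fun t => by simpa using congrArg Prod.fst (h2 t), fun t => ?_⟩, fun l hl hl' t => ?_⟩
    · have := (h3 t).2
      rw [hderiv hg] at this
      simpa [coneC] using this
    · rw [← eNorm_iteratedDeriv_graph hg hl (hl'.trans hj)]
      exact h4 l hl hl' t
  · rintro ⟨hg, h4⟩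
    refine ⟨⟨hg.smooth.prodMk contDiff_id, fun t => by simp [hg.periodic t], fun t => ?_⟩,
      fun t => rfl, fun l hl hl' t => ?_⟩
    · rw [hderiv hg.smooth]
      exact ⟨by simp [Prod.ext_iff], by simpa [coneC] using hg.slope t⟩
    · rw [eNorm_iteratedDeriv_graph hg.smooth hl (hl'.trans hj)]
      exact h4 l hl hl' t

theorem CentralGraph.add_const {r : ℕ} {χ : ℝ} {g : ℝ → ℝ} (h : CentralGraph r χ g) (a : ℝ) :
    CentralGraph r χ fun t => g t + a :=
  ⟨h.smooth.add contDiff_const, fun t => by simp [h.periodic t], fun t => by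
    simpa using h.slope t⟩

theorem iteratedDeriv_add_const {g : ℝ → ℝ} {l : ℕ} (hl : 1 ≤ l) (a : ℝ) :
    iteratedDeriv l (fun t => g t + a) = iteratedDeriv l g := by
  obtain ⟨i, rfl⟩ : ∃ i, l = i + 1 := ⟨l - 1, by omega⟩
  rw [iteratedDeriv_succ', iteratedDeriv_succ']
  congr 1
  ext t
  simp

/-- Uniform bounds on the derivatives of the preimages of central curves. -/
theorem exists_backward_bounds (r : ℕ) (M : ℝ) : ∃ (nbar : ℕ) (K : ℝ), 1 ≤ K ∧
    ∀ {G : ℝ × ℝ → ℝ × ℝ} {d : HypConst} {D : ℕ} {e : ℤ} {g η : ℕ → ℝ → ℝ},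
      Sys r M G d D e → Chain r G d g η → ∀ {c : ℝ}, 2 * K ≤ c → ∀ L, 1 ≤ L → L ≤ r →
      (∀ i, 2 ≤ i → i ≤ L → ∀ s, |iteratedDeriv i (g 0) s| ≤ c ^ (i - 1)!) →
      ∀ i, 2 ≤ i → i ≤ L → (∀ n s, |iteratedDeriv i (g n) s| ≤ 2 * K * c ^ (i - 1)!) ∧
        ∀ n, nbar < n → ∀ s, |iteratedDeriv i (g n) s| ≤ c ^ (i - 1)! := by
  obtain ⟨θ, hθ0, hθ1, hθ⟩ := exists_pinching_rate r M
  have hex : ∀ L, ∃ K : ℝ, 1 ≤ K ∧ (1 ≤ L → L ≤ r →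
      ∀ {G : ℝ × ℝ → ℝ × ℝ} {d : HypConst} {D : ℕ} {e : ℤ} {g η : ℕ → ℝ → ℝ},
      Sys r M G d D e → Chain r G d g η → ∀ {c : ℝ}, 1 ≤ c →
      (∀ i, 2 ≤ i → i ≤ L → ∀ s, |iteratedDeriv i (g 0) s| ≤ c ^ (i - 1)!) →
      ∀ i, 2 ≤ i → i ≤ L → ∀ n s, |iteratedDeriv i (g n) s| ≤
        K * (θ ^ n * c ^ (i - 1)! + c ^ ((i - 1).factorial - 1))) := by
    intro L
    by_cases hL : 1 ≤ L ∧ L ≤ r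
    · obtain ⟨K, hK, hb⟩ := Chain.exists_bounds r M θ hθ0 hθ1 L hL.1 hL.2
      exact ⟨K, hK, fun _ _ {G d D e g η} hs ch {c} hc h0 => hb hs ch (hθ hs) hc h0⟩
    · exact ⟨1, le_rfl, fun h1 h2 => absurd ⟨h1, h2⟩ hL⟩
  choose K hK hb using hex
  -- The sum is a single constant valid for all orders L ≤ r.
  set K' := ∑ L ∈ Finset.range (r + 1), K L with hK'
  have hle : ∀ L ≤ r, K L ≤ K' := fun L hL => Finset.single_le_sum
    (fun i _ => zero_le_one.trans (hK i)) (Finset.mem_range.2 (by omega))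
  have hK1 : 1 ≤ K' := (hK 0).trans (hle 0 (by omega))
  -- With this choice the decaying term is at most half of c^{(i-1)!} for n > nbar, and c ≥ 2K'
  -- makes the other one, smaller by a factor c, at most the other half.
  obtain ⟨nbar, hn⟩ := exists_pow_lt_of_lt_one (show (0 : ℝ) < 1 / (2 * K') by positivity) hθ1
  refine ⟨nbar, K', hK1, fun {G d D e g η} hs ch {c} hc L hL1 hL2 h0 i hi hi' => ?_⟩
  have hc1 : 1 ≤ c := by linarith
  have key : ∀ n s, |iteratedDeriv i (g n) s| ≤
      K' * (θ ^ n * c ^ (i - 1)! + c ^ ((i - 1).factorial - 1)) := fun n s =>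
    (hb L hL1 hL2 hs ch hc1 h0 i hi hi' n s).trans
      (mul_le_mul_of_nonneg_right (hle L hL2) (by positivity))
  have hfac : c ^ (i - 1)! = c ^ ((i - 1).factorial - 1) * c := by
    rw [← pow_succ, Nat.sub_add_cancel (Nat.factorial_pos _)]
  have hp : (0 : ℝ) < c ^ ((i - 1).factorial - 1) := by positivity
  constructor
  · intro n s
    refine (key n s).trans ?_
    rw [mul_assoc 2, mul_left_comm 2]
    have h1 : θ ^ n * c ^ (i - 1)! ≤ 1 * c ^ (i - 1)! :=
      mul_le_mul_of_nonneg_right (pow_le_one₀ hθ0.le hθ1.le) (by positivity)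
    have h2 : c ^ ((i - 1).factorial - 1) ≤ c ^ (i - 1)! := by
      rw [hfac]; exact le_mul_of_one_le_right hp.le hc1
    refine mul_le_mul_of_nonneg_left ?_ (by linarith)
    linarith
  · intro n hn' s
    refine (key n s).trans ?_
    have h1 : K' * θ ^ n ≤ 1 / 2 := by
      have h2 : θ ^ n ≤ 1 / (2 * K') :=
        (pow_le_pow_of_le_one hθ0.le hθ1.le hn'.le).trans hn.le
      calc K' * θ ^ n ≤ K' * (1 / (2 * K')) := mul_le_mul_of_nonneg_left h2 (by linarith)
        _ = 1 / 2 := by field_simp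
    have h3 : K' * c ^ ((i - 1).factorial - 1) ≤ 1 / 2 * c ^ (i - 1)! := by
      rw [hfac]; nlinarith
    have h4 : K' * θ ^ n * c ^ (i - 1)! ≤ 1 / 2 * c ^ (i - 1)! :=
      mul_le_mul_of_nonneg_right h1 (by positivity)
    rw [mul_add, ← mul_assoc]
    linarith

namespace Sys

variable {r : ℕ} {M : ℝ} {G : ℝ × ℝ → ℝ × ℝ} {d : HypConst} {D : ℕ} {e : ℤ}

/-- Chains starting from all the integer translates of a central curve. -/
theorem exists_chains (h : Sys r M G d D e) {g₀ : ℝ → ℝ} (hg : CentralGraph r d.χc g₀) :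
    ∃ g η : ℕ → ℕ → ℝ → ℝ, (∀ j, Chain r G d (g j) (η j)) ∧ ∀ j t, g j 0 t = g₀ t + j := by
  choose g η hc h0 using fun j : ℕ => h.exists_chain (hg.add_const j)
  exact ⟨g, η, hc, fun j t => by rw [h0]⟩

theorem preimageSplits_iterate (h : Sys r M G d D e) {F : Torus → Torus} (hF : IsLift r F G)
    {l : ℕ} (hl : l ≤ r) {c : ℝ} {n : ℕ}
    (hbd : ∀ {g η : ℕ → ℝ → ℝ}, Chain r G d g η →
      (∀ i, 2 ≤ i → i ≤ l → ∀ s, |iteratedDeriv i (g 0) s| ≤ c ^ (i - 1)!) →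
      ∀ i, 2 ≤ i → i ≤ l → ∀ s, |iteratedDeriv i (g n) s| ≤ c ^ (i - 1)!)
    {γ : ℝ → ℝ × ℝ} (hγ : γ ∈ Gam r d.χc l c) :
    PreimageSplits r (F^[n]) γ (Gam r d.χc l c) := by
  obtain ⟨g₀, rfl⟩ : ∃ g₀ : ℝ → ℝ, γ = fun t => (g₀ t, t) := ⟨_, eq_graph_of_mem_Gam hγ⟩
  obtain ⟨hg, hb⟩ := (graph_mem_Gam_iff h.r_ne hl).1 hγ
  obtain ⟨g, η, ch, h0⟩ := h.exists_chains hg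
  refine ⟨D ^ n, fun i s => (g i n s, s), fun i => ⟨?_, climb (η i) 0 n,
    (ch i).isCircleDiffeo_climb h n 0, fun s => ?_⟩, h.preimage_range hF ch h0 n⟩
  · refine (graph_mem_Gam_iff h.r_ne hl).2 ⟨(ch i).graph n, hbd (ch i) fun k hk hk' s => ?_⟩
    rw [show g i 0 = fun t => g₀ t + (i : ℕ) from funext (h0 i),
      iteratedDeriv_add_const (by omega)]
    exact hb k hk hk' s
  · rw [iterate_proj hF, (ch i).iter_map n (zero_add n).symm s, h0]
    refine proj_eq_iff.2 ⟨(i : ℕ), 0, ?_⟩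
    simp

end Sys

end SVPH

namespace SVPH

/-! ### Partial derivatives of periodic functions -/

theorem Pl.contDiff {N : ℕ} : ∀ {K : ℝ} {f : ℝ × ℝ → ℝ}, Pl N K f → ContDiff ℝ N f := by
  induction N with
  | zero => exact fun h => contDiff_zero.2 h.1
  | succ N ih =>
    intro K f h
    rw [Nat.cast_succ, contDiff_succ_iff_fderiv]
    refine ⟨h.1, by simp, ?_⟩
    have : fderiv ℝ f = fun z => partialD 0 f z • ContinuousLinearMap.fst ℝ ℝ ℝ +
        partialD 1 f z • ContinuousLinearMap.snd ℝ ℝ ℝ := by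
      ext1 z
      ext <;> simp [fderiv_apply_eq]
    rw [this]
    exact ((ih (h.2.2 0)).smul contDiff_const).add ((ih (h.2.2 1)).smul contDiff_const)

theorem contDiff_partials {m : ℕ} : ∀ (α : List (Fin 2)) {f : ℝ × ℝ → ℝ},
    ContDiff ℝ (α.length + m : ℕ) f → ContDiff ℝ m (partials α f) := by
  intro α
  induction α generalizing m with
  | nil =>
    intro f hf
    rw [List.length_nil, zero_add] at hf
    exact hf
  | cons i α ih =>
    intro f hf
    refine contDiff_partialD (ih ?_) i
    refine hf.of_le ?_
    simp only [List.length_cons]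
    exact_mod_cast (by omega : α.length + (m + 1) ≤ α.length + 1 + m)

theorem Pl.partials {m : ℕ} {K : ℝ} : ∀ (α : List (Fin 2)) {f : ℝ × ℝ → ℝ},
    Pl (α.length + m) K f → Pl m K (partials α f) := by
  intro α
  induction α generalizing m with
  | nil =>
    intro f hf
    rw [List.length_nil, zero_add] at hf
    exact hf
  | cons i α ih =>
    intro f hf
    have h1 : Pl (m + 1) K (SVPH.partials α f) := by
      apply ih
      convert hf using 1
      simp only [List.length_cons]; omega
    exact h1.2.2 i

theorem partialD_comp_add (f : ℝ × ℝ → ℝ) (w : ℝ × ℝ) (i : Fin 2) :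
    partialD i (fun z => f (z + w)) = fun z => partialD i f (z + w) := by
  ext z
  simp only [partialD]
  rw [fderiv_comp_add_right]

theorem partials_comp_add (f : ℝ × ℝ → ℝ) (w : ℝ × ℝ) (α : List (Fin 2)) :
    partials α (fun z => f (z + w)) = fun z => partials α f (z + w) := by
  induction α with
  | nil => rfl
  | cons i α ih =>
    simp only [partials]
    rw [ih, partialD_comp_add]

theorem partials_periodic {f : ℝ × ℝ → ℝ} {w : ℝ × ℝ} (hf : ∀ z, f (z + w) = f z)
    (α : List (Fin 2)) (z : ℝ × ℝ) : partials α f (z + w) = partials α f z := by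
  have := partials_comp_add f w α
  simp only [hf] at this
  exact (congrFun this z).symm

theorem exists_Pl_of_periodic {N : ℕ} : ∀ {f : ℝ × ℝ → ℝ}, ContDiff ℝ N f →
    (∀ (a b : ℤ) z, f (z + ((a : ℝ), (b : ℝ))) = f z) → ∃ K, Pl N K f := by
  have hbd : ∀ {f : ℝ × ℝ → ℝ}, Continuous f →
      (∀ (a b : ℤ) z, f (z + ((a : ℝ), (b : ℝ))) = f z) → ∃ K, ∀ z, |f z| ≤ K := by
    intro f hf hp
    refine ⟨supSquare f, fun z => ?_⟩
    have h1 := hp ⌊z.1⌋ ⌊z.2⌋ (Int.fract z.1, Int.fract z.2)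
    have e1 : (Int.fract z.1, Int.fract z.2) + ((⌊z.1⌋ : ℝ), (⌊z.2⌋ : ℝ)) = z :=
      Prod.ext (Int.fract_add_floor _) (Int.fract_add_floor _)
    rw [← e1, h1]
    exact abs_le_supSquare hf ⟨⟨Int.fract_nonneg _, (Int.fract_lt_one _).le⟩,
      ⟨Int.fract_nonneg _, (Int.fract_lt_one _).le⟩⟩
  induction N with
  | zero =>
    intro f hf hp
    obtain ⟨K, hK⟩ := hbd hf.continuous hp
    exact ⟨K, hf.continuous, hK⟩
  | succ N ih =>
    intro f hf hp
    obtain ⟨K, hK⟩ := hbd hf.continuous hp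
    have h1 : ∀ i, ∃ K, Pl N K (partialD i f) := fun i => by
      refine ih (contDiff_partialD hf i) fun a b z => ?_
      have := partials_periodic (w := ((a : ℝ), (b : ℝ))) (hp a b) [i] z
      exact this
    choose L hL using h1
    refine ⟨max K (max (L 0) (L 1)), hf.differentiable (by simp), fun z => (hK z).trans
      (le_max_left _ _), fun i => (hL i).mono ?_⟩
    fin_cases i <;> simp

/-! ### The norms of functions on the circle -/

theorem bddAbove_abs_of_periodic {ψ : ℝ → ℝ} (hc : Continuous ψ) (hp : Function.Periodic ψ 1) :
    BddAbove (Set.range fun t => |ψ t|) := by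
  have hp' : Function.Periodic (fun t => |ψ t|) 1 := fun t => by simp only [hp t]
  have := hp'.compact_of_continuous one_ne_zero hc.abs
  exact this.bddAbove

theorem periodic_deriv {ψ : ℝ → ℝ} (hp : Function.Periodic ψ 1) :
    Function.Periodic (deriv ψ) 1 := by
  intro t
  have h1 := deriv_comp_add_const (f := ψ) (a := 1) (x := t)
  rw [← h1]
  congr 1
  exact funext hp

theorem sSup_abs_nonneg (ψ : ℝ → ℝ) : 0 ≤ sSup (Set.range fun t => |ψ t|) :=
  Real.sSup_nonneg (by rintro _ ⟨t, rfl⟩; exact abs_nonneg _)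

theorem circleNorm_nonneg (k : ℕ) : ∀ ψ, 0 ≤ circleNorm k ψ := by
  induction k with
  | zero => exact sSup_abs_nonneg
  | succ k ih => exact fun ψ => add_nonneg (mul_nonneg (by positivity) (sSup_abs_nonneg ψ)) (ih _)

theorem Sc_circleNorm (k : ℕ) : ∀ {ψ : ℝ → ℝ}, ContDiff ℝ k ψ → Function.Periodic ψ 1 →
    Sc k (circleNorm k ψ) 1 ψ := by
  induction k with
  | zero => exact fun {ψ} hc hp => ⟨hc.continuous, fun t =>
      le_csSup (bddAbove_abs_of_periodic hc.continuous hp) ⟨t, rfl⟩⟩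
  | succ k ih =>
    intro ψ hc hp
    have hc' := hc
    rw [Nat.cast_succ, contDiff_succ_iff_deriv] at hc'
    have h0 := sSup_abs_nonneg ψ
    have h1 : (1 : ℝ) ≤ 2 ^ (k + 1) := one_le_pow₀ (by norm_num)
    refine ⟨hc'.1, fun t => ?_, (ih hc'.2.2 (periodic_deriv hp)).mono ?_ zero_le_one⟩
    · have h2 := le_csSup (bddAbove_abs_of_periodic hc.continuous hp) ⟨t, rfl⟩
      have h3 := circleNorm_nonneg k (deriv ψ)
      simp only [circleNorm]
      simp only at h2
      nlinarith
    · rw [mul_one]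
      simp only [circleNorm]
      nlinarith

/-- Converse of `Sc_circleNorm`, which costs no constant. The scale enters with the k-th power: for
the leading terms this becomes (c^{k!} S²)^k. -/
theorem circleNorm_le {k : ℕ} : ∀ {K R : ℝ} {ψ : ℝ → ℝ}, Sc k K R ψ → 1 ≤ R →
    circleNorm k ψ ≤ 2 ^ (k + 1) * K * R ^ k := by
  induction k with
  | zero =>
    intro K R ψ h _
    have h1 : sSup (Set.range fun t => |ψ t|) ≤ K :=
      Real.sSup_le (by rintro _ ⟨t, rfl⟩; exact h.2 t) h.nonneg
    have h2 := h.nonneg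
    simp only [circleNorm, zero_add, pow_one, pow_zero, mul_one]
    linarith
  | succ k ih =>
    intro K R ψ h hR
    have h1 : sSup (Set.range fun t => |ψ t|) ≤ K :=
      Real.sSup_le (by rintro _ ⟨t, rfl⟩; exact h.2.1 t) h.nonneg
    have h2 := ih h.2.2 hR
    have h3 : 1 ≤ R ^ (k + 1) := one_le_pow₀ hR
    have h4 := h.nonneg
    have h5 : K ≤ K * R ^ (k + 1) := le_mul_of_one_le_right h4 h3
    simp only [circleNorm]
    calc _ ≤ 2 ^ (k + 1) * (K * R ^ (k + 1)) + 2 ^ (k + 1) * (K * R) * R ^ k := by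
          have := h1.trans h5
          gcongr
      _ = _ := by ring

theorem circleNorm_const_mul (k : ℕ) (a : ℝ) : ∀ ψ : ℝ → ℝ,
    circleNorm k (fun t => a * ψ t) = |a| * circleNorm k ψ := by
  have h0 : ∀ ψ : ℝ → ℝ, sSup (Set.range fun t => |a * ψ t|) =
      |a| * sSup (Set.range fun t => |ψ t|) := by
    intro ψ
    simp only [abs_mul]
    exact (Real.mul_iSup_of_nonneg (abs_nonneg a) fun t => |ψ t|).symm
  induction k with
  | zero => exact h0
  | succ k ih =>
    intro ψ
    have h1 : deriv (fun t => a * ψ t) = fun t => a * deriv ψ t := by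
      ext t
      exact deriv_const_mul_field a
    simp only [circleNorm]
    rw [h0, h1, ih]
    ring

/-! ### The geometric norms -/

/-- The pairings defining the geometric norms are bounded. -/
theorem bddAbove_geomNorm {r : ℕ} {χ c : ℝ} {ρ : ℕ} {u : Torus → ℝ} (hu : IsCk (r - 1) u)
    (hρ : ρ ≤ r - 1) :
    BddAbove {I | ∃ α : List (Fin 2), α.length ≤ ρ ∧ ∃ γ ∈ Gam r χ r c, ∃ ψ : ℝ → ℝ,
      ContDiff ℝ α.length ψ ∧ Function.Periodic ψ 1 ∧ circleNorm α.length ψ = 1 ∧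
      I = ∫ t in (0 : ℝ)..1, ψ t * partials α (fun z => u (proj z)) (γ t)} := by
  obtain ⟨K, hK⟩ := exists_Pl_of_periodic hu fun a b z => by rw [proj_add_int]
  refine ⟨1 * K, ?_⟩
  rintro I ⟨α, hα, γ, hγ, ψ, hψ, hp, h1, rfl⟩
  have hs := Sc_circleNorm _ hψ hp
  rw [h1] at hs
  have hP : Pl 0 K (partials α fun z => u (proj z)) :=
    Pl.partials α (m := 0) (hK.of_le (by omega))
  refine (le_abs_self _).trans ?_
  have := intervalIntegral.norm_integral_le_of_norm_le_const (a := (0 : ℝ)) (b := 1)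
    (f := fun t => ψ t * partials α (fun z => u (proj z)) (γ t)) (C := 1 * K) fun t _ => by
      rw [Real.norm_eq_abs, abs_mul]
      exact mul_le_mul (hs.bound t) (hP.bound _) (abs_nonneg _) zero_le_one
  simpa using this

theorem geomNorm_le {r : ℕ} {χ c : ℝ} {ρ : ℕ} {u : Torus → ℝ} {B : ℝ} (hB : 0 ≤ B)
    (h : ∀ (α : List (Fin 2)), α.length ≤ ρ → ∀ γ ∈ Gam r χ r c, ∀ ψ : ℝ → ℝ,
      ContDiff ℝ α.length ψ → Function.Periodic ψ 1 → circleNorm α.length ψ = 1 →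
      ∫ t in (0 : ℝ)..1, ψ t * partials α (fun z => u (proj z)) (γ t) ≤ B) :
    geomNorm r χ c ρ u ≤ B := by
  refine Real.sSup_le ?_ hB
  rintro I ⟨α, hα, γ, hγ, ψ, hψ, hp, h1, rfl⟩
  exact h α hα γ hγ ψ hψ hp h1

theorem abs_pairing_le_of_norm_eq_one {r : ℕ} {χ c : ℝ} {ρ : ℕ} {u : Torus → ℝ}
    (hu : IsCk (r - 1) u) (hρ : ρ ≤ r - 1) {α : List (Fin 2)} (hα : α.length ≤ ρ)
    {γ : ℝ → ℝ × ℝ} (hγ : γ ∈ Gam r χ r c) {ψ : ℝ → ℝ} (hψ : ContDiff ℝ α.length ψ)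
    (hp : Function.Periodic ψ 1) (h1 : circleNorm α.length ψ = 1) :
    |∫ t in (0 : ℝ)..1, ψ t * partials α (fun z => u (proj z)) (γ t)| ≤ geomNorm r χ c ρ u := by
  refine abs_le'.2 ⟨le_csSup (bddAbove_geomNorm hu hρ) ⟨α, hα, γ, hγ, ψ, hψ, hp, h1, rfl⟩,
    le_csSup (bddAbove_geomNorm hu hρ) ⟨α, hα, γ, hγ, fun t => -1 * ψ t,
      contDiff_const.mul hψ, fun t => by simp only [hp t], ?_, ?_⟩⟩
  · rw [circleNorm_const_mul, h1]; simp
  · rw [← intervalIntegral.integral_neg]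
    congr 1
    ext t
    ring

theorem geomNorm_nonneg {r : ℕ} {χ c : ℝ} {ρ : ℕ} {u : Torus → ℝ} (hu : IsCk (r - 1) u)
    (hρ : ρ ≤ r - 1) : 0 ≤ geomNorm r χ c ρ u := by
  by_cases hne : ∃ α : List (Fin 2), α.length ≤ ρ ∧ ∃ γ ∈ Gam r χ r c, ∃ ψ : ℝ → ℝ,
      ContDiff ℝ α.length ψ ∧ Function.Periodic ψ 1 ∧ circleNorm α.length ψ = 1
  · obtain ⟨α, hα, γ, hγ, ψ, hψ, hp, h1⟩ := hne
    exact (abs_nonneg _).trans (abs_pairing_le_of_norm_eq_one hu hρ hα hγ hψ hp h1)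
  -- Without admissible data the set is empty, and its supremum is 0 by convention.
  · refine Real.sSup_nonneg ?_
    rintro I ⟨α, hα, γ, hγ, ψ, hψ, hp, h1, rfl⟩
    exact absurd ⟨α, hα, γ, hγ, ψ, hψ, hp, h1⟩ hne

theorem geomNorm_mono {r : ℕ} {χ c : ℝ} {ρ ρ' : ℕ} {u : Torus → ℝ} (hu : IsCk (r - 1) u)
    (hρ : ρ ≤ ρ') (hρ' : ρ' ≤ r - 1) : geomNorm r χ c ρ u ≤ geomNorm r χ c ρ' u :=
  geomNorm_le (geomNorm_nonneg hu hρ') fun _ hα _ hγ _ hψ hp h1 =>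
    (le_abs_self _).trans (abs_pairing_le_of_norm_eq_one hu hρ' (hα.trans hρ) hγ hψ hp h1)

/-- Pairing with an arbitrary test function. -/
theorem abs_pairing_le {r : ℕ} {χ c : ℝ} {ρ : ℕ} {u : Torus → ℝ}
    (hu : IsCk (r - 1) u) (hρ : ρ ≤ r - 1) {α : List (Fin 2)} (hα : α.length ≤ ρ)
    {γ : ℝ → ℝ × ℝ} (hγ : γ ∈ Gam r χ r c) {ψ : ℝ → ℝ} (hψ : ContDiff ℝ α.length ψ)
    (hp : Function.Periodic ψ 1) :
    |∫ t in (0 : ℝ)..1, ψ t * partials α (fun z => u (proj z)) (γ t)| ≤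
      circleNorm α.length ψ * geomNorm r χ c ρ u := by
  rcases (circleNorm_nonneg α.length ψ).eq_or_lt with h0 | h0
  · have hs := Sc_circleNorm _ hψ hp
    rw [← h0] at hs ⊢
    have : ∀ t, ψ t = 0 := fun t => abs_nonpos_iff.1 (hs.bound t)
    simp [this]
  · set N := circleNorm α.length ψ with hN
    have h1 := abs_pairing_le_of_norm_eq_one hu hρ hα hγ (ψ := fun t => N⁻¹ * ψ t)
      (contDiff_const.mul hψ) (fun t => by simp only [hp t]) (by
        rw [circleNorm_const_mul, ← hN, abs_of_pos (inv_pos.2 h0), inv_mul_cancel₀ h0.ne'])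
    simp only [mul_assoc] at h1
    rw [intervalIntegral.integral_const_mul, abs_mul, abs_of_pos (inv_pos.2 h0),
      inv_mul_le_iff₀ h0] at h1
    exact h1

end SVPH

namespace SVPH

/-! ### Differential operators with variable coefficients -/

/-- The operator `m₀ ∂₀ + m₁ ∂₁`. -/
def vecD (m : Fin 2 → ℝ × ℝ → ℝ) (Z : ℝ × ℝ → ℝ) : ℝ × ℝ → ℝ :=
  fun z => m 0 z * partialD 0 Z z + m 1 z * partialD 1 Z z

/-- Composition of the operators `vecD (m i)` along a word. -/
def vecDs (m : Fin 2 → Fin 2 → ℝ × ℝ → ℝ) (α : List (Fin 2)) (Z : ℝ × ℝ → ℝ) : ℝ × ℝ → ℝ :=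
  α.foldr (fun i Z => vecD (m i) Z) Z

theorem contDiff_vecD {k : ℕ} {m : Fin 2 → ℝ × ℝ → ℝ} (hm : ∀ i, ContDiff ℝ k (m i))
    {Z : ℝ × ℝ → ℝ} (hZ : ContDiff ℝ (k + 1 : ℕ) Z) : ContDiff ℝ k (vecD m Z) :=
  ((hm 0).mul (contDiff_partialD hZ 0)).add ((hm 1).mul (contDiff_partialD hZ 1))

theorem contDiff_vecDs {N : ℕ} {m : Fin 2 → Fin 2 → ℝ × ℝ → ℝ} (hm : ∀ i j, ContDiff ℝ N (m i j)) :
    ∀ (α : List (Fin 2)) {k : ℕ} {Z : ℝ × ℝ → ℝ}, α.length + k ≤ N →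
      ContDiff ℝ (α.length + k : ℕ) Z → ContDiff ℝ k (vecDs m α Z) := by
  intro α
  induction α with
  | nil =>
    intro k Z _ hZ
    rw [List.length_nil, zero_add] at hZ
    exact hZ
  | cons i α ih =>
    intro k Z hk hZ
    rw [List.length_cons] at hk hZ
    have e : α.length + 1 + k = α.length + (k + 1) := by omega
    rw [e] at hZ
    exact contDiff_vecD (fun j => (hm i j).of_le (by exact_mod_cast (by omega : k ≤ N)))
      (ih (by omega) hZ)

theorem vecDs_add {N : ℕ} {m : Fin 2 → Fin 2 → ℝ × ℝ → ℝ} (hm : ∀ i j, ContDiff ℝ N (m i j)) :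
    ∀ (α : List (Fin 2)) {Z Z' : ℝ × ℝ → ℝ}, α.length ≤ N → ContDiff ℝ α.length Z →
      ContDiff ℝ α.length Z' →
      vecDs m α (fun z => Z z + Z' z) = fun z => vecDs m α Z z + vecDs m α Z' z := by
  intro α
  induction α with
  | nil => exact fun _ _ _ => rfl
  | cons i α ih =>
    intro Z Z' hN hZ hZ'
    rw [List.length_cons] at hN hZ hZ'
    have h1 : vecDs m (i :: α) (fun z => Z z + Z' z) =
        vecD (m i) (fun z => vecDs m α Z z + vecDs m α Z' z) := by
      rw [← ih (by omega) (hZ.of_le (by exact_mod_cast Nat.le_succ _))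
        (hZ'.of_le (by exact_mod_cast Nat.le_succ _))]
      rfl
    rw [h1]
    have hd := (contDiff_vecDs hm α (k := 1) hN hZ).differentiable (by simp)
    have hd' := (contDiff_vecDs hm α (k := 1) hN hZ').differentiable (by simp)
    ext z
    simp only [vecD, partialD_add hd hd']
    change _ = vecD (m i) (vecDs m α Z) z + vecD (m i) (vecDs m α Z') z
    simp only [vecD]
    ring

/-- Moving the innermost operator onto the two factors of a product. -/
theorem vecDs_append_mul {N : ℕ} {m : Fin 2 → Fin 2 → ℝ × ℝ → ℝ}
    (hm : ∀ i j, ContDiff ℝ N (m i j)) (α : List (Fin 2)) (i : Fin 2) (hN : α.length ≤ N)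
    {A V : ℝ × ℝ → ℝ} (hA : ContDiff ℝ (α.length + 1 : ℕ) A)
    (hV : ContDiff ℝ (α.length + 1 : ℕ) V) (z : ℝ × ℝ) :
    vecDs m (α ++ [i]) (fun z => A z * V z) z =
      vecDs m α (fun z => vecD (m i) A z * V z) z +
      vecDs m α (fun z => A z * m i 0 z * partialD 0 V z) z +
      vecDs m α (fun z => A z * m i 1 z * partialD 1 V z) z := by
  have hle : ((α.length : ℕ) : WithTop ℕ∞) ≤ (α.length + 1 : ℕ) := by
    exact_mod_cast Nat.le_succ _
  have hmα : ∀ i j, ContDiff ℝ α.length (m i j) := fun i j => (hm i j).of_le (by exact_mod_cast hN)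
  have h1 : vecDs m (α ++ [i]) (fun z => A z * V z) =
      vecDs m α (fun z => (vecD (m i) A z * V z + A z * m i 0 z * partialD 0 V z) +
        A z * m i 1 z * partialD 1 V z) := by
    simp only [vecDs, List.foldr_append, List.foldr_cons, List.foldr_nil]
    congr 1
    ext z
    simp only [vecD, partialD_mul (hA.differentiable (by simp)) (hV.differentiable (by simp))]
    ring
  have c1 : ContDiff ℝ α.length fun z => vecD (m i) A z * V z :=
    (contDiff_vecD (hmα i) hA).mul (hV.of_le hle)
  have c2 : ∀ j, ContDiff ℝ α.length fun z => A z * m i j z * partialD j V z := fun j =>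
    ((hA.of_le hle).mul (hmα i j)).mul (contDiff_partialD hV j)
  rw [h1, vecDs_add hm α hN (c1.add (c2 0)) (c2 1), vecDs_add hm α hN c1 (c2 0)]

/-! ### Pairings along a curve -/

/-- A function `U` and a periodic graph `q` for which pairings of the derivatives of `U` along the
graph are controlled by the sequence of norms `nn`. -/
structure Tested (N : ℕ) (T : ℝ) (U : ℝ × ℝ → ℝ) (q : ℝ → ℝ) (nn : ℕ → ℝ) : Prop where
  smooth : ContDiff ℝ N U
  per : ∀ z, U (z + (0, 1)) = U z
  q_diff : Differentiable ℝ q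
  q_per : ∀ s, q (s + 1) = q s
  q_class : Sc N T 1 (deriv q)
  mono : ∀ i j, i ≤ j → j ≤ N → nn i ≤ nn j
  nonneg : ∀ k, k ≤ N → 0 ≤ nn k
  test : ∀ β : List (Fin 2), β.length ≤ N → ∀ (χ : ℝ → ℝ) (X : ℝ), Function.Periodic χ 1 →
    Sc β.length X 1 χ → |∫ s in (0 : ℝ)..1, χ s * partials β U (q s, s)| ≤ X * nn β.length

namespace Tested

variable {N : ℕ} {T : ℝ} {U : ℝ × ℝ → ℝ} {q : ℝ → ℝ} {nn : ℕ → ℝ}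

theorem contDiff_partials (h : Tested N T U q nn) {β : List (Fin 2)} {k : ℕ}
    (hk : β.length + k ≤ N) : ContDiff ℝ k (partials β U) :=
  SVPH.contDiff_partials β (h.smooth.of_le (by exact_mod_cast hk))

theorem continuous_graph (h : Tested N T U q nn) : Continuous fun s => (q s, s) :=
  h.q_diff.continuous.prodMk continuous_id

theorem continuous_partials (h : Tested N T U q nn) {β : List (Fin 2)} (hk : β.length ≤ N) :
    Continuous fun s => partials β U (q s, s) :=
  (h.contDiff_partials (β := β) (k := 0) hk).continuous.comp h.continuous_graph

theorem periodic_graph (h : Tested N T U q nn) {A : ℝ × ℝ → ℝ} (hA : ∀ z, A (z + (0, 1)) = A z) :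
    Function.Periodic (fun s => A (q s, s)) 1 := by
  intro s
  simp only [h.q_per]
  rw [← hA (q s, s)]
  simp

/-- Integration by parts along the graph. -/
theorem integral_partialD_one (h : Tested N T U q nn) {Z : ℝ × ℝ → ℝ} (hZ : ContDiff ℝ 1 Z)
    (hZp : ∀ z, Z (z + (0, 1)) = Z z) {χ : ℝ → ℝ} (hχ : ContDiff ℝ 1 χ)
    (hp : Function.Periodic χ 1) :
    ∫ s in (0 : ℝ)..1, χ s * partialD 1 Z (q s, s) =
      -(∫ s in (0 : ℝ)..1, deriv χ s * Z (q s, s)) +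
        ∫ s in (0 : ℝ)..1, -(χ s * deriv q s) * partialD 0 Z (q s, s) := by
  have hZd : Differentiable ℝ Z := hZ.differentiable (by simp)
  have hZ1 : ContDiff ℝ ((0 : ℕ) + 1 : ℕ) Z := by simpa using hZ
  have hc : ∀ i, Continuous fun s => partialD i Z (q s, s) := fun i =>
    (contDiff_partialD hZ1 i).continuous.comp h.continuous_graph
  have hqc : Continuous (deriv q) := h.q_class.continuous
  have hχc : Continuous (deriv χ) := hχ.continuous_deriv le_rfl
  have hv : ∀ s, HasDerivAt (fun s => Z (q s, s))
      (partialD 0 Z (q s, s) * deriv q s + partialD 1 Z (q s, s)) s := by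
    intro s
    have h1 := deriv_comp_graph hZd h.q_diff
    have h2 : DifferentiableAt ℝ (fun s => Z (q s, s)) s :=
      (hZd _).comp s ((h.q_diff s).prodMk differentiableAt_id)
    have h3 := h2.hasDerivAt
    rwa [h1] at h3
  have hvc : Continuous fun s => partialD 0 Z (q s, s) * deriv q s + partialD 1 Z (q s, s) :=
    ((hc 0).mul hqc).add (hc 1)
  have hZc : Continuous fun s => Z (q s, s) := hZ.continuous.comp h.continuous_graph
  -- Along the graph ∂₁Z is the derivative of s ↦ Z(q s, s) minus q'∂₀Z; periodicity removes the
  -- boundary terms.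
  have key := intervalIntegral.integral_mul_deriv_eq_deriv_mul (a := (0 : ℝ)) (b := 1)
    (u := χ) (v := fun s => Z (q s, s)) (u' := deriv χ)
    (v' := fun s => partialD 0 Z (q s, s) * deriv q s + partialD 1 Z (q s, s))
    (fun s _ => (hχ.differentiable (by simp) s).hasDerivAt) (fun s _ => hv s)
    (hχc.intervalIntegrable _ _) (hvc.intervalIntegrable _ _)
  have e1 : χ 1 = χ 0 := by simpa using hp 0
  have e2 : Z (q 1, 1) = Z (q 0, 0) := by simpa using h.periodic_graph hZp 0
  simp only [e1, e2, sub_self, zero_sub] at key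
  rw [← key, ← intervalIntegral.integral_add]
  · congr 1
    ext s
    ring
  · exact (hχ.continuous.mul hvc).intervalIntegrable _ _
  · exact ((hχ.continuous.mul hqc).neg.mul (hc 0)).intervalIntegrable _ _

/-- Symmetry of second derivatives brings ∂₁ to the outermost position, where it can be integrated
by parts. -/
theorem partials_replicate_cons {U : ℝ × ℝ → ℝ} (β : List (Fin 2)) : ∀ a : ℕ,
    ContDiff ℝ (β.length + (a + 1) : ℕ) U →
    partials (List.replicate a 0 ++ 1 :: β) U = partialD 1 (partials (List.replicate a 0 ++ β) U) := by
  intro a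
  induction a with
  | zero => intro _; rfl
  | succ a ih =>
    intro hU
    have h1 := ih (hU.of_le (by exact_mod_cast (by omega : β.length + (a + 1) ≤ _)))
    have h2 : ContDiff ℝ (2 : ℕ) (partials (List.replicate a 0 ++ β) U) := by
      refine SVPH.contDiff_partials _ (hU.of_le ?_)
      simp only [List.length_append, List.length_replicate]
      exact_mod_cast (by omega : a + β.length + 2 ≤ β.length + (a + 1 + 1))
    simp only [List.replicate_succ, List.cons_append, partials]
    rw [h1, partialD_comm h2]

/-- Modulo lower order terms, every derivative along the graph is a multiple of a pure derivative
in the first direction. -/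
theorem exists_reduction (N : ℕ) {T : ℝ} (hT : 0 ≤ T) (l : ℕ) : ∃ C : ℝ, 0 ≤ C ∧
    ∀ {U : ℝ × ℝ → ℝ} {q : ℝ → ℝ} {nn : ℕ → ℝ}, Tested N T U q nn →
      ∀ β : List (Fin 2), β.length = l → ∀ a : ℕ, a + l ≤ N → ∀ (χ : ℝ → ℝ) (X : ℝ),
      Function.Periodic χ 1 → Sc (a + l) X 1 χ →
      |(∫ s in (0 : ℝ)..1, χ s * partials (List.replicate a 0 ++ β) U (q s, s)) -
        ∫ s in (0 : ℝ)..1, χ s * (-deriv q s) ^ β.count 1 *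
          partials (List.replicate (a + l) 0) U (q s, s)| ≤ C * (X * nn (a + l - 1)) := by
  induction l with
  | zero =>
    refine ⟨0, le_rfl, fun {U q nn} h β hβ a ha χ X hp hχ => ?_⟩
    obtain rfl := List.length_eq_zero_iff.1 hβ
    simp
  | succ l ih =>
    obtain ⟨C, hC, hb⟩ := ih
    refine ⟨C + (1 + C * (2 ^ N * T)), by positivity, fun {U q nn} h β hβ a ha χ X hp hχ => ?_⟩
    obtain ⟨i, β, rfl⟩ := List.exists_cons_of_length_eq_add_one hβ
    rw [List.length_cons, Nat.add_right_cancel_iff] at hβ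
    have e : a + 1 + l = a + (l + 1) := by omega
    have hX := hχ.nonneg
    have hn := h.nonneg (a + (l + 1) - 1) (by omega)
    have hXn := mul_nonneg hX hn
    have hi : i = 0 ∨ i = 1 := by omega
    -- A leading ∂₀ joins the prefix. A leading ∂₁ is moved outside and traded for -q'∂₀, with an
    -- error in which one derivative has passed from U to the test function.
    rcases hi with rfl | rfl
    · have h1 := hb h β hβ (a + 1) (by omega) χ X hp (by rwa [e])
      rw [e, List.replicate_succ', List.append_assoc] at h1
      have e2 : List.count 1 ((0 : Fin 2) :: β) = List.count 1 β := by simp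
      rw [e2]
      refine h1.trans (mul_le_mul_of_nonneg_right ?_ hXn)
      have : 0 ≤ C * (2 ^ N * T) := by positivity
      linarith
    · have hlen : (List.replicate a (0 : Fin 2) ++ β).length = a + l := by simp [hβ]
      have hZ : ContDiff ℝ 1 (partials (List.replicate a 0 ++ β) U) := by
        have := h.contDiff_partials (β := List.replicate a 0 ++ β) (k := 1) (by omega)
        simpa using this
      have hχ' : Sc (a + l + 1) X 1 χ := hχ
      have hχ1 : ContDiff ℝ 1 χ := hχ'.contDiff.of_le (by
        exact_mod_cast (by omega : 1 ≤ a + l + 1))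
      have e0 : partials (List.replicate a 0 ++ 1 :: β) U =
          partialD 1 (partials (List.replicate a 0 ++ β) U) :=
        partials_replicate_cons β a (h.smooth.of_le (by
          exact_mod_cast (by omega : β.length + (a + 1) ≤ N)))
      rw [e0, h.integral_partialD_one hZ (fun z => partials_periodic h.per _ z) hχ1 hp]
      have h1 := h.test (List.replicate a 0 ++ β) (by omega) (deriv χ) X (periodic_deriv hp) (by
        have := hχ'.2.2
        rw [mul_one] at this
        rwa [hlen])
      rw [hlen] at h1
      have hχq : Sc (a + 1 + l) (2 ^ N * T * X) 1 fun s => -(χ s * deriv q s) := by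
        rw [e]
        refine ((hχ.mul (h.q_class.of_le ha)).mono ?_ zero_le_one).neg
        have : (2 : ℝ) ^ (a + (l + 1)) ≤ 2 ^ N := pow_le_pow_right₀ one_le_two ha
        calc (2 : ℝ) ^ (a + (l + 1)) * (X * T) ≤ 2 ^ N * (X * T) :=
              mul_le_mul_of_nonneg_right this (mul_nonneg hX hT)
          _ = _ := by ring
      have hqp : Function.Periodic (deriv q) 1 := periodic_deriv h.q_per
      have h2 := hb h β hβ (a + 1) (by omega) (fun s => -(χ s * deriv q s)) _
        (fun s => by simp only [hp s, hqp s]) hχq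
      rw [e] at h2
      have e3 : List.replicate (a + 1) (0 : Fin 2) ++ β = 0 :: (List.replicate a 0 ++ β) := rfl
      have e4 : ∀ s, χ s * (-deriv q s) ^ List.count 1 ((1 : Fin 2) :: β) *
          partials (List.replicate (a + (l + 1)) 0) U (q s, s) =
          -(χ s * deriv q s) * (-deriv q s) ^ List.count 1 β *
          partials (List.replicate (a + (l + 1)) 0) U (q s, s) := by
        intro s
        rw [List.count_cons_self, pow_succ]
        ring
      simp only [e4]
      rw [e3] at h2
      simp only [partials] at h2
      have e5 : a + (l + 1) - 1 = a + l := by omega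
      rw [e5] at h2 ⊢ hXn
      rw [neg_add_eq_sub, sub_sub, add_comm, ← sub_sub]
      refine (abs_sub _ _).trans ((add_le_add h2 h1).trans ?_)
      have : 0 ≤ C * (X * nn (a + l)) := mul_nonneg hC hXn
      nlinarith

end Tested

end SVPH

/-! ### Iterated operators under the integral -/

namespace SVPH

namespace Tested

theorem Pl_vecD {k : ℕ} {K K' : ℝ} {m : Fin 2 → ℝ × ℝ → ℝ} (hm : ∀ i, Pl k K (m i))
    {A : ℝ × ℝ → ℝ} (hA : Pl (k + 1) K' A) : Pl k (2 ^ k * (K * K') + 2 ^ k * (K * K')) (vecD m A) :=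
  ((hm 0).mul (hA.2.2 0)).add ((hm 1).mul (hA.2.2 1))

theorem vecD_periodic {w : ℝ × ℝ} {m : Fin 2 → ℝ × ℝ → ℝ} (hm : ∀ i z, m i (z + w) = m i z)
    {A : ℝ × ℝ → ℝ} (hA : ∀ z, A (z + w) = A z) (z : ℝ × ℝ) : vecD m A (z + w) = vecD m A z := by
  have := fun i => partials_periodic hA [i] z
  simp only [partials] at this
  simp only [vecD, hm, this]

variable {N : ℕ} {T : ℝ} {U : ℝ × ℝ → ℝ} {q : ℝ → ℝ} {nn : ℕ → ℝ}

/-- Splitting off the innermost operator under the integral. -/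
theorem integral_vecDs_append (h : Tested N T U q nn) {m : Fin 2 → Fin 2 → ℝ × ℝ → ℝ}
    (hm : ∀ i j, ContDiff ℝ N (m i j)) {α β : List (Fin 2)} (i : Fin 2)
    (hl : α.length + 1 + β.length ≤ N) {A : ℝ × ℝ → ℝ} (hA : ContDiff ℝ (α.length + 1 : ℕ) A)
    {χ : ℝ → ℝ} (hχ : Continuous χ) :
    ∫ s in (0 : ℝ)..1, χ s * vecDs m (α ++ [i]) (fun z => A z * partials β U z) (q s, s) =
      (∫ s in (0 : ℝ)..1, χ s * vecDs m α (fun z => vecD (m i) A z * partials β U z) (q s, s)) +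
      (∫ s in (0 : ℝ)..1,
        χ s * vecDs m α (fun z => (A z * m i 0 z) * partials (0 :: β) U z) (q s, s)) +
      ∫ s in (0 : ℝ)..1,
        χ s * vecDs m α (fun z => (A z * m i 1 z) * partials (1 :: β) U z) (q s, s) := by
  have hV : ContDiff ℝ (α.length + 1 : ℕ) (partials β U) := h.contDiff_partials (by omega)
  have hle : ((α.length : ℕ) : WithTop ℕ∞) ≤ (α.length + 1 : ℕ) := by
    exact_mod_cast Nat.le_succ _
  have hmα : ∀ i j, ContDiff ℝ α.length (m i j) := fun i j =>
    (hm i j).of_le (by exact_mod_cast (by omega : α.length ≤ N))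
  have hc : ∀ {Z : ℝ × ℝ → ℝ}, ContDiff ℝ α.length Z →
      IntervalIntegrable (fun s => χ s * vecDs m α Z (q s, s)) MeasureTheory.volume 0 1 := by
    intro Z hZ
    have := contDiff_vecDs hm α (k := 0) (by omega) hZ
    exact (hχ.mul (this.continuous.comp h.continuous_graph)).intervalIntegrable _ _
  have i1 := hc ((contDiff_vecD (hmα i) hA).mul (hV.of_le hle))
  have i2 : ∀ j, _ := fun j => hc (((hA.of_le hle).mul (hmα i j)).mul (contDiff_partialD hV j))
  simp only [partials]
  rw [← intervalIntegral.integral_add i1 (i2 0), ← intervalIntegral.integral_add (i1.add (i2 0)) (i2 1)]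
  congr 1
  ext s
  rw [vecDs_append_mul hm α i (by omega) hA hV]
  simp only [mul_add]

/-- A crude bound of the pairings of iterated operators. -/
theorem exists_crude (N : ℕ) {T Km : ℝ} (hT : 0 ≤ T) (hKm : 0 ≤ Km) (l : ℕ) : ∀ {KA : ℝ}, 0 ≤ KA →
    ∃ C : ℝ, 0 ≤ C ∧ ∀ {U : ℝ × ℝ → ℝ} {q : ℝ → ℝ} {nn : ℕ → ℝ}, Tested N T U q nn →
      ∀ {m : Fin 2 → Fin 2 → ℝ × ℝ → ℝ}, (∀ i j, Pl N Km (m i j)) →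
      (∀ i j z, m i j (z + (0, 1)) = m i j z) →
      ∀ α β : List (Fin 2), α.length = l → l + β.length ≤ N →
      ∀ {A : ℝ × ℝ → ℝ}, Pl (l + β.length) KA A → (∀ z, A (z + (0, 1)) = A z) →
      ∀ (χ : ℝ → ℝ) (X : ℝ), Function.Periodic χ 1 → Sc (l + β.length) X 1 χ →
      |∫ s in (0 : ℝ)..1, χ s * vecDs m α (fun z => A z * partials β U z) (q s, s)| ≤
        C * (X * nn (l + β.length)) := by
  induction l with
  | zero =>
    intro KA hKA
    -- The order of the word varies, so the constants for all orders up to N are merged into their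
    -- sum.
    obtain ⟨C, hC, hcg⟩ : ∃ C : ℝ, 1 ≤ C ∧ ∀ k ≤ N, ∀ {K : ℝ} {f : ℝ × ℝ → ℝ} {q : ℝ → ℝ},
        Pl k K f → Differentiable ℝ q → Sc N T 1 (deriv q) → Sc k (C * K) 1 (fun s => f (q s, s)) := by
      choose C hC hb using fun k => Pl.comp_graph k hT
      refine ⟨∑ k ∈ Finset.range (N + 1), C k, ?_, fun k hk {K f q} hf hq hqc => ?_⟩
      · exact (hC 0).trans (Finset.single_le_sum (fun i _ => zero_le_one.trans (hC i))
          (Finset.mem_range.2 (by omega)))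
      · refine (hb k hf hq (fun m hm => hqc.of_le (by omega)) le_rfl).mono ?_ zero_le_one
        exact mul_le_mul_of_nonneg_right (Finset.single_le_sum
          (fun i _ => zero_le_one.trans (hC i)) (Finset.mem_range.2 (by omega))) hf.nonneg
    refine ⟨2 ^ N * (C * KA), by positivity,
      fun {U q nn} h {m} hm hmp α β hα hl {A} hA hAp χ X hp hχ => ?_⟩
    obtain rfl := List.length_eq_zero_iff.1 hα
    rw [zero_add] at hl hA hχ ⊢
    have hX := hχ.nonneg
    have h1 := h.test β hl (fun s => χ s * A (q s, s)) (2 ^ N * (C * KA) * X)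
      (fun s => by simp only [hp s, h.periodic_graph hAp s]) (by
        refine (hχ.mul (hcg _ hl hA h.q_diff h.q_class)).mono ?_ zero_le_one
        have : (2 : ℝ) ^ β.length ≤ 2 ^ N := pow_le_pow_right₀ one_le_two hl
        calc (2 : ℝ) ^ β.length * (X * (C * KA)) ≤ 2 ^ N * (X * (C * KA)) :=
              mul_le_mul_of_nonneg_right this (by positivity)
          _ = _ := by ring)
    simp only [mul_assoc] at h1 ⊢
    exact h1
  | succ l ih =>
    intro KA hKA
    obtain ⟨C₁, hC₁, hb₁⟩ := ih (KA := 2 ^ N * (Km * KA) + 2 ^ N * (Km * KA)) (by positivity)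
    obtain ⟨C₂, hC₂, hb₂⟩ := ih (KA := 2 ^ N * (KA * Km)) (by positivity)
    refine ⟨C₁ + C₂ + C₂, by positivity,
      fun {U q nn} h {m} hm hmp α' β hα hl {A} hA hAp χ X hp hχ => ?_⟩
    -- The last letter acts first. On A·∂^βU it either differentiates A, leaving one derivative
    -- fewer on U, or lengthens β and multiplies A by a coefficient.
    obtain ⟨α, i, rfl⟩ : ∃ α i, α' = α ++ [i] :=
      ⟨_, _, (List.dropLast_append_getLast (by rintro rfl; simp at hα)).symm⟩
    have hα' : α.length = l := by simpa using hα
    have e : l + 1 + β.length = (l + β.length) + 1 := by omega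
    have e' : l + (β.length + 1) = (l + β.length) + 1 := by omega
    rw [e] at hA hχ ⊢
    have hX := hχ.nonneg
    rw [h.integral_vecDs_append (fun i j => (hm i j).contDiff) i (by omega)
      (hA.contDiff.of_le (by exact_mod_cast (by omega : α.length + 1 ≤ l + β.length + 1)))
      hχ.continuous]
    have hpow : ∀ k ≤ N, (2 : ℝ) ^ k ≤ 2 ^ N := fun k hk => pow_le_pow_right₀ one_le_two hk
    have t1 := hb₁ h hm hmp α β hα' (by omega) (A := vecD (m i) A)
      ((Pl_vecD (fun j => (hm i j).of_le (by omega)) hA).mono (by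
        have := hpow (l + β.length) (by omega)
        gcongr)) (vecD_periodic (hmp i) hAp) χ X hp hχ.of_succ
    have t2 : ∀ j, |∫ s in (0 : ℝ)..1,
        χ s * vecDs m α (fun z => (A z * m i j z) * partials (j :: β) U z) (q s, s)| ≤
        C₂ * (X * nn (l + β.length + 1)) := by
      intro j
      have := hb₂ h hm hmp α (j :: β) hα' (by rw [List.length_cons]; omega)
        (A := fun z => A z * m i j z) (by
          rw [List.length_cons, e']
          refine (hA.mul ((hm i j).of_le (by omega))).mono ?_
          have := hpow (l + β.length + 1) (by omega)
          gcongr) (fun z => by rw [hAp, hmp]) χ X hp (by rwa [List.length_cons, e'])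
      rwa [List.length_cons, e'] at this
    have hmono : C₁ * (X * nn (l + β.length)) ≤ C₁ * (X * nn (l + β.length + 1)) := by
      have := h.mono (l + β.length) (l + β.length + 1) (by omega) (by omega)
      gcongr
    refine (abs_add_three _ _ _).trans ?_
    have := t2 0
    have := t2 1
    linarith

/-- The leading term of the pairings of iterated operators. -/
theorem exists_leading (N : ℕ) {T Km : ℝ} (hT : 0 ≤ T) (hKm : 0 ≤ Km) (l : ℕ) :
    ∀ {KA : ℝ}, 0 ≤ KA →
    ∃ C : ℝ, 0 ≤ C ∧ ∀ {U : ℝ × ℝ → ℝ} {q : ℝ → ℝ} {nn : ℕ → ℝ}, Tested N T U q nn →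
      ∀ {m : Fin 2 → Fin 2 → ℝ × ℝ → ℝ}, (∀ i j, Pl N Km (m i j)) →
      (∀ i j z, m i j (z + (0, 1)) = m i j z) →
      ∀ α β : List (Fin 2), α.length = l → l + β.length ≤ N →
      ∀ {A : ℝ × ℝ → ℝ}, Pl (l + β.length) KA A → (∀ z, A (z + (0, 1)) = A z) →
      ∀ (χ : ℝ → ℝ) (X : ℝ), Function.Periodic χ 1 → Sc (l + β.length) X 1 χ →
      |(∫ s in (0 : ℝ)..1, χ s * vecDs m α (fun z => A z * partials β U z) (q s, s)) -
        ∫ s in (0 : ℝ)..1, χ s * A (q s, s) *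
          (α.map fun i => m i 0 (q s, s) - deriv q s * m i 1 (q s, s)).prod *
          (-deriv q s) ^ β.count 1 * partials (List.replicate (l + β.length) 0) U (q s, s)| ≤
        C * (X * nn (l + β.length - 1)) := by
  induction l with
  | zero =>
    intro KA hKA
    choose C₀ hC₀ hred using fun k => exists_reduction N hT k
    choose C₁ hC₁ hcg using fun k => Pl.comp_graph k hT
    have hC₁' : ∀ k, 0 ≤ C₁ k := fun k => zero_le_one.trans (hC₁ k)
    have hpos : ∀ k, 0 ≤ C₀ k * (2 ^ k * (C₁ k * KA)) := fun k =>
      mul_nonneg (hC₀ k) (mul_nonneg (by positivity) (mul_nonneg (hC₁' k) hKA))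
    refine ⟨∑ k ∈ Finset.range (N + 1), C₀ k * (2 ^ k * (C₁ k * KA)),
      Finset.sum_nonneg fun k _ => hpos k,
      fun {U q nn} h {m} hm hmp α β hα hl {A} hA hAp χ X hp hχ => ?_⟩
    obtain rfl := List.length_eq_zero_iff.1 hα
    rw [zero_add] at hl hA hχ ⊢
    have hX := hχ.nonneg
    have hn := h.nonneg (β.length - 1) (by omega)
    have h1 := hred β.length h β rfl 0 (by omega) (fun s => χ s * A (q s, s)) _
      (fun s => by simp only [hp s, h.periodic_graph hAp s]) (by
        rw [zero_add]
        exact hχ.mul (hcg _ hA h.q_diff (fun m hm => h.q_class.of_le (by omega)) le_rfl))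
    rw [zero_add] at h1
    have h2 : C₀ β.length * (2 ^ β.length * (X * (C₁ β.length * KA)) * nn (β.length - 1)) ≤
        (∑ k ∈ Finset.range (N + 1), C₀ k * (2 ^ k * (C₁ k * KA))) * (X * nn (β.length - 1)) := by
      have h3 := Finset.single_le_sum (f := fun k => C₀ k * (2 ^ k * (C₁ k * KA)))
        (fun i _ => hpos i) (Finset.mem_range.2 (by omega : β.length < N + 1))
      refine le_trans (le_of_eq ?_) (mul_le_mul_of_nonneg_right h3 (mul_nonneg hX hn))
      ring
    refine le_trans (le_of_eq ?_) (h1.trans h2)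
    congr 2
    · congr 1
      ext s
      simp [vecDs, mul_assoc]
    · congr 1
      ext s
      simp
  | succ l ih =>
    intro KA hKA
    -- Once an operator has fallen on A, only l + |β| derivatives are left for U, so the crude bound
    -- suffices for that term.
    obtain ⟨C₁, hC₁, hb₁⟩ := exists_crude N hT hKm l
      (KA := 2 ^ N * (Km * KA) + 2 ^ N * (Km * KA)) (by positivity)
    obtain ⟨C₂, hC₂, hb₂⟩ := ih (KA := 2 ^ N * (KA * Km)) (by positivity)
    refine ⟨C₁ + C₂ + C₂, by positivity,
      fun {U q nn} h {m} hm hmp α' β hα hl {A} hA hAp χ X hp hχ => ?_⟩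
    obtain ⟨α, i, rfl⟩ : ∃ α i, α' = α ++ [i] :=
      ⟨_, _, (List.dropLast_append_getLast (by rintro rfl; simp at hα)).symm⟩
    have hα' : α.length = l := by simpa using hα
    have e : l + 1 + β.length = (l + β.length) + 1 := by omega
    have e' : l + (β.length + 1) = (l + β.length) + 1 := by omega
    rw [e] at hA hχ ⊢
    have hX := hχ.nonneg
    rw [h.integral_vecDs_append (fun i j => (hm i j).contDiff) i (by omega)
      (hA.contDiff.of_le (by exact_mod_cast (by omega : α.length + 1 ≤ l + β.length + 1)))
      hχ.continuous]
    have hpow : ∀ k ≤ N, (2 : ℝ) ^ k ≤ 2 ^ N := fun k hk => pow_le_pow_right₀ one_le_two hk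
    have t1 := hb₁ h hm hmp α β hα' (by omega) (A := vecD (m i) A)
      ((Pl_vecD (fun j => (hm i j).of_le (by omega)) hA).mono (by
        have := hpow (l + β.length) (by omega)
        gcongr)) (vecD_periodic (hmp i) hAp) χ X hp hχ.of_succ
    have t2 := fun j => hb₂ h hm hmp α (j :: β) hα' (by rw [List.length_cons]; omega)
        (A := fun z => A z * m i j z) (by
          rw [List.length_cons, e']
          refine (hA.mul ((hm i j).of_le (by omega))).mono ?_
          have := hpow (l + β.length + 1) (by omega)
          gcongr) (fun z => by rw [hAp, hmp]) χ X hp (by rwa [List.length_cons, e'])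
    simp only [List.length_cons, e', Nat.add_sub_cancel] at t2 ⊢
    set L : ℝ → ℝ := fun s =>
      (α.map fun i => m i 0 (q s, s) - deriv q s * m i 1 (q s, s)).prod with hL
    have hmc : ∀ i j, Continuous fun s => m i j (q s, s) := fun i j =>
      (hm i j).continuous.comp h.continuous_graph
    have hqc : Continuous (deriv q) := h.q_class.continuous
    have hLc : Continuous L := by
      rw [hL]
      exact continuous_list_prod α fun i _ => (hmc i 0).sub (hqc.mul (hmc i 1))
    have hAc : Continuous fun s => A (q s, s) := hA.continuous.comp h.continuous_graph
    have hPc : Continuous fun s => partials (List.replicate (l + β.length + 1) 0) U (q s, s) :=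
      h.continuous_partials (by simp; omega)
    -- The two ways of lengthening β, by ∂₀ or by ∂₁, add up to the factor m i 0 - q'·m i 1
    -- contributed by the letter i.
    have e5 : ∫ s in (0 : ℝ)..1, χ s * A (q s, s) *
          ((α ++ [i]).map fun i => m i 0 (q s, s) - deriv q s * m i 1 (q s, s)).prod *
          (-deriv q s) ^ β.count 1 * partials (List.replicate (l + β.length + 1) 0) U (q s, s) =
        (∫ s in (0 : ℝ)..1, χ s * (A (q s, s) * m i 0 (q s, s)) * L s *
          (-deriv q s) ^ ((0 : Fin 2) :: β).count 1 *
          partials (List.replicate (l + β.length + 1) 0) U (q s, s)) +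
        ∫ s in (0 : ℝ)..1, χ s * (A (q s, s) * m i 1 (q s, s)) * L s *
          (-deriv q s) ^ ((1 : Fin 2) :: β).count 1 *
          partials (List.replicate (l + β.length + 1) 0) U (q s, s) := by
      have hi : ∀ j k, IntervalIntegrable (fun s => χ s * (A (q s, s) * m i j (q s, s)) * L s *
          (-deriv q s) ^ k * partials (List.replicate (l + β.length + 1) 0) U (q s, s))
          MeasureTheory.volume 0 1 := fun j k =>
        ((((hχ.continuous.mul (hAc.mul (hmc i j))).mul hLc).mul (hqc.neg.pow k)).mul
          hPc).intervalIntegrable _ _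
      rw [← intervalIntegral.integral_add (hi 0 _) (hi 1 _)]
      congr 1
      ext s
      have c0 : List.count 1 ((0 : Fin 2) :: β) = List.count 1 β := by simp
      rw [c0, List.count_cons_self, pow_succ, List.map_append, List.prod_append]
      simp only [List.map_cons, List.map_nil, List.prod_cons, List.prod_nil, hL]
      ring
    rw [e5]
    have t20 := t2 0
    have t21 := t2 1
    set I1 := ∫ s in (0 : ℝ)..1, χ s * vecDs m α (fun z => vecD (m i) A z * partials β U z) (q s, s)
    set I2 := ∫ s in (0 : ℝ)..1,
        χ s * vecDs m α (fun z => (A z * m i 0 z) * partials (0 :: β) U z) (q s, s)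
    set I3 := ∫ s in (0 : ℝ)..1,
        χ s * vecDs m α (fun z => (A z * m i 1 z) * partials (1 :: β) U z) (q s, s)
    rw [add_sub_add_comm, add_comm I1, add_sub_right_comm]
    rw [add_comm _ I1, add_assoc, ← add_assoc]
    refine (abs_add_three _ _ _).trans ?_
    linarith

end Tested

end SVPH

namespace SVPH

/-! ### Conjugating partial derivatives by the dynamics -/

/-- The coefficients of the operators conjugate to `∂₀`, `∂₁` under `G^n`. -/
def pushCoef (G : ℝ × ℝ → ℝ × ℝ) (n : ℕ) (i j : Fin 2) (z : ℝ × ℝ) : ℝ :=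
  (if i = 0 then
    if j = 0 then partialD 1 (fun y => (G^[n] y).2) z else -partialD 0 (fun y => (G^[n] y).2) z
  else
    if j = 0 then -partialD 1 (fun y => (G^[n] y).1) z else partialD 0 (fun y => (G^[n] y).1) z) *
  ((dIter G n z).det)⁻¹

theorem partials_sum {ι : Type*} (t : Finset ι) {f : ι → ℝ × ℝ → ℝ} (α : List (Fin 2)) :
    (∀ i ∈ t, ContDiff ℝ α.length (f i)) →
    partials α (fun z => ∑ i ∈ t, f i z) = fun z => ∑ i ∈ t, partials α (f i) z := by
  induction α with
  | nil => intro _; rfl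
  | cons k α ih =>
    intro hf
    have h1 := ih fun i hi => (hf i hi).of_le (by simp)
    simp only [partials]
    rw [h1]
    ext z
    have hd : ∀ i ∈ t, DifferentiableAt ℝ (partials α (f i)) z := fun i hi =>
      (contDiff_partials (m := 1) α (hf i hi)).differentiable (by simp) z
    simp only [partialD]
    rw [fderiv_fun_sum hd]
    simp

namespace Sys

variable {r : ℕ} {M : ℝ} {G : ℝ × ℝ → ℝ × ℝ} {d : HypConst} {D : ℕ} {e : ℤ}

/-- The chain rule expresses the derivatives of Y ∘ G^n through those of Y; Cramer's rule inverts
this linear system. -/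
theorem partialD_comp_iter (h : Sys r M G d D e) (n : ℕ) {Y : ℝ × ℝ → ℝ}
    (hY : Differentiable ℝ Y) (i : Fin 2) (z : ℝ × ℝ) :
    partialD i Y (G^[n] z) = vecD (pushCoef G n i) (fun z => Y (G^[n] z)) z := by
  have hJ := (h.det_iter_pos n z).ne'
  have hdet := h.det_eq n z
  have hi : i = 0 ∨ i = 1 := by omega
  simp only [vecD, pushCoef, partialD_comp hY (h.differentiable_iter n)]
  set J := (dIter G n z).det
  set a := partialD 0 (fun y => (G^[n] y).1) z
  set b := partialD 1 (fun y => (G^[n] y).1) z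
  set c := partialD 0 (fun y => (G^[n] y).2) z
  set f := partialD 1 (fun y => (G^[n] y).2) z
  have e1 : J * J⁻¹ = 1 := mul_inv_cancel₀ hJ
  rcases hi with rfl | rfl
  · simp only [if_true, one_ne_zero, if_false]
    calc _ = partialD 0 Y (G^[n] z) * (J * J⁻¹) := by rw [e1, mul_one]
      _ = partialD 0 Y (G^[n] z) * ((a * f - c * b) * J⁻¹) := by rw [hdet]
      _ = _ := by ring
  · simp only [if_true, one_ne_zero, if_false]
    calc _ = partialD 1 Y (G^[n] z) * (J * J⁻¹) := by rw [e1, mul_one]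
      _ = partialD 1 Y (G^[n] z) * ((a * f - c * b) * J⁻¹) := by rw [hdet]
      _ = _ := by ring

theorem partials_comp_iter (h : Sys r M G d D e) (n : ℕ) {Y : ℝ × ℝ → ℝ} :
    ∀ α : List (Fin 2), ContDiff ℝ α.length Y → ∀ z,
      partials α Y (G^[n] z) = vecDs (pushCoef G n) α (fun z => Y (G^[n] z)) z := by
  intro α
  induction α with
  | nil => exact fun _ _ => rfl
  | cons i α ih =>
    intro hY z
    have h1 := ih (hY.of_le (by simp))
    have hd := (contDiff_partials (m := 1) α hY).differentiable (by simp)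
    have h2 := h.partialD_comp_iter n hd i z
    simp only [h1] at h2
    exact h2

theorem pushCoef_periodic (h : Sys r M G d D e) (n : ℕ) (i j : Fin 2) (z : ℝ × ℝ) :
    pushCoef G n i j (z + (0, 1)) = pushCoef G n i j z := by
  have h1 : dIter G n (z + (0, 1)) = dIter G n z := by simpa using h.dIter_add_int n 0 1 z
  simp only [pushCoef, h.partialD_fst, h.partialD_snd, h1]

theorem det_inv_periodic (h : Sys r M G d D e) (n : ℕ) (z : ℝ × ℝ) :
    ((dIter G n (z + (0, 1))).det)⁻¹ = ((dIter G n z).det)⁻¹ := by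
  have h1 : dIter G n (z + (0, 1)) = dIter G n z := by simpa using h.dIter_add_int n 0 1 z
  rw [h1]

end Sys

/-- Uniform bounds for the coefficients. -/
theorem exists_Pl_pushCoef (r : ℕ) (M : ℝ) (n : ℕ) : ∃ K : ℝ, 0 ≤ K ∧
    ∀ {G : ℝ × ℝ → ℝ × ℝ} {d : HypConst} {D : ℕ} {e : ℤ}, Sys r M G d D e →
      Pl (r - 1) K (fun z => ((dIter G n z).det)⁻¹) ∧
      ∀ i j, Pl (r - 1) K (pushCoef G n i j) := by
  by_cases hM : 0 < M
  swap
  · exact ⟨0, le_rfl, fun {G d D e} h => absurd (zero_lt_one.trans_le h.one_le_M) hM⟩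
  obtain ⟨K, hK, hP⟩ := exists_Pl_iter r M n
  obtain ⟨C, hC, hinv⟩ := Pl.inv (r - 1) (K := 2 ^ (r - 1) * (K * K) + 2 ^ (r - 1) * (K * K))
    (by positivity) (δ := (2 * M ^ 2)⁻¹) (by positivity)
  refine ⟨C + 2 ^ (r - 1) * (K * C), by positivity, fun {G d D e} h => ?_⟩
  have hdet : Pl (r - 1) C (fun z => ((dIter G n z).det)⁻¹) := by
    refine hinv ?_ fun z => h.det_iter_ge n z
    simp only [h.det_eq]
    exact ((hP h 0).1.mul (hP h 1).2).sub ((hP h 0).2.mul (hP h 1).1)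
  have h0 : 0 ≤ 2 ^ (r - 1) * (K * C) := by positivity
  refine ⟨hdet.mono (by linarith), fun i j => ?_⟩
  have key : ∀ {f : ℝ × ℝ → ℝ}, Pl (r - 1) K f →
      Pl (r - 1) (C + 2 ^ (r - 1) * (K * C)) fun z => f z * ((dIter G n z).det)⁻¹ := fun hf =>
    (hf.mul hdet).mono (by linarith)
  have hi : i = 0 ∨ i = 1 := by omega
  have hj : j = 0 ∨ j = 1 := by omega
  unfold pushCoef
  rcases hi with rfl | rfl <;> rcases hj with rfl | rfl <;>
    simp only [if_true, one_ne_zero, if_false]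
  · exact key (hP h 1).2
  · exact key (hP h 0).2.neg
  · exact key (hP h 1).1.neg
  · exact key (hP h 0).1

namespace Chain

variable {r : ℕ} {M : ℝ} {G : ℝ × ℝ → ℝ × ℝ} {d : HypConst} {D : ℕ} {e : ℤ} {g η : ℕ → ℝ → ℝ}

/-- The left side is what remains of the conjugate of ∂_i after ∂₁ has been replaced by -g_n'∂₀. It
is a coordinate of DG^n(g_n', 1) = T'·(g₀'(T), 1), up to sign, divided by the determinant. Hence
each derivative in a pairing yields exactly one Jacobian. -/
theorem pushCoef_leading (h : Sys r M G d D e) (c : Chain r G d g η) (n : ℕ) (s : ℝ) (i : Fin 2) :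
    pushCoef G n i 0 (g n s, s) - deriv (g n) s * pushCoef G n i 1 (g n s, s) =
      (if i = 1 then -deriv (g 0) (climb η 0 n s) else 1) * jac G g η n 0 n s := by
  have ht := c.dIter_tangent h (zero_add n).symm s
  rw [h.dIter_apply] at ht
  have h1 := congrArg Prod.fst ht
  have h2 := congrArg Prod.snd ht
  simp only at h1 h2
  have hi : i = 0 ∨ i = 1 := by omega
  rcases hi with rfl | rfl
  · simp only [pushCoef, jac, if_true, one_ne_zero, if_false, zero_ne_one]
    rw [← h2]
    ring
  · simp only [pushCoef, jac, if_true, one_ne_zero, if_false]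
    rw [mul_div_assoc', neg_mul (deriv (g 0) _), ← h1]
    ring

theorem prod_pushCoef_leading (h : Sys r M G d D e) (c : Chain r G d g η) (n : ℕ) (s : ℝ)
    (α : List (Fin 2)) :
    (α.map fun i => pushCoef G n i 0 (g n s, s) -
        deriv (g n) s * pushCoef G n i 1 (g n s, s)).prod =
      (-deriv (g 0) (climb η 0 n s)) ^ α.count 1 * jac G g η n 0 n s ^ α.length := by
  simp only [c.pushCoef_leading h]
  induction α with
  | nil => simp
  | cons i α ih =>
    rw [List.map_cons, List.prod_cons, ih]
    have hi : i = 0 ∨ i = 1 := by omega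
    rcases hi with rfl | rfl
    · simp [pow_succ]; ring
    · simp [pow_succ]; ring

end Chain

namespace Sys

variable {r : ℕ} {M : ℝ} {G : ℝ × ℝ → ℝ × ℝ} {d : HypConst} {D : ℕ} {e : ℤ}

theorem integral_comp_circleDiffeo (h : Sys r M G d D e) {η : ℝ → ℝ} (hη : IsCircleDiffeo r η)
    {f : ℝ → ℝ} (hf : Continuous f) (hp : Function.Periodic f 1) :
    ∫ t in (0 : ℝ)..1, f t = ∫ s in (0 : ℝ)..1, f (η s) * deriv η s := by
  have hd := h.diff_diffeo hη
  have hc : Continuous (deriv η) := hη.1.continuous_deriv (by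
    have := h.two_le; exact_mod_cast (by omega : 1 ≤ r))
  have h1 := intervalIntegral.integral_comp_mul_deriv (a := (0 : ℝ)) (b := 1) (f := η)
    (f' := deriv η) (g := f) (fun s _ => (hd s).hasDerivAt) hc.continuousOn hf
  simp only [Function.comp] at h1
  rw [h1]
  have e1 : η 1 = η 0 + 1 := by simpa using hη.2.1 0
  rw [e1]
  have := hp.intervalIntegral_add_eq 0 (η 0)
  rwa [zero_add] at this

/-- Pairings of the iterated transfer operator as sums over the preimages of the curve. -/
theorem pairing_transfer (h : Sys r M G d D e) {F : Torus → Torus} (hF : IsLift r F G)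
    {g₀ : ℝ → ℝ} {g η : ℕ → ℕ → ℝ → ℝ} (c : ∀ j, Chain r G d (g j) (η j))
    (h0 : ∀ j t, g j 0 t = g₀ t + j) (n : ℕ) {u : Torus → ℝ} (hu : IsCk (r - 1) u)
    (α : List (Fin 2)) (hα : α.length ≤ r - 1) {ψ : ℝ → ℝ} (hψ : Continuous ψ)
    (hp : Function.Periodic ψ 1) :
    ∫ t in (0 : ℝ)..1, ψ t * partials α (fun z => (transfer F G)^[n] u (proj z)) (g₀ t, t) =
      ∑ j ∈ Finset.range (D ^ n), ∫ s in (0 : ℝ)..1,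
        (ψ (climb (η j) 0 n s) * deriv (climb (η j) 0 n) s) *
          vecDs (pushCoef G n) α (fun z => ((dIter G n z).det)⁻¹ * partials [] (fun z => u (proj z)) z)
            (g j n s, s) := by
  obtain ⟨H, hH, hl, hr⟩ := h.exists_inverse
  have hl' := Function.LeftInverse.iterate (g := H) (f := G) hl n
  have hr' := Function.RightInverse.iterate (f := G) (g := H) hr n
  -- The density of one branch on the plane; the others are its translates, so each pairing is one
  -- of Y along a translated curve.
  set Y : ℝ × ℝ → ℝ := fun z => u (proj (H^[n] z)) / (dIter G n (H^[n] z)).det with hY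
  have hYs : ContDiff ℝ (r - 1 : ℕ) Y := h.contDiff_branch hH n hu
  have hYα : ContDiff ℝ α.length Y := hYs.of_le (by exact_mod_cast hα)
  have hYp : ∀ z, Y (z + (0, 1)) = Y z := by
    intro z
    have e1 : H^[n] (z + (0, 1)) = H^[n] z + (0, 1) := by
      apply h.bijective.1.iterate n
      obtain ⟨E, hE⟩ := h.exists_iter_add_int n
      have := hE 0 1 (H^[n] z)
      simp only [Int.cast_zero, Int.cast_one, mul_zero, zero_add] at this
      rw [this, hr', hr']
    have e2 := h.dIter_add_int n 0 1 (H^[n] z)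
    have e3 := proj_add_int (H^[n] z) 0 1
    simp only [Int.cast_zero, Int.cast_one] at e2 e3
    simp only [hY, e1, e2, e3]
  -- The empty word is written out to match the shape A·∂^βU of `Tested.exists_leading`.
  have hYP : (fun z => Y (G^[n] z)) =
      fun z => ((dIter G n z).det)⁻¹ * partials [] (fun z => u (proj z)) z := by
    ext z
    simp only [hY, hl' z, partials]
    rw [div_eq_inv_mul]
  have hsum : partials α (fun z => (transfer F G)^[n] u (proj z)) =
      fun z => ∑ j ∈ Finset.range (D ^ n), partials α Y (z + ((j : ℝ), 0)) := by
    have e1 : (fun z => (transfer F G)^[n] u (proj z)) =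
        fun z => ∑ j ∈ Finset.range (D ^ n), Y (z + ((j : ℝ), 0)) :=
      funext fun z => h.transfer_iterate_proj hF hl hr n u z
    rw [e1, partials_sum (f := fun (j : ℕ) z => Y (z + ((j : ℝ), 0))) _ α fun j _ =>
      hYα.comp (contDiff_id.add contDiff_const)]
    ext z
    exact Finset.sum_congr rfl fun j _ => by rw [partials_comp_add]
  have hYc : Continuous (partials α Y) :=
    (contDiff_partials (m := 0) α (by simpa using hYα)).continuous
  have hgc : ∀ j, Continuous (g j 0) := fun j => ((c j).graph 0).smooth.continuous
  have hfc : ∀ j, Continuous fun t => ψ t * partials α Y (g j 0 t, t) := fun j =>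
    hψ.mul (hYc.comp ((hgc j).prodMk continuous_id))
  rw [hsum]
  have e4 : ∀ j : ℕ, ∀ t, (g₀ t, t) + ((j : ℝ), (0 : ℝ)) = (g j 0 t, t) := fun j t => by
    rw [h0]; simp
  simp only [e4, Finset.mul_sum]
  rw [intervalIntegral.integral_finsetSum fun j _ => (hfc j).intervalIntegrable _ _]
  refine Finset.sum_congr rfl fun j _ => ?_
  have hfp : Function.Periodic (fun t => ψ t * partials α Y (g j 0 t, t)) 1 := by
    intro t
    have e5 := partials_periodic hYp α (g j 0 t, t)
    have e6 : (g j 0 t, t) + (0, 1) = (g j 0 (t + 1), t + 1) := by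
      rw [((c j).graph 0).periodic]; simp
    rw [e6] at e5
    simp only [hp t, e5]
  rw [h.integral_comp_circleDiffeo ((c j).isCircleDiffeo_climb h n 0) (hfc j) hfp]
  congr 1
  ext s
  rw [← (c j).iter_map n (zero_add n).symm s, h.partials_comp_iter n α hYα, hYP]
  ring

end Sys

end SVPH

/-! ### The branches over an admissible curve and their test functions -/

namespace SVPH

theorem Sc.scale_one {N : ℕ} : ∀ {K R : ℝ} {f : ℝ → ℝ}, Sc N K R f → 1 ≤ R →
    Sc N (K * R ^ N) 1 f := by
  induction N with
  | zero => intro K R f h _; simpa using ⟨h.1, h.2⟩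
  | succ N ih =>
    intro K R f h hR
    have hK := h.nonneg
    refine ⟨h.1, fun s => (h.2.1 s).trans (le_mul_of_one_le_right hK (one_le_pow₀ hR)), ?_⟩
    refine (ih h.2.2 hR).mono (le_of_eq ?_) zero_le_one
    ring

theorem geomS_le {μ : ℝ} (hμ : 1 ≤ μ) (n : ℕ) : geomS μ n ≤ n * μ ^ n := by
  refine (Finset.sum_le_card_nsmul _ _ (μ ^ n) fun k hk => ?_).trans (le_of_eq (by simp))
  exact pow_le_pow_right₀ hμ (Finset.mem_range.1 hk).le

/-- The derivatives of the preimages of the curves of `Γ_r(c)` are under control, and the preimages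
of order `n` are in `Γ_r(c)` again. -/
structure Admissible (r : ℕ) (K c : ℝ) (n : ℕ) (G : ℝ × ℝ → ℝ × ℝ) (d : HypConst) : Prop where
  one_le : 1 ≤ K
  one_le_c : 1 ≤ c
  bound : ∀ {g η : ℕ → ℝ → ℝ}, Chain r G d g η →
    (∀ i, 2 ≤ i → i ≤ r → ∀ s, |iteratedDeriv i (g 0) s| ≤ c ^ (i - 1)!) →
    ∀ i, 2 ≤ i → i ≤ r → ∀ m s, |iteratedDeriv i (g m) s| ≤ K * c ^ (i - 1)!
  inv : ∀ {g η : ℕ → ℝ → ℝ}, Chain r G d g η →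
    (∀ i, 2 ≤ i → i ≤ r → ∀ s, |iteratedDeriv i (g 0) s| ≤ c ^ (i - 1)!) →
    ∀ i, 2 ≤ i → i ≤ r → ∀ s, |iteratedDeriv i (g n) s| ≤ c ^ (i - 1)!

/-- The branches over a curve, with all their bounds. -/
structure Branches (r : ℕ) (K c : ℝ) (n : ℕ) (G : ℝ × ℝ → ℝ × ℝ) (d : HypConst) (g₀ : ℝ → ℝ)
    (g η : ℕ → ℕ → ℝ → ℝ) : Prop where
  central : CentralGraph r d.χc g₀
  chain : ∀ j, Chain r G d (g j) (η j)
  start : ∀ j t, g j 0 t = g₀ t + j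
  class_deriv : ∀ j k ρ, ρ + 1 ≤ r → Sc ρ K (c ^ ρ !) (deriv (g j k))
  second : ∀ j k s, |deriv (deriv (g j k)) s| ≤ K * c
  mem : ∀ j, (fun s => (g j n s, s)) ∈ Gam r d.χc r c

namespace Sys

variable {r : ℕ} {M : ℝ} {G : ℝ × ℝ → ℝ × ℝ} {d : HypConst} {D : ℕ} {e : ℤ}

theorem exists_branches (h : Sys r M G d D e) {K c : ℝ} {n : ℕ} (ha : Admissible r K c n G d)
    {γ : ℝ → ℝ × ℝ} (hγ : γ ∈ Gam r d.χc r c) : ∃ g₀ g η,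
      γ = (fun t => (g₀ t, t)) ∧ Branches r K c n G d g₀ g η := by
  obtain ⟨g₀, rfl⟩ : ∃ g₀ : ℝ → ℝ, γ = fun t => (g₀ t, t) := ⟨_, eq_graph_of_mem_Gam hγ⟩
  obtain ⟨hg, hb⟩ := (graph_mem_Gam_iff h.r_ne le_rfl).1 hγ
  obtain ⟨g, η, ch, h0⟩ := h.exists_chains hg
  have hst : ∀ j i, 2 ≤ i → i ≤ r → ∀ s, |iteratedDeriv i (g j 0) s| ≤ c ^ (i - 1)! := by
    intro j i hi hi' s
    rw [show g j 0 = fun t => g₀ t + j from funext (h0 j), iteratedDeriv_add_const (by omega)]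
    exact hb i hi hi' s
  refine ⟨g₀, g, η, rfl, hg, ch, h0, fun j k ρ hρ => ?_, fun j k s => ?_, fun j => ?_⟩
  · have hs : ContDiff ℝ ((ρ : WithTop ℕ∞) + 1) (g j k) :=
      ((ch j).graph k).smooth.of_le (by exact_mod_cast hρ)
    refine Sc.of_contDiff (contDiff_succ_iff_deriv.1 hs).2.2 fun i hi s => ?_
    rw [← iteratedDeriv_succ']
    rcases Nat.eq_zero_or_pos i with rfl | hi0
    · rw [iteratedDeriv_one, pow_zero, mul_one]
      exact (h.slope_le_one ((ch j).graph k) s).trans ha.one_le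
    · refine (ha.bound (ch j) (hst j) (i + 1) (by omega) (by omega) k s).trans ?_
      refine mul_le_mul_of_nonneg_left ?_ (zero_le_one.trans ha.one_le)
      -- The natural bound c^{i!} fits the single scale c^{ρ!}, because i! ≤ ρ!·i for 1 ≤ i ≤ ρ.
      rw [Nat.add_sub_cancel, ← pow_mul]
      refine pow_le_pow_right₀ ha.one_le_c ((Nat.factorial_le hi).trans ?_)
      exact Nat.le_mul_of_pos_right _ hi0
  · have := ha.bound (ch j) (hst j) 2 le_rfl h.two_le k s
    simpa [iteratedDeriv_succ, iteratedDeriv_zero] using this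
  · exact (graph_mem_Gam_iff h.r_ne le_rfl).2 ⟨(ch j).graph n, ha.inv (ch j) (hst j)⟩

/-- D is the increment of f over one horizontal period. -/
theorem D_le (h : Sys r M G d D e) : (D : ℝ) ≤ M := by
  have h1 := Convex.norm_image_sub_le_of_norm_hasDerivWithin_le (f := fun x => (G (x, 0)).1)
    (f' := fun x => partialD 0 (fun y => (G y).1) (x, 0)) (s := Set.univ) (C := M) (x := 0) (y := 1)
    (fun x _ => by
      have h1 : DifferentiableAt ℝ (fun y => (G y).1) (x, 0) := (h.differentiable _).fst
      exact (h1.hasFDerivAt.comp_hasDerivAt (f := fun x : ℝ => (x, (0 : ℝ))) x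
        ((hasDerivAt_id x).prodMk (hasDerivAt_const x (0 : ℝ)))).hasDerivWithinAt)
    (fun x _ => (h.Pl_partialD 0).1.bound _) convex_univ trivial trivial
  have h2 := h.add_e₁ (0, 0)
  simp only [Prod.mk_add_mk, zero_add] at h2
  rw [h2] at h1
  simpa using h1

theorem geomS_le_of_sys (h : Sys r M G d D e) (n : ℕ) : geomS d.μ n ≤ n * (2 * M ^ 2) ^ n := by
  refine (geomS_le h.one_lt_μ.le n).trans ?_
  have := h.μ_le_lm.trans h.lm_le
  have := h.μ_pos
  gcongr

end Sys

namespace Branches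

variable {r : ℕ} {M : ℝ} {G : ℝ × ℝ → ℝ × ℝ} {d : HypConst} {D : ℕ} {e : ℤ}
  {K c : ℝ} {n : ℕ} {g₀ : ℝ → ℝ} {g η : ℕ → ℕ → ℝ → ℝ}

/-- The endpoints of the chains are in Γ_r(c) again, so pairings along them are controlled by the
geometric norms themselves. The factor 2^r pays for passing from the class of a test function to its
weighted norm. -/
theorem tested (h : Sys r M G d D e) (b : Branches r K c n G d g₀ g η) (hc : 1 ≤ c)
    {u : Torus → ℝ} (hu : IsCk (r - 1) u) (j : ℕ) :
    Tested (r - 1) (K * (c ^ (r - 1)!) ^ (r - 1)) (fun z => u (proj z)) (g j n)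
      (fun k => 2 ^ r * geomNorm r d.χc c k u) := by
  have hr := h.two_le
  refine ⟨hu, fun z => ?_, h.diff_graph ((b.chain j).graph n), ((b.chain j).graph n).periodic,
    (b.class_deriv j n (r - 1) (by omega)).scale_one (one_le_pow₀ hc), fun i k hik hk => ?_,
    fun k hk => ?_, fun β hβ χ X hp hχ => ?_⟩
  · have := proj_add_int z 0 1
    simp only [Int.cast_zero, Int.cast_one] at this
    rw [this]
  · have := geomNorm_mono (χ := d.χc) (c := c) hu hik hk
    gcongr
  · have := geomNorm_nonneg (χ := d.χc) (c := c) hu hk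
    positivity
  · refine (abs_pairing_le hu hβ le_rfl (b.mem j) hχ.contDiff hp).trans ?_
    have h1 := circleNorm_le hχ le_rfl
    rw [one_pow, mul_one] at h1
    have h2 : (2 : ℝ) ^ (β.length + 1) ≤ 2 ^ r := pow_le_pow_right₀ one_le_two (by omega)
    have h3 := geomNorm_nonneg (χ := d.χc) (c := c) hu hβ
    have hX := hχ.nonneg
    calc _ ≤ 2 ^ r * X * geomNorm r d.χc c β.length u := by
          refine mul_le_mul_of_nonneg_right (h1.trans ?_) h3
          gcongr
      _ = _ := by ring

end Branches

/-- The classes of the test functions obtained by the change of variables. -/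
theorem exists_pulled_test_class (r : ℕ) (M : ℝ) {K c : ℝ} (hK : 1 ≤ K) (hc : 1 ≤ c) {n : ℕ}
    (hn : 1 ≤ n) (k : ℕ) (hk : k + 1 ≤ r) : ∃ X : ℝ, 0 ≤ X ∧
    ∀ {G : ℝ × ℝ → ℝ × ℝ} {d : HypConst} {D : ℕ} {e : ℤ} {g₀ : ℝ → ℝ} {g η : ℕ → ℕ → ℝ → ℝ},
      Sys r M G d D e → Branches r K c n G d g₀ g η → ∀ (j : ℕ) {ψ : ℝ → ℝ}, Sc k 1 1 ψ →
      Sc k X 1 fun s => ψ (climb (η j) 0 n s) * deriv (climb (η j) 0 n) s := by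
  obtain ⟨C, hC, hcl⟩ := Chain.exists_climb_class r M K (zero_le_one.trans hK) k hk
  -- A bound for the geometric sum by n and M alone: the constant of the remainder may depend on n
  -- and c, but not on μ.
  set Sn : ℝ := n * (2 * M ^ 2) ^ n with hSn
  have hSn0 : 0 ≤ Sn := by positivity
  have hB : (1 : ℝ) ≤ c ^ k ! := one_le_pow₀ hc
  have hB0 := zero_le_one.trans hB
  set T := C * Sn * (c ^ k ! * Sn ^ 2) ^ k with hT
  have hT0 : 0 ≤ T := by positivity
  obtain ⟨C', hC', hcomp⟩ := Sc.comp k (Q := max 1 T) (le_max_left _ _)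
  refine ⟨2 ^ k * (C' * 1 * T), by positivity, fun {G d D e g₀ g η} h b j ψ hψ => ?_⟩
  have hS := one_le_geomS h.one_lt_μ.le hn
  have hSS := h.geomS_le_of_sys n
  have h1 := hcl h (b.chain j) hB (fun m => b.class_deriv j m k hk) hn 0 n (zero_add n)
  have hS0 := zero_le_one.trans hS
  have h2 : Sc k T 1 (deriv (climb (η j) 0 n)) := by
    refine (h1.scale_one (one_le_mul_of_one_le_of_one_le hB (one_le_pow₀ hS))).mono ?_ zero_le_one
    rw [hT, hSn]
    gcongr
  have h3 := hcomp hψ (h.diff_diffeo ((b.chain j).isCircleDiffeo_climb h n 0))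
    (fun m hm => h2.of_le hm.le) zero_le_one zero_le_one (by
      rw [one_mul, mul_one]; exact le_max_right _ _)
  exact h3.mul h2

/-- The pulled back test functions of the leading terms. -/
theorem exists_leading_test_class (r : ℕ) (M : ℝ) {K : ℝ} (hK : 1 ≤ K) (k : ℕ) (hk : k + 1 ≤ r) :
    ∃ C : ℝ, 0 ≤ C ∧
    ∀ {c : ℝ} {n : ℕ} {G : ℝ × ℝ → ℝ × ℝ} {d : HypConst} {D : ℕ} {e : ℤ} {g₀ : ℝ → ℝ}
      {g η : ℕ → ℕ → ℝ → ℝ},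
      1 ≤ c → 1 ≤ n → Sys r M G d D e → Branches r K c n G d g₀ g η → ∀ (j : ℕ) {ψ : ℝ → ℝ},
      Sc k 1 1 ψ → ∀ m ≤ k, ∀ {P : ℝ}, (∀ s, jac G (g j) (η j) n 0 n s ≤ P) →
      Sc k (C * P * ((d.lm ^ n)⁻¹) ^ k) (c ^ k ! * geomS d.μ n ^ 2) fun s =>
        ψ (climb (η j) 0 n s) * (-deriv (g j 0) (climb (η j) 0 n s)) ^ m *
          (jac G (g j) (η j) n 0 n s * jac G (g j) (η j) n 0 n s ^ k) := by
  obtain ⟨C, hC, hcl⟩ := Chain.exists_climb_class r M K (zero_le_one.trans hK) k hk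
  obtain ⟨C₁, hC₁, hcomp⟩ := Sc.comp k (Q := max 1 C) (le_max_left _ _)
  obtain ⟨C₂, hC₂, hjac⟩ := Chain.exists_jac_class r M K (zero_le_one.trans hK) k hk
  have hC₁0 := zero_le_one.trans hC₁
  have hC₂0 := zero_le_one.trans hC₂
  have hK0 := zero_le_one.trans hK
  refine ⟨2 ^ k * ((2 ^ k * (C₁ * 1 * (2 ^ k * (C₁ * K)) ^ k)) *
    (2 ^ k * (C₂ * (2 ^ k * (C₂ * (2 * M ^ 2))) ^ k))), by positivity,
    fun {c n G d D e g₀ g η} hc hn h b j ψ hψ m hm P hP => ?_⟩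
  have hB : (1 : ℝ) ≤ c ^ k ! := one_le_pow₀ hc
  have hB0 := zero_le_one.trans hB
  have hS := one_le_geomS h.one_lt_μ.le hn
  set S := geomS d.μ n with hSd
  have hS0 := zero_le_one.trans hS
  have hR : 0 ≤ c ^ k ! * S ^ 2 := by positivity
  have hcls := fun p => b.class_deriv j p k hk
  have hT := hcl h (b.chain j) hB hcls hn 0 n (zero_add n)
  rw [← hSd] at hT
  have hTd := h.diff_diffeo ((b.chain j).isCircleDiffeo_climb h n 0)
  have hBT : c ^ k ! * (C * S) ≤ max 1 C * (c ^ k ! * S ^ 2) := by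
    calc c ^ k ! * (C * S) = C * (c ^ k ! * S) * 1 := by ring
      _ ≤ max 1 C * (c ^ k ! * S) * S := by
          have := le_max_right 1 C
          gcongr
      _ = _ := by ring
  have f1 := hcomp (hψ.mono_scale hB zero_le_one) hTd (fun p hp => hT.of_le hp.le) hB0 hR hBT
  have f2 := (hcomp (hcls 0) hTd (fun p hp => hT.of_le hp.le) hB0 hR hBT).neg.pow hR m
  have hlm := pow_pos h.lm_pos n
  have hself := (b.chain j).hasDerivAt_jac_self h
  -- One of the k + 1 Jacobians keeps the bound P of its own branch, to be summed later; the other k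
  -- receive the uniform bound 2M²λ₋^{-n} in `f4`.
  have f3 := hjac h (b.chain j) hB hcls hself hn hP
  have f4 := hjac h (b.chain j) hB hcls hself hn (P := 2 * M ^ 2 * (d.lm ^ n)⁻¹) fun s => by
    rw [← div_eq_mul_inv, le_div_iff₀ hlm]
    exact ((b.chain j).jac_le h (zero_add n).symm s).2
  have f2' : Sc k ((2 ^ k * (C₁ * K)) ^ k) (c ^ k ! * S ^ 2)
      fun s => (-deriv (g j 0) (climb (η j) 0 n s)) ^ m := by
    refine f2.mono (pow_le_pow_right₀ ?_ hm) hR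
    exact one_le_mul_of_one_le_of_one_le (one_le_pow₀ one_le_two)
      (one_le_mul_of_one_le_of_one_le hC₁ hK)
  refine ((f1.mul f2').mul (f3.mul (f4.pow hR k))).mono (le_of_eq ?_) hR
  simp only [mul_pow]
  ring

end SVPH

namespace SVPH

/-! ### Bounds for the iterated transfer operator -/

/-- Summing a uniform bound over the preimages. -/
theorem Sys.sum_const_le {r : ℕ} {M : ℝ} {G : ℝ × ℝ → ℝ × ℝ} {d : HypConst} {D : ℕ} {e : ℤ}
    (h : Sys r M G d D e) (n : ℕ) {a : ℕ → ℝ} {E : ℝ} (hE : 0 ≤ E) (ha : ∀ j, a j ≤ E) :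
    ∑ j ∈ Finset.range (D ^ n), a j ≤ M ^ n * E := by
  refine (Finset.sum_le_card_nsmul _ _ E fun j _ => ha j).trans ?_
  rw [Finset.card_range, nsmul_eq_mul]
  have := h.D_le
  push_cast
  gcongr

/-- All branches, at most M^n in number, are estimated separately. The dependence on n is harmless,
since the bound is applied to words shorter than ρ, which only contribute to ‖u‖_{ρ-1}. -/
theorem exists_crude_pairing (r : ℕ) (M : ℝ) {K c : ℝ} (hK : 1 ≤ K) (hc : 1 ≤ c) {n : ℕ}
    (hn : 1 ≤ n) (k : ℕ) (hk : k + 1 ≤ r) : ∃ E : ℝ, 0 ≤ E ∧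
    ∀ {F : Torus → Torus} {G : ℝ × ℝ → ℝ × ℝ} {d : HypConst} {D : ℕ} {e : ℤ},
      Sys r M G d D e → IsLift r F G → Admissible r K c n G d →
      ∀ {u : Torus → ℝ}, IsCk (r - 1) u → ∀ α : List (Fin 2), α.length = k →
      ∀ γ ∈ Gam r d.χc r c, ∀ {ψ : ℝ → ℝ}, Function.Periodic ψ 1 → Sc k 1 1 ψ →
      |∫ t in (0 : ℝ)..1, ψ t * partials α (fun z => (transfer F G)^[n] u (proj z)) (γ t)| ≤
        E * geomNorm r d.χc c k u := by
  -- A system forces M ≥ 1, so a negative M leaves nothing to prove; the constants below are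
  -- nonnegative only for M ≥ 0.
  by_cases hM : 0 ≤ M
  swap
  · exact ⟨0, le_rfl, fun {F G d D e} h => absurd (zero_le_one.trans h.one_le_M) hM⟩
  have hT : 0 ≤ K * (c ^ (r - 1)!) ^ (r - 1) := by positivity
  obtain ⟨Km, hKm, hcoef⟩ := exists_Pl_pushCoef r M n
  obtain ⟨C, hC, hcr⟩ := Tested.exists_crude (r - 1) hT hKm k hKm
  obtain ⟨X, hX, hχ⟩ := exists_pulled_test_class r M hK hc hn k hk
  refine ⟨M ^ n * (C * (X * 2 ^ r)), by positivity,
    fun {F G d D e} h hF ha {u} hu α hα γ hγ {ψ} hp hψ => ?_⟩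
  obtain ⟨g₀, g, η, rfl, b⟩ := h.exists_branches ha hγ
  rw [h.pairing_transfer hF b.chain b.start n hu α (by omega) hψ.continuous hp]
  refine (Finset.abs_sum_le_sum_abs _ _).trans ?_
  have hg := geomNorm_nonneg (χ := d.χc) (c := c) hu (by omega : k ≤ r - 1)
  rw [mul_assoc]
  refine h.sum_const_le n (by positivity) fun j => ?_
  have h1 := hcr (b.tested h hc hu j) (hcoef h).2 (h.pushCoef_periodic n) α [] hα
    (by simp; omega) (A := fun z => ((dIter G n z).det)⁻¹)
    ((hcoef h).1.of_le (by simp; omega)) (h.det_inv_periodic n) _ X (fun s => ?_) (hχ h b j hψ)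
  · refine h1.trans (le_of_eq ?_)
    rw [List.length_nil, add_zero]
    ring
  · have hd := (b.chain j).isCircleDiffeo_climb h n 0
    simp only [hd.2.1, hp _, (b.chain j).deriv_climb_periodic h]

/-- The sum of the leading terms over all the preimages. -/
theorem exists_sum_leading (r : ℕ) (M : ℝ) {K : ℝ} (hK : 1 ≤ K) (k : ℕ) (hk : k + 1 ≤ r) :
    ∃ C : ℝ, 0 ≤ C ∧
    ∀ {c : ℝ} {n : ℕ} {G : ℝ × ℝ → ℝ × ℝ} {d : HypConst} {D : ℕ} {e : ℤ} {g₀ : ℝ → ℝ}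
      {g η : ℕ → ℕ → ℝ → ℝ},
      1 ≤ c → 1 ≤ n → Sys r M G d D e → Branches r K c n G d g₀ g η →
      ∀ {u : Torus → ℝ}, IsCk (r - 1) u → ∀ {ψ : ℝ → ℝ}, Function.Periodic ψ 1 → Sc k 1 1 ψ →
      ∀ m ≤ k, ∀ β : List (Fin 2), β.length = k →
      ∑ j ∈ Finset.range (D ^ n), |∫ s in (0 : ℝ)..1,
        (ψ (climb (η j) 0 n s) * (-deriv (g j 0) (climb (η j) 0 n s)) ^ m *
          (jac G (g j) (η j) n 0 n s * jac G (g j) (η j) n 0 n s ^ k)) *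
            partials β (fun z => u (proj z)) (g j n s, s)| ≤
        C * ((1 + CF r G d * c) * c ^ (k ! * k) * geomS d.μ n ^ (2 * k + 1) / d.lm ^ (k * n)) *
          geomNorm r d.χc c k u := by
  by_cases hM : 0 ≤ M
  swap
  · exact ⟨0, le_rfl, fun {c n G d D e g₀ g η} _ _ h => absurd (zero_le_one.trans h.one_le_M) hM⟩
  obtain ⟨C, hC, hcl⟩ := exists_leading_test_class r M hK k hk
  refine ⟨2 ^ (k + 1) * C * (9 * M ^ 4 * K * (M * (2 + 80 * M ^ 7))), by positivity,
    fun {c n G d D e g₀ g η} hc hn h b {u} hu {ψ} hp hψ m hm β hβ => ?_⟩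
  obtain ⟨P, hjP, hP0, hPsum⟩ := h.exists_jac_sup b.central b.chain b.start hK
    (zero_le_one.trans hc) b.second hn
  have hS := one_le_geomS h.one_lt_μ.le hn
  set S := geomS d.μ n with hSd
  have hS0 := zero_le_one.trans hS
  have hlm := h.lm_pos
  have hg := geomNorm_nonneg (χ := d.χc) (c := c) hu (by omega : k ≤ r - 1)
  have hR : 1 ≤ c ^ k ! * S ^ 2 :=
    one_le_mul_of_one_le_of_one_le (one_le_pow₀ hc) (one_le_pow₀ hS)
  -- What remains of the bound on one branch after removal of its factor P j, with the test function
  -- measured at scale c^{k!}S².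
  set Q := 2 ^ (k + 1) * C * ((d.lm ^ n)⁻¹) ^ k * (c ^ k ! * S ^ 2) ^ k *
    geomNorm r d.χc c k u with hQ
  have hQ0 : 0 ≤ Q := by positivity
  have hterm : ∀ j, |∫ s in (0 : ℝ)..1,
        (ψ (climb (η j) 0 n s) * (-deriv (g j 0) (climb (η j) 0 n s)) ^ m *
          (jac G (g j) (η j) n 0 n s * jac G (g j) (η j) n 0 n s ^ k)) *
            partials β (fun z => u (proj z)) (g j n s, s)| ≤ P j * Q := by
    intro j
    have hΦ := hcl hc hn h b j hψ m hm (hjP j)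
    have hd := (b.chain j).isCircleDiffeo_climb h n 0
    have hgp : Function.Periodic (deriv (g j 0)) 1 :=
      periodic_deriv ((b.chain j).graph 0).periodic
    have hjp := (b.chain j).jac_periodic h n 0 n
    have h1 := abs_pairing_le (c := c) (χ := d.χc) hu (by omega : k ≤ r - 1) hβ.le (b.mem j)
      (ψ := fun s => ψ (climb (η j) 0 n s) * (-deriv (g j 0) (climb (η j) 0 n s)) ^ m *
        (jac G (g j) (η j) n 0 n s * jac G (g j) (η j) n 0 n s ^ k))
      (by rw [hβ]; exact hΦ.contDiff) (fun s => by simp only [hd.2.1, hp _, hjp _, hgp _])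
    refine h1.trans ?_
    rw [hβ]
    refine (mul_le_mul_of_nonneg_right (circleNorm_le hΦ hR) hg).trans (le_of_eq ?_)
    rw [hQ]
    ring
  refine (Finset.sum_le_sum fun j _ => hterm j).trans ?_
  rw [← Finset.sum_mul]
  refine (mul_le_mul_of_nonneg_right hPsum hQ0).trans (le_of_eq ?_)
  rw [hQ, inv_pow, ← pow_mul, mul_comm n k, mul_pow, ← pow_mul, ← pow_mul]
  field_simp
  ring

/-- Each branch is compared with its leading term. The leading terms are summed with the sharp bound
of `exists_sum_leading`, which is uniform in n; the differences involve only k - 1 derivatives of u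
and may be summed crudely. -/
theorem exists_main_pairing (r : ℕ) (M : ℝ) {K : ℝ} (hK : 1 ≤ K) (k : ℕ) (hk : k + 1 ≤ r) :
    ∃ C : ℝ, 0 ≤ C ∧ ∀ {c : ℝ} {n : ℕ}, 1 ≤ c → 1 ≤ n → ∃ E : ℝ, 0 ≤ E ∧
    ∀ {F : Torus → Torus} {G : ℝ × ℝ → ℝ × ℝ} {d : HypConst} {D : ℕ} {e : ℤ},
      Sys r M G d D e → IsLift r F G → Admissible r K c n G d →
      ∀ {u : Torus → ℝ}, IsCk (r - 1) u → ∀ α : List (Fin 2), α.length = k →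
      ∀ γ ∈ Gam r d.χc r c, ∀ {ψ : ℝ → ℝ}, Function.Periodic ψ 1 → Sc k 1 1 ψ →
      |∫ t in (0 : ℝ)..1, ψ t * partials α (fun z => (transfer F G)^[n] u (proj z)) (γ t)| ≤
        C * ((1 + CF r G d * c) * c ^ (k ! * k) * geomS d.μ n ^ (2 * k + 1) / d.lm ^ (k * n)) *
          geomNorm r d.χc c k u + E * geomNorm r d.χc c (k - 1) u := by
  by_cases hM : 0 ≤ M
  swap
  · exact ⟨0, le_rfl, fun {c n} _ _ => ⟨0, le_rfl, fun {F G d D e} h =>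
      absurd (zero_le_one.trans h.one_le_M) hM⟩⟩
  obtain ⟨C, hC, hlead⟩ := exists_sum_leading r M hK k hk
  refine ⟨C, hC, fun {c n} hc hn => ?_⟩
  have hT : 0 ≤ K * (c ^ (r - 1)!) ^ (r - 1) := by positivity
  obtain ⟨Km, hKm, hcoef⟩ := exists_Pl_pushCoef r M n
  obtain ⟨C₁, hC₁, hld⟩ := Tested.exists_leading (r - 1) hT hKm k hKm
  obtain ⟨X, hX, hχ⟩ := exists_pulled_test_class r M hK hc hn k hk
  refine ⟨M ^ n * (C₁ * (X * 2 ^ r)), by positivity,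
    fun {F G d D e} h hF ha {u} hu α hα γ hγ {ψ} hp hψ => ?_⟩
  obtain ⟨g₀, g, η, rfl, b⟩ := h.exists_branches ha hγ
  rw [h.pairing_transfer hF b.chain b.start n hu α (by omega) hψ.continuous hp]
  have hg := geomNorm_nonneg (χ := d.χc) (c := c) hu (by omega : k - 1 ≤ r - 1)
  have hm : α.count 1 ≤ k := hα ▸ List.count_le_length
  have hL := hlead hc hn h b hu hp hψ (α.count 1) hm (List.replicate k 0) (by simp)
  -- In the leading term the density 1/det combines with T' into one Jacobian, and the k operators
  -- supply the other k.
  have hdiff : ∀ j, |∫ s in (0 : ℝ)..1,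
      (ψ (climb (η j) 0 n s) * deriv (climb (η j) 0 n) s) *
        vecDs (pushCoef G n) α (fun z => ((dIter G n z).det)⁻¹ * partials [] (fun z => u (proj z)) z)
          (g j n s, s)| - |∫ s in (0 : ℝ)..1,
        (ψ (climb (η j) 0 n s) * (-deriv (g j 0) (climb (η j) 0 n s)) ^ α.count 1 *
          (jac G (g j) (η j) n 0 n s * jac G (g j) (η j) n 0 n s ^ k)) *
            partials (List.replicate k 0) (fun z => u (proj z)) (g j n s, s)| ≤
      C₁ * (X * 2 ^ r) * geomNorm r d.χc c (k - 1) u := by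
    intro j
    refine (abs_sub_abs_le_abs_sub _ _).trans ?_
    have h1 := hld (b.tested h hc hu j) (hcoef h).2 (h.pushCoef_periodic n) α [] hα
      (by simp; omega) (A := fun z => ((dIter G n z).det)⁻¹)
      ((hcoef h).1.of_le (by simp; omega)) (h.det_inv_periodic n) _ X (fun s => ?_) (hχ h b j hψ)
    · refine le_trans (le_of_eq ?_) (h1.trans (le_of_eq ?_))
      · congr 2
        congr 1
        ext s
        rw [(b.chain j).prod_pushCoef_leading h, hα]
        simp only [jac, List.count_nil, pow_zero, mul_one, List.length_nil, add_zero]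
        ring
      · rw [List.length_nil, add_zero]
        ring
    · have hd := (b.chain j).isCircleDiffeo_climb h n 0
      simp only [hd.2.1, hp _, (b.chain j).deriv_climb_periodic h]
  refine (Finset.abs_sum_le_sum_abs _ _).trans ?_
  have hE := h.sum_const_le n (by positivity) hdiff
  rw [Finset.sum_sub_distrib] at hE
  rw [mul_assoc (M ^ n)]
  linarith

/-- For the empty word the pairing is its own leading term, so no remainder appears and the constant
is uniform in n. -/
theorem exists_zero_pairing (r : ℕ) (M : ℝ) {K : ℝ} (hK : 1 ≤ K) (hr : 1 ≤ r) :
    ∃ C : ℝ, 0 ≤ C ∧ ∀ {c : ℝ} {n : ℕ}, 1 ≤ c → 1 ≤ n →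
    ∀ {F : Torus → Torus} {G : ℝ × ℝ → ℝ × ℝ} {d : HypConst} {D : ℕ} {e : ℤ},
      Sys r M G d D e → IsLift r F G → Admissible r K c n G d →
      ∀ {u : Torus → ℝ}, IsCk (r - 1) u →
      ∀ γ ∈ Gam r d.χc r c, ∀ {ψ : ℝ → ℝ}, Function.Periodic ψ 1 → Sc 0 1 1 ψ →
      |∫ t in (0 : ℝ)..1, ψ t * partials [] (fun z => (transfer F G)^[n] u (proj z)) (γ t)| ≤
        C * ((1 + CF r G d * c) * geomS d.μ n) * geomNorm r d.χc c 0 u := by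
  obtain ⟨C, hC, hlead⟩ := exists_sum_leading r M hK 0 hr
  refine ⟨C, hC, fun {c n} hc hn {F G d D e} h hF ha {u} hu γ hγ {ψ} hp hψ => ?_⟩
  obtain ⟨g₀, g, η, rfl, b⟩ := h.exists_branches ha hγ
  rw [h.pairing_transfer hF b.chain b.start n hu [] (by simp) hψ.continuous hp]
  have hL := hlead hc hn h b hu hp hψ 0 le_rfl [] rfl
  simp only [mul_zero, pow_zero, mul_one, zero_mul, div_one, zero_add, pow_one] at hL
  refine (Finset.abs_sum_le_sum_abs _ _).trans (le_trans (le_of_eq ?_) hL)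
  refine Finset.sum_congr rfl fun j _ => ?_
  congr 2
  ext s
  simp only [vecDs, List.foldr_nil, jac]
  ring

/-! ### The constants -/

theorem Cmu_mul_pow {Csharp μ : ℝ} (hμ : 1 < μ) (n : ℕ) :
    Cmu Csharp μ n * μ ^ n = Csharp * geomS μ n := by
  have h1 : μ - 1 ≠ 0 := by linarith
  have h2 : μ ^ n ≠ 0 := by positivity
  rw [Cmu, geomS, geom_sum_eq hμ.ne' n]
  field_simp

theorem two_mul_add_one_le_aBar {ρ : ℕ} (hρ : 1 ≤ ρ) : 2 * ρ + 1 ≤ aBar ρ := by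
  have h1 : 1 ≤ aExp ρ := by
    have h2 := Finset.single_le_sum (f := fun k => (ρ - 1)! / k !) (fun _ _ => Nat.zero_le _)
      (Finset.mem_range.2 hρ)
    simp only [Nat.factorial_zero, Nat.div_one] at h2
    exact (Nat.factorial_pos _).trans_le h2
  have h3 : ρ ≤ aExp ρ * ρ ^ 2 := by nlinarith
  unfold aBar
  nlinarith

theorem two_mul_add_one_le_bBar (ρ : ℕ) : 2 * ρ + 1 ≤ bBar ρ := by
  have := Nat.factorial_pos ρ
  unfold bBar
  nlinarith [sq_nonneg ((ρ : ℤ) - 1)]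

/-- The bound obtained for the leading term is within the stated one. -/
theorem Sys.leading_le {r : ℕ} {M : ℝ} {G : ℝ × ℝ → ℝ × ℝ} {d : HypConst} {D : ℕ} {e : ℤ}
    (h : Sys r M G d D e) {C Csharp c : ℝ} (hC : C ≤ Csharp) (hM : 2 * M ^ 2 ≤ Csharp)
    (hc : 1 ≤ c) {n ρ : ℕ} (hn : 1 ≤ n) (hρ : 1 ≤ ρ) :
    C * ((1 + CF r G d * c) * c ^ (ρ ! * ρ) * geomS d.μ n ^ (2 * ρ + 1) / d.lm ^ (ρ * n)) ≤
      cRhoF (CF r G d) c ρ *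
        (Cmu Csharp d.μ n ^ aBar ρ * d.μ ^ (bBar ρ * n) / d.lm ^ (ρ * n)) := by
  have hCF := h.CF_nonneg
  have hμ := h.one_lt_μ
  have hμ0 := h.μ_pos
  have hlm := h.lm_pos
  have hS := one_le_geomS hμ.le hn
  set S := geomS d.μ n with hSd
  have hS0 := zero_le_one.trans hS
  have hCs1 : 1 ≤ Csharp := by nlinarith [h.one_le_M]
  have hL := Cmu_mul_pow (Csharp := Csharp) hμ n
  set L := Cmu Csharp d.μ n with hLd
  -- Needed to raise the exponent 2ρ + 1 to ā_ρ. It holds because μ^n ≤ μS and C_♯ was chosen at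
  -- least 2M² ≥ μ.
  have hL1 : 1 ≤ L := by
    have h1 : d.μ ^ n ≤ Csharp * S := by
      refine (pow_le_mul_geomS hμ.le hn le_rfl).trans ?_
      have : d.μ ≤ Csharp := (h.μ_le_lm.trans h.lm_le).trans hM
      gcongr
    rw [← hL] at h1
    exact (le_mul_iff_one_le_left (by positivity)).1 h1
  have k1 : C * S ^ (2 * ρ + 1) ≤ L ^ aBar ρ * d.μ ^ (bBar ρ * n) := by
    calc C * S ^ (2 * ρ + 1) ≤ Csharp ^ (2 * ρ + 1) * S ^ (2 * ρ + 1) := by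
          refine mul_le_mul_of_nonneg_right (hC.trans ?_) (by positivity)
          exact le_self_pow₀ hCs1 (by omega)
      _ = L ^ (2 * ρ + 1) * d.μ ^ ((2 * ρ + 1) * n) := by
          rw [← mul_pow, ← hL, mul_pow, ← pow_mul, mul_comm n]
      _ ≤ L ^ aBar ρ * d.μ ^ (bBar ρ * n) := by
          refine mul_le_mul (pow_le_pow_right₀ hL1 (two_mul_add_one_le_aBar hρ))
            (pow_le_pow_right₀ hμ.le (Nat.mul_le_mul_right n (two_mul_add_one_le_bBar ρ)))
            (by positivity) (by positivity)
  have k2 : 1 + CF r G d * c ≤ (1 + CF r G d * c ^ ρ !) ^ cBar ρ := by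
    have h1 : 1 + CF r G d * c ≤ 1 + CF r G d * c ^ ρ ! := by
      have : c ≤ c ^ ρ ! := le_self_pow₀ hc (Nat.factorial_pos ρ).ne'
      gcongr
    refine h1.trans (le_self_pow₀ ?_ (by unfold cBar; omega))
    have : 0 ≤ CF r G d * c ^ ρ ! := by positivity
    linarith
  have k3 : c ^ (ρ ! * ρ) ≤ c ^ (ρ ! * (2 * ρ + 1)) :=
    pow_le_pow_right₀ hc (Nat.mul_le_mul_left _ (by omega))
  have hc0 := zero_le_one.trans hc
  have hk2 : 0 ≤ 1 + CF r G d * c := by positivity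
  calc _ = (c ^ (ρ ! * ρ) * (1 + CF r G d * c)) * (C * S ^ (2 * ρ + 1) / d.lm ^ (ρ * n)) := by ring
    _ ≤ (c ^ (ρ ! * ρ) * (1 + CF r G d * c)) *
        (L ^ aBar ρ * d.μ ^ (bBar ρ * n) / d.lm ^ (ρ * n)) := by gcongr
    _ ≤ _ := by
        rw [cRhoF]
        gcongr

end SVPH

/-! ### Assembly of the norm inequality -/

namespace SVPH

/-- Words of length ρ satisfy the main estimate, shorter ones the crude estimate with a norm of
order at most ρ - 1. The constant of the leading term is fixed before c and n, that of the remainder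
after them. -/
theorem exists_geomNorm_transfer (r : ℕ) (M : ℝ) {K : ℝ} (hK : 1 ≤ K) (ρ : ℕ) (hρ1 : 1 ≤ ρ)
    (hρ : ρ + 1 ≤ r) :
    ∃ C : ℝ, 0 ≤ C ∧ ∀ {c : ℝ} {n : ℕ}, 1 ≤ c → 1 ≤ n → ∃ E : ℝ,
    ∀ {F : Torus → Torus} {G : ℝ × ℝ → ℝ × ℝ} {d : HypConst} {D : ℕ} {e : ℤ},
      Sys r M G d D e → IsLift r F G → Admissible r K c n G d →
      ∀ {u : Torus → ℝ}, IsCk (r - 1) u →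
      geomNorm r d.χc c ρ ((transfer F G)^[n] u) ≤
        C * ((1 + CF r G d * c) * c ^ (ρ ! * ρ) * geomS d.μ n ^ (2 * ρ + 1) / d.lm ^ (ρ * n)) *
          geomNorm r d.χc c ρ u + E * geomNorm r d.χc c (ρ - 1) u := by
  obtain ⟨C, hC, hmain⟩ := exists_main_pairing r M hK ρ hρ
  refine ⟨C, hC, fun {c n} hc hn => ?_⟩
  obtain ⟨E, hE, hE'⟩ := hmain hc hn
  have hex : ∀ k, ∃ A : ℝ, 0 ≤ A ∧ (k + 1 ≤ r →
      ∀ {F : Torus → Torus} {G : ℝ × ℝ → ℝ × ℝ} {d : HypConst} {D : ℕ} {e : ℤ},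
      Sys r M G d D e → IsLift r F G → Admissible r K c n G d →
      ∀ {u : Torus → ℝ}, IsCk (r - 1) u → ∀ α : List (Fin 2), α.length = k →
      ∀ γ ∈ Gam r d.χc r c, ∀ {ψ : ℝ → ℝ}, Function.Periodic ψ 1 → Sc k 1 1 ψ →
      |∫ t in (0 : ℝ)..1, ψ t * partials α (fun z => (transfer F G)^[n] u (proj z)) (γ t)| ≤
        A * geomNorm r d.χc c k u) := by
    intro k
    by_cases hk : k + 1 ≤ r
    · obtain ⟨A, hA, hb⟩ := exists_crude_pairing r M hK hc hn k hk
      exact ⟨A, hA, fun _ => hb⟩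
    · exact ⟨0, le_rfl, fun h => absurd h hk⟩
  choose A hA hcr using hex
  have hsum : 0 ≤ ∑ k ∈ Finset.range ρ, A k := Finset.sum_nonneg fun k _ => hA k
  refine ⟨E + ∑ k ∈ Finset.range ρ, A k, fun {F G d D e} h hF ha {u} hu => ?_⟩
  have hg := geomNorm_nonneg (χ := d.χc) (c := c) hu (by omega : ρ ≤ r - 1)
  have hg' := geomNorm_nonneg (χ := d.χc) (c := c) hu (by omega : ρ - 1 ≤ r - 1)
  have hCF := h.CF_nonneg
  have hlm := h.lm_pos
  have hS := zero_le_one.trans (one_le_geomS h.one_lt_μ.le hn)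
  have hlead : 0 ≤ C * ((1 + CF r G d * c) * c ^ (ρ ! * ρ) * geomS d.μ n ^ (2 * ρ + 1) /
      d.lm ^ (ρ * n)) * geomNorm r d.χc c ρ u := by positivity
  have hEg : 0 ≤ E * geomNorm r d.χc c (ρ - 1) u := mul_nonneg hE hg'
  have hsg := mul_nonneg hsum hg'
  rw [add_mul E]
  refine geomNorm_le (by linarith) fun α hα γ hγ ψ hψ hp h1 => (le_abs_self _).trans ?_
  have hs := Sc_circleNorm _ hψ hp
  rw [h1] at hs
  rcases hα.eq_or_lt with hα' | hα'
  · rw [hα'] at hs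
    have := hE' h hF ha hu α hα' γ hγ hp hs
    linarith
  · have h2 := hcr α.length (by omega) h hF ha hu α rfl γ hγ hp hs
    have h3 := Finset.single_le_sum (fun i _ => hA i) (Finset.mem_range.2 hα')
    have h4 := geomNorm_mono (χ := d.χc) (c := c) hu (by omega : α.length ≤ ρ - 1)
      (by omega : ρ - 1 ≤ r - 1)
    have h5 : A α.length * geomNorm r d.χc c α.length u ≤
        (∑ k ∈ Finset.range ρ, A k) * geomNorm r d.χc c (ρ - 1) u :=
      mul_le_mul h3 h4 (geomNorm_nonneg hu (by omega)) hsum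
    linarith

end SVPH

end

theorem theorem4p1 (r : ℕ) (hr : 5 ≤ r) (M : ℝ) :
    -- uniform constants: they depend only on `r` and on the bound `M`
    ∃ (nbar : ℕ) (Cflat Csharp : ℝ) (Cn : ℕ → ℕ → ℝ → ℝ), 1 < Cflat ∧ 0 < Csharp ∧
      ∀ (F : Torus → Torus) (G : ℝ × ℝ → ℝ × ℝ) (d : HypConst),
        IsSVPH r F G d → UniformBound r M G d →
        ∀ c : ℝ, 9 / 4 * Cflat ^ 3 * d.μ ^ (3 * nbar) < c →
        ∀ n : ℕ, nbar < n →
          -- backward invariance of the classes of admissible central curves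
          (∀ l, 1 ≤ l → l ≤ r → ∀ γ ∈ Gam r d.χc l c,
            PreimageSplits r (F^[n]) γ (Gam r d.χc l c)) ∧
          ∀ u : Torus → ℝ, IsCk (r - 1) u →
            IsCk (r - 1) ((transfer F G)^[n] u) ∧
            geomNorm r d.χc c 0 ((transfer F G)^[n] u) ≤
              (1 + CF r G d * c) * (Cmu Csharp d.μ n * d.μ ^ n) * geomNorm r d.χc c 0 u ∧
            ∀ ρ : ℕ, 1 ≤ ρ → ρ ≤ r - 1 →
              geomNorm r d.χc c ρ ((transfer F G)^[n] u) ≤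
                cRhoF (CF r G d) c ρ *
                    (Cmu Csharp d.μ n ^ aBar ρ * d.μ ^ (bBar ρ * n) / d.lm ^ (ρ * n)) *
                    geomNorm r d.χc c ρ u +
                  Cn n ρ c * geomNorm r d.χc c (ρ - 1) u := by
  obtain ⟨nbar, K, hK, hback⟩ := exists_backward_bounds r M
  have hK2 : 1 ≤ 2 * K := by linarith
  obtain ⟨C₀, hC₀, hzero⟩ := exists_zero_pairing r M hK2 (by omega)
  -- All parameters are admitted, with 0 as default value outside the relevant range, so that the
  -- constants can be chosen as functions of ρ, n and c.
  have hex : ∀ ρ, ∃ C : ℝ, 0 ≤ C ∧ ∀ (n : ℕ) (c : ℝ), ∃ E : ℝ,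
      1 ≤ ρ → ρ ≤ r - 1 → 1 ≤ c → 1 ≤ n →
      ∀ {F : Torus → Torus} {G : ℝ × ℝ → ℝ × ℝ} {d : HypConst} {D : ℕ} {e : ℤ},
      Sys r M G d D e → IsLift r F G → Admissible r (2 * K) c n G d →
      ∀ {u : Torus → ℝ}, IsCk (r - 1) u →
      geomNorm r d.χc c ρ ((transfer F G)^[n] u) ≤
        C * ((1 + CF r G d * c) * c ^ (ρ ! * ρ) * geomS d.μ n ^ (2 * ρ + 1) / d.lm ^ (ρ * n)) *
          geomNorm r d.χc c ρ u + E * geomNorm r d.χc c (ρ - 1) u := by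
    intro ρ
    by_cases hρ : 1 ≤ ρ ∧ ρ ≤ r - 1
    · obtain ⟨C, hC, hb⟩ := exists_geomNorm_transfer r M hK2 ρ hρ.1 (by omega)
      refine ⟨C, hC, fun n c => ?_⟩
      by_cases hcn : 1 ≤ c ∧ 1 ≤ n
      · obtain ⟨E, hE⟩ := hb hcn.1 hcn.2
        exact ⟨E, fun _ _ _ _ => hE⟩
      · exact ⟨0, fun _ _ h1 h2 => absurd ⟨h1, h2⟩ hcn⟩
    · exact ⟨0, le_rfl, fun n c => ⟨0, fun h1 h2 => absurd ⟨h1, h2⟩ hρ⟩⟩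
  choose C hC E hE using hex
  -- Large enough for the leading constants of all orders below r, and for the bound 2M² of μ used
  -- in `Sys.leading_le`.
  set Csharp := 1 + 2 * M ^ 2 + C₀ + ∑ ρ ∈ Finset.range r, C ρ with hCs
  have hsum : 0 ≤ ∑ ρ ∈ Finset.range r, C ρ := Finset.sum_nonneg fun ρ _ => hC ρ
  have hM2 : 0 ≤ M ^ 2 := sq_nonneg M
  refine ⟨nbar, 2 * K + 1, Csharp, fun n ρ c => E ρ n c, by linarith, by linarith,
    fun F G d hF hb c hc n hn => ?_⟩
  obtain ⟨D, e, h⟩ := hF.exists_sys hr hb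
  -- Only c ≥ 2K is used. With C_♭ = 2K + 1 and μ > 1, the stated threshold exceeds it.
  have hcK : 2 * K ≤ c := by
    have h1 : 2 * K + 1 ≤ (2 * K + 1) ^ 3 := le_self_pow₀ (by linarith) (by norm_num)
    have h2 : 1 ≤ d.μ ^ (3 * nbar) := one_le_pow₀ h.one_lt_μ.le
    have h3 : (2 * K + 1) ^ 3 ≤ (2 * K + 1) ^ 3 * d.μ ^ (3 * nbar) :=
      le_mul_of_one_le_right (by positivity) h2
    have h4 : 9 / 4 * (2 * K + 1) ^ 3 * d.μ ^ (3 * nbar) =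
        9 / 4 * ((2 * K + 1) ^ 3 * d.μ ^ (3 * nbar)) := by ring
    linarith
  have hc1 : 1 ≤ c := by linarith
  have hn1 : 1 ≤ n := by omega
  have hCF := h.CF_nonneg
  have ha : Admissible r (2 * K) c n G d := ⟨hK2, hc1,
    fun ch h0 i hi hi' => (hback h ch hcK r (by omega) le_rfl h0 i hi hi').1,
    fun ch h0 i hi hi' => (hback h ch hcK r (by omega) le_rfl h0 i hi hi').2 n hn⟩
  refine ⟨fun l hl1 hl γ hγ => h.preimageSplits_iterate hF.lift hl
    (fun ch h0 i hi hi' => (hback h ch hcK l hl1 hl h0 i hi hi').2 n hn) hγ,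
    fun u hu => ⟨h.isCk_transfer_iterate hF.lift n hu, ?_, fun ρ hρ1 hρ => ?_⟩⟩
  · have hg := geomNorm_nonneg (χ := d.χc) (c := c) hu (Nat.zero_le (r - 1))
    have hS := zero_le_one.trans (one_le_geomS h.one_lt_μ.le hn1)
    rw [Cmu_mul_pow h.one_lt_μ]
    refine geomNorm_le (by positivity) fun α hα γ hγ ψ hψ hp h1 => (le_abs_self _).trans ?_
    obtain rfl := List.length_eq_zero_iff.1 (Nat.le_zero.1 hα)
    have hs := Sc_circleNorm _ hψ hp
    rw [h1] at hs
    refine (hzero hc1 hn1 h hF.lift ha hu γ hγ hp hs).trans (mul_le_mul_of_nonneg_right ?_ hg)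
    have hC₀' : C₀ ≤ Csharp := by linarith
    calc C₀ * ((1 + CF r G d * c) * geomS d.μ n)
        ≤ Csharp * ((1 + CF r G d * c) * geomS d.μ n) :=
          mul_le_mul_of_nonneg_right hC₀' (by positivity)
      _ = _ := by ring
  · have hg := geomNorm_nonneg (χ := d.χc) (c := c) hu hρ
    refine (hE ρ n c hρ1 hρ hc1 hn1 h hF.lift ha hu).trans ?_
    have hCρ := Finset.single_le_sum (fun i _ => hC i)
      (Finset.mem_range.2 (by omega : ρ < r))
    exact add_le_add_left (mul_le_mul_of_nonneg_right
      (h.leading_le (by linarith) (by linarith) hc1 hn1 hρ1) hg) _
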